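/- Let $K$ be a field with $\mathrm{char}(K)\neq 2$ and let $\mathcal G=\mathrm{GA}_2(K)$ be the group, under composition, of polynomial automorphisms of the affine plane over $K$: pairs $(P,Q)$ of polynomials in $K[x,y]$ having a polynomial inverse, written $x'=P(x,y),\ y'=Q(x,y)$. Put $\deg(P,Q)=\max(\deg P,\deg Q)$. Let $\mathcal A\subset\mathcal G$ be the affine automorphisms, $\mathcal E\subset\mathcal G$ the elementary ones, $x'=\alpha x+P(y),\ y'=\beta y+v$ with $\alpha\beta\neq0$, and $\mathcal B=\mathcal A\cap\mathcal E$. Let $\mathcal I\subset\mathcal A$ be the set of linear maps with matrix $\left(\begin{smallmatrix}0&1\\1&\beta\end{smallmatrix}\right)$, $\beta\in K$, let $\mathcal J\subset\mathcal E$ be the set of maps $x'=x+y^2P(y),\ y'=y$ with $0\ne P\in K[y]$, and let $T=\left(\begin{smallmatrix}0&1\\1&0\end{smallmatrix}\right)\in\mathcal I$. Every $g\in\mathcal G$ has a unique normal form $g=b\circ w_1\circ\cdots\circ w_k$ with $b\in\mathcal B$, $k\ge0$ and the $w_i$ alternating between $\mathcal I$ and $\mathcal J$. Call $g$ cyclically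 reduced if $k$ is even and positive, and a CR element if it is conjugate in $\mathcal G$ to a cyclically reduced element. The poly-degree $\mathrm{pd}(g)$ is the sequence of the degrees of those $w_i$ that lie in $\mathcal J$, in the order written. By an elementary involution we mean an element of $\mathcal E\setminus\mathcal B$ of the form (E1) $x'=-x+P(y),\ y'=y$, or (E2) $x'=\alpha x+P(y),\ y'=-y+v$ with $\alpha\in\{\pm1\}$, $v\in K$ and $P(v-y)=-\alpha P(y)$. Consider, for $b\in\mathcal B$, $a_i\in\mathcal I$, $e_i\in\mathcal J$ and elementary involutions $\hat e,\bar e$, the elements (1) $c\circ T\circ c^{-1}\circ T$, where $c=b\circ e_m\circ a_{m-1}\circ e_{m-1}\circ\cdots\circ a_1\circ e_1$, $m\ge1$; (2) $c\circ\hat e\circ c^{-1}\circ T$, where $c=b\circ e_m\circ a_{m-1}\circ\cdots\circ e_2\circ a_1$, $m\ge1$ (for $m=1$, $c=b$); (3) $c\circ\hat e\circ c^{-1}\circ\bar e$, where $c=b\circ a_m\circ e_{m-1}\circ a_{m-1}\circ\cdots\circ e_1\circ a_1$, $m\ge1$. Let $f\in\mathcal G$ be a CR element. (a) There is an $r\in\mathcal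 G$ of order $2$ with $r f r^{-1}=f^{-1}$ if and only if $f$ is conjugate in $\mathcal G$ to an element of the form (1), (2), or (3) with $b=1$ in case (3). (b) The equivalence also holds with forms (1)–(3) restricted as follows: $b$ belongs to a prescribed set of representatives of the right cosets in $\mathcal B$ of the centraliser in $\mathcal B$ of the last factor ($T$ in (1) and (2), $\bar e$ in (3)), and $\hat e$, $\bar e$ are each of one of the forms $x'=-x+y^2Q(y),\ y'=y$ with $Q\ne0$; $x'=x+P(y),\ y'=-y$ with $P$ odd of degree $\ge3$; $x'=-x+P(y),\ y'=-y$ with $P$ even of degree $\ge2$. (c) Every element of the form (1)–(3) is cyclically reduced, and its Jacobian determinant is the product of those of the two involutions displayed ($T,T$; $\hat e,T$; $\hat e,\bar e$, respectively), each of which is $\pm1$. Its poly-degree is $(n_m,\dots,n_1,n_1,\dots,n_m)$ in case (1), $(n_m,\dots,n_2,\hat n,n_2,\dots,n_m)$ in case (2), $(n_{m-1},\dots,n_1,\hat n,n_1,\dots,n_{m-1},\bar n)$ in case (3), where $n_i=\deg e_i$, $\hat n=\deg\hat e$, $\bar n=\deg\bar e$. (d) Consequently, if $f$ is conjugate to an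 element of the form (1), (2) or (3), and $f'$ is any cyclically reduced element conjugate to $f$, then $\mathrm{pd}(f')$ is, up to a cyclic permutation, the corresponding sequence in (c), and all its entries are $\ge2$. -/

import Mathlib

open Polynomial

namespace PlaneAut

/-- A polynomial self-map `(x, y) ↦ (P(x, y), Q(x, y))` of the affine plane over `K`
(`x` is `X 0`, `y` is `X 1`). -/
@[ext]
structure PolyMap (K : Type*) [Field K] where
  P : MvPolynomial (Fin 2) K
  Q : MvPolynomial (Fin 2) K

variable {K : Type*} [Field K]

/-- Composition: `(f * g)(x, y) = f (g (x, y))`. -/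
noncomputable instance : Mul (PolyMap K) :=
  ⟨fun f g => ⟨MvPolynomial.aeval ![g.P, g.Q] f.P, MvPolynomial.aeval ![g.P, g.Q] f.Q⟩⟩

noncomputable instance : One (PolyMap K) :=
  ⟨⟨MvPolynomial.X 0, MvPolynomial.X 1⟩⟩

theorem PolyMap.mul_def (f g : PolyMap K) : f * g =
    ⟨MvPolynomial.aeval ![g.P, g.Q] f.P, MvPolynomial.aeval ![g.P, g.Q] f.Q⟩ := rfl

theorem PolyMap.one_def : (1 : PolyMap K) = ⟨MvPolynomial.X 0, MvPolynomial.X 1⟩ := rfl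

theorem PolyMap.aeval_aeval (g h : PolyMap K) (p : MvPolynomial (Fin 2) K) :
    MvPolynomial.aeval ![h.P, h.Q] (MvPolynomial.aeval ![g.P, g.Q] p) =
      MvPolynomial.aeval ![(g * h).P, (g * h).Q] p := by
  have H : (MvPolynomial.aeval ![h.P, h.Q]).comp (MvPolynomial.aeval ![g.P, g.Q]) =
      (MvPolynomial.aeval ![(g * h).P, (g * h).Q] :
        MvPolynomial (Fin 2) K →ₐ[K] MvPolynomial (Fin 2) K) := by
    ext i : 1
    fin_cases i <;> simp [PolyMap.mul_def]
  exact DFunLike.congr_fun H p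

noncomputable instance : Monoid (PolyMap K) where
  mul_assoc f g h := by
    rw [PolyMap.mul_def (f * g) h, PolyMap.mul_def f (g * h), PolyMap.mul_def f g]
    simp only [PolyMap.aeval_aeval]
  one_mul f := by
    simp [PolyMap.mul_def, PolyMap.one_def]
  mul_one f := by
    have h : (![MvPolynomial.X 0, MvPolynomial.X 1] : Fin 2 → MvPolynomial (Fin 2) K)
        = MvPolynomial.X := by
      ext i : 1
      fin_cases i <;> rfl
    simp [PolyMap.mul_def, PolyMap.one_def, h]

/-- The group `GA₂(K)` of polynomial automorphisms of the affine plane: the polynomial maps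
with a polynomial inverse, under composition. -/
abbrev GA2 (K : Type*) [Field K] := (PolyMap K)ˣ

/-- The degree of a polynomial automorphism `(P, Q)`: the maximum of `deg P` and `deg Q`. -/
noncomputable def degree (g : GA2 K) : ℕ := max g.val.P.totalDegree g.val.Q.totalDegree

/-- The determinant of the (formal) Jacobian matrix. -/
noncomputable def jacobianDet (g : GA2 K) : MvPolynomial (Fin 2) K :=
  MvPolynomial.pderiv 0 g.val.P * MvPolynomial.pderiv 1 g.val.Q -
    MvPolynomial.pderiv 1 g.val.P * MvPolynomial.pderiv 0 g.val.Q

/-- `g` is the affine map `x' = m₀₀ x + m₀₁ y + u`, `y' = m₁₀ x + m₁₁ y + v`. -/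
def IsAffineMap (g : GA2 K) (M : Matrix (Fin 2) (Fin 2) K) (u v : K) : Prop :=
  g.val.P = MvPolynomial.C (M 0 0) * MvPolynomial.X 0 + MvPolynomial.C (M 0 1) * MvPolynomial.X 1
    + MvPolynomial.C u ∧
  g.val.Q = MvPolynomial.C (M 1 0) * MvPolynomial.X 0 + MvPolynomial.C (M 1 1) * MvPolynomial.X 1
    + MvPolynomial.C v

/-- `g` is the map `x' = α x + P(y)`, `y' = β y + v`. -/
def IsElemMap (g : GA2 K) (α : K) (P : K[X]) (β v : K) : Prop :=
  g.val.P = MvPolynomial.C α * MvPolynomial.X 0 + Polynomial.aeval (MvPolynomial.X 1) P ∧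
  g.val.Q = MvPolynomial.C β * MvPolynomial.X 1 + MvPolynomial.C v

/-- The affine automorphisms. -/
def affine (K : Type*) [Field K] : Set (GA2 K) :=
  {g | ∃ (M : Matrix (Fin 2) (Fin 2) K) (u v : K), M.det ≠ 0 ∧ IsAffineMap g M u v}

/-- The elementary automorphisms. -/
def elementary (K : Type*) [Field K] : Set (GA2 K) :=
  {g | ∃ (α β v : K) (P : K[X]), α * β ≠ 0 ∧ IsElemMap g α P β v}

/-- The basic automorphisms. -/
def basic (K : Type*) [Field K] : Set (GA2 K) := affine K ∩ elementary K

/-- Affine coset representatives: the linear maps with matrix `(0 1; 1 β)`. -/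
def cosetI (K : Type*) [Field K] : Set (GA2 K) :=
  {g | ∃ β : K, IsAffineMap g !![0, 1; 1, β] 0 0}

/-- Elementary coset representatives: `x' = x + y² P(y)`, `y' = y` with `P ≠ 0`. -/
def cosetJ (K : Type*) [Field K] : Set (GA2 K) :=
  {g | ∃ P : K[X], P ≠ 0 ∧ IsElemMap g 1 (X ^ 2 * P) 1 0}

/-- `g = b ∘ w₁ ∘ ⋯ ∘ wₖ` with `b` basic and the `wᵢ` alternating between the coset
representatives `cosetI` and `cosetJ` (starting and ending with either; `k = 0` allowed). -/
def IsNormalForm (g b : GA2 K) (w : List (GA2 K)) : Prop :=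
  b ∈ basic K ∧ (∀ h ∈ w, h ∈ cosetI K ∪ cosetJ K) ∧
    w.IsChain (fun h h' => (h ∈ cosetI K ∧ h' ∈ cosetJ K) ∨ (h ∈ cosetJ K ∧ h' ∈ cosetI K)) ∧
    g = b * w.prod

/-- `g` has a cyclically reduced normal form: its length is even and positive. -/
def IsCyclicallyReduced (g : GA2 K) : Prop :=
  ∃ b w, IsNormalForm g b w ∧ Even w.length ∧ 0 < w.length

/-- CR elements: the conjugates of elements with a cyclically reduced normal form. -/
def IsCR (g : GA2 K) : Prop := ∃ g', IsConj g g' ∧ IsCyclicallyReduced g'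

open Classical in
/-- `L` is the poly-degree of `g`: the degrees of the elementary factors of the normal form of
`g`, in the order in which they are written. -/
def HasPolyDegree (g : GA2 K) (L : List ℕ) : Prop :=
  ∃ b w, IsNormalForm g b w ∧ L = (w.filter (fun h => h ∈ cosetJ K)).map degree

/-- `f` is reversible with a reversor that is an involution. -/
def IsReversibleByInvolution (f : GA2 K) : Prop :=
  ∃ r : GA2 K, orderOf r = 2 ∧ r * f * r⁻¹ = f⁻¹

/-- The coordinate swap `x' = y`, `y' = x`. -/
noncomputable def swap (K : Type*) [Field K] : GA2 K where
  val := ⟨MvPolynomial.X 1, MvPolynomial.X 0⟩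
  inv := ⟨MvPolynomial.X 1, MvPolynomial.X 0⟩
  val_inv := by simp [PolyMap.mul_def, PolyMap.one_def]
  inv_val := by simp [PolyMap.mul_def, PolyMap.one_def]

/-- The non-basic elementary maps of one of the two shapes
`x' = -x + P(y), y' = y`, or
`x' = α x + P(y), y' = -y + v` with `α = ±1` and `P(v - y) = -α P(y)`. -/
def IsElemInvolution (e : GA2 K) : Prop :=
  e ∉ basic K ∧
    ((∃ P : K[X], IsElemMap e (-1) P 1 0) ∨
     (∃ (α v : K) (P : K[X]), (α = 1 ∨ α = -1) ∧ P.comp (C v - X) = -C α * P ∧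
        IsElemMap e α P (-1) v))

/-- The elementary involutions of one of the three shapes
`x' = -x + y² Q(y), y' = y` with `Q ≠ 0`;
`x' = x + P(y), y' = -y` with `P` odd of degree at least 3;
`x' = -x + P(y), y' = -y` with `P` even of degree at least 2. -/
def IsSpecialElemInvolution (e : GA2 K) : Prop :=
  (∃ Q : K[X], Q ≠ 0 ∧ IsElemMap e (-1) (X ^ 2 * Q) 1 0) ∨
  (∃ P : K[X], P.comp (-X) = -P ∧ 3 ≤ P.natDegree ∧ IsElemMap e 1 P (-1) 0) ∨
  (∃ P : K[X], P.comp (-X) = P ∧ 2 ≤ P.natDegree ∧ IsElemMap e (-1) P (-1) 0)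

/-- The data of the three types of normal forms `c ∘ σ ∘ c⁻¹ ∘ τ`.
* `one b e l`, `l = [(a_{m-1}, e_{m-1}), …, (a_1, e_1)]`:
  `c = b e a_{m-1} e_{m-1} ⋯ a_1 e_1` and `σ = τ = T`;
* `two b l ê`, `l = [(e_m, a_{m-1}), …, (e_2, a_1)]`:
  `c = b e_m a_{m-1} ⋯ e_2 a_1`, `σ = ê` and `τ = T`;
* `three b a l ê ē`, `l = [(e_{m-1}, a_{m-1}), …, (e_1, a_1)]`:
  `c = b a e_{m-1} a_{m-1} ⋯ e_1 a_1`, `σ = ê` and `τ = ē`. -/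
inductive InvForm (K : Type*) [Field K] where
  | one (b e : GA2 K) (l : List (GA2 K × GA2 K))
  | two (b : GA2 K) (l : List (GA2 K × GA2 K)) (ehat : GA2 K)
  | three (b a : GA2 K) (l : List (GA2 K × GA2 K)) (ehat ebar : GA2 K)

namespace InvForm

/-- The product `(p₁ q₁) ⋯ (pₖ qₖ)` of a list of pairs. -/
noncomputable def pairProd (l : List (GA2 K × GA2 K)) : GA2 K :=
  (l.map fun p => p.1 * p.2).prod

/-- The leading element `b`. -/
def lead : InvForm K → GA2 K
  | one b _ _ => b
  | two b _ _ => b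
  | three b _ _ _ _ => b

/-- The conjugating word `c`. -/
noncomputable def word : InvForm K → GA2 K
  | one b e l => b * e * pairProd l
  | two b l _ => b * pairProd l
  | three b a l _ _ => b * a * pairProd l

/-- The first involution `σ`. -/
noncomputable def inner : InvForm K → GA2 K
  | one _ _ _ => swap K
  | two _ _ ehat => ehat
  | three _ _ _ ehat _ => ehat

/-- The last involution `τ`. -/
noncomputable def outer : InvForm K → GA2 K
  | one _ _ _ => swap K
  | two _ _ _ => swap K
  | three _ _ _ _ ebar => ebar

/-- The automorphism `c ∘ σ ∘ c⁻¹ ∘ τ`. -/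
noncomputable def toGA2 (D : InvForm K) : GA2 K :=
  D.word * D.inner * (D.word)⁻¹ * D.outer

/-- The membership conditions on the factors. -/
def WellFormed : InvForm K → Prop
  | one b e l => b ∈ basic K ∧ e ∈ cosetJ K ∧ ∀ p ∈ l, p.1 ∈ cosetI K ∧ p.2 ∈ cosetJ K
  | two b l ehat => b ∈ basic K ∧ (∀ p ∈ l, p.1 ∈ cosetJ K ∧ p.2 ∈ cosetI K) ∧
      IsElemInvolution ehat
  | three b a l ehat ebar => b ∈ basic K ∧ a ∈ cosetI K ∧
      (∀ p ∈ l, p.1 ∈ cosetJ K ∧ p.2 ∈ cosetI K) ∧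
      IsElemInvolution ehat ∧ IsElemInvolution ebar

/-- In the third type, the leading basic element is absent. -/
def LeadAbsentInThree : InvForm K → Prop
  | one _ _ _ => True
  | two _ _ _ => True
  | three b _ _ _ _ => b = 1

/-- The elementary involutions that occur are of the special shapes. -/
def SpecialInvolutions : InvForm K → Prop
  | one _ _ _ => True
  | two _ _ ehat => IsSpecialElemInvolution ehat
  | three _ _ _ ehat ebar => IsSpecialElemInvolution ehat ∧ IsSpecialElemInvolution ebar

/-- The palindromic sequence of degrees `(n_m, …, n_1, n̂, n_1, …, n_m, n̄)`: both `n̂` and `n̄`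
are absent in the first type, `n̄` is absent in the second type, both are present in the third. -/
noncomputable def degrees : InvForm K → List ℕ
  | one _ e l =>
      let d := degree e :: l.map fun p => degree p.2
      d ++ d.reverse
  | two _ l ehat =>
      let d := l.map fun p => degree p.1
      d ++ [degree ehat] ++ d.reverse
  | three _ _ l ehat ebar =>
      let d := l.map fun p => degree p.1
      d ++ [degree ehat] ++ d.reverse ++ [degree ebar]

end InvForm

/-- `R` consists of basic maps and meets every right coset, in the group of basic maps, of the
centraliser of `τ` in that group. -/
def IsRepresentativeSet (R : Set (GA2 K)) (τ : GA2 K) : Prop :=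
  R ⊆ basic K ∧ ∀ b ∈ basic K, ∃ c ∈ basic K, c * τ = τ * c ∧ c * b ∈ R

end PlaneAut

/-! If an involution `r` reverses `f`, then `f = (f r) r` is a product of two elements of square
one. Conversely, if `f = s τ` with `s² = τ² = 1` and `τ ≠ 1`, then `τ` reverses `f`. The task is
therefore to list, up to conjugacy, the products of two such elements that are CR.

This is a question about the amalgam of the affine and elementary groups over their intersection. An
element of square one is conjugate into a factor, since otherwise its square would have a nonempty
reduced word. So `f` is conjugate to `c σ c⁻¹ τ` with `σ`, `τ` in factors. Whenever `σ` or `τ` lies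
in the factor of the adjacent letter of `c`, that letter can be absorbed. A CR element is not
conjugate into a factor, so the process stops at a word without cancellation
(`IsAmalgam.exists_involution_form`). In characteristic other than two, a nonbasic affine involution
is conjugate under basic maps to the swap, and a nonbasic elementary one to a special shape. The
factors containing `σ` and `τ` then distinguish the three forms, up to exchanging the two
involutions.

With `c = b w`, the word `w σ w⁻¹ (b⁻¹ τ)` is reduced of even length, which gives cyclic reducedness
and palindromic degrees. The conjugates of such a word are described by `CycClass`: the reduced
words of even length among them carry the same degrees up to rotation. Affine letters have degree
one and elementary letters degree at least two, so filtering yields the poly-degree.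

The amalgam structure is the theorem of Jung and van der Kulk. Freeness follows from degree growth
along reduced words (`totalDegree_word`). Generation follows from `exists_degree_reduction`, valid
in every characteristic: if the degrees of the components `p`, `q` do not divide each other, a
sequence of key polynomials, controlled by Jacobian brackets, shows that `K[p, q]` has no element of
degree one and so cannot contain `x`. -/

namespace PlaneAut

variable {K : Type*} [Field K]

/-! ### Degree filtration, Jacobian bracket, leading forms. -/

/-- Polynomials in two variables all of whose monomials have degree less than `n`. -/
noncomputable def degLT (K : Type*) [Field K] (n : ℤ) : Submodule K (MvPolynomial (Fin 2) K) :=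
  MvPolynomial.restrictSupport K {m | (m.degree : ℤ) < n}

theorem mem_degLT {n : ℤ} {f : MvPolynomial (Fin 2) K} :
    f ∈ degLT K n ↔ ∀ m, f.coeff m ≠ 0 → (m.degree : ℤ) < n := by
  rw [degLT, MvPolynomial.mem_restrictSupport_iff]
  simp only [Set.subset_def, Finset.mem_coe, MvPolynomial.mem_support_iff, Set.mem_ofPred_eq]

theorem degLT_mono {a b : ℤ} (h : a ≤ b) {f : MvPolynomial (Fin 2) K} (hf : f ∈ degLT K a) :
    f ∈ degLT K b := by
  rw [mem_degLT] at *
  exact fun m hm => (hf m hm).trans_le h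

theorem mem_degLT_of_totalDegree_lt {n : ℤ} {f : MvPolynomial (Fin 2) K}
    (h : (f.totalDegree : ℤ) < n) : f ∈ degLT K n := by
  rw [mem_degLT]
  intro m hm
  have := MvPolynomial.le_totalDegree (MvPolynomial.mem_support_iff.2 hm)
  have h2 : (m.degree : ℤ) ≤ f.totalDegree := by
    rw [Finsupp.degree_eq_sum, ← Finsupp.sum_fintype _ (fun _ e => e) (by simp)]
    exact_mod_cast this
  omega

theorem self_mem_degLT (f : MvPolynomial (Fin 2) K) : f ∈ degLT K (f.totalDegree + 1) :=
  mem_degLT_of_totalDegree_lt (by omega)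

theorem totalDegree_lt_of_mem_degLT {n : ℤ} {f : MvPolynomial (Fin 2) K} (hf : f ∈ degLT K n)
    (h0 : f ≠ 0) : (f.totalDegree : ℤ) < n := by
  obtain ⟨m, hm, hm'⟩ := Finset.exists_mem_eq_sup f.support
    (Finset.nonempty_of_ne_empty (by simpa using h0)) (fun s => s.sum fun _ e => e)
  have h2 : f.totalDegree = m.degree := by
    rw [Finsupp.degree_eq_sum, ← Finsupp.sum_fintype _ (fun _ e => e) (by simp)]
    exact hm'
  rw [h2]
  exact mem_degLT.1 hf m (MvPolynomial.mem_support_iff.1 hm)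

theorem mem_degLT_iff {n : ℤ} {f : MvPolynomial (Fin 2) K} :
    f ∈ degLT K n ↔ f = 0 ∨ (f.totalDegree : ℤ) < n := by
  constructor
  · intro h
    by_cases h0 : f = 0
    · exact Or.inl h0
    · exact Or.inr (totalDegree_lt_of_mem_degLT h h0)
  · rintro (rfl | h)
    · exact zero_mem _
    · exact mem_degLT_of_totalDegree_lt h

/-- Strict bounds by `a` and `b` mean degrees at most `a - 1` and `b - 1`; this accounts for the
`-1`. Integer bounds allow the differences of degrees used later. -/
theorem mul_mem_degLT {a b : ℤ} {f g : MvPolynomial (Fin 2) K} (hf : f ∈ degLT K a)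
    (hg : g ∈ degLT K b) : f * g ∈ degLT K (a + b - 1) := by
  by_cases hf0 : f = 0
  · simp [hf0]
  by_cases hg0 : g = 0
  · simp [hg0]
  have h1 := totalDegree_lt_of_mem_degLT hf hf0
  have h2 := totalDegree_lt_of_mem_degLT hg hg0
  apply mem_degLT_of_totalDegree_lt
  have := MvPolynomial.totalDegree_mul f g
  omega

theorem mul_mem_degLT_left {a n : ℤ} {f : MvPolynomial (Fin 2) K} (g : MvPolynomial (Fin 2) K)
    (hf : f ∈ degLT K a) (h : a + g.totalDegree ≤ n) : g * f ∈ degLT K n :=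
  degLT_mono (by omega) (mul_mem_degLT (self_mem_degLT g) hf)

theorem pow_mem_degLT (f : MvPolynomial (Fin 2) K) (n : ℕ) :
    f ^ n ∈ degLT K (n * f.totalDegree + 1) := by
  apply mem_degLT_of_totalDegree_lt
  have := MvPolynomial.totalDegree_pow f n
  zify at this
  omega

theorem of_mul_mem_degLT {a n : ℤ} {f g : MvPolynomial (Fin 2) K} (hg : g ≠ 0)
    (h : g * f ∈ degLT K n) (ha : n ≤ a + g.totalDegree) : f ∈ degLT K a := by
  rw [mem_degLT_iff] at *
  rcases h with h | h
  · left; simpa [hg] using h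
  · by_cases hf : f = 0
    · exact Or.inl hf
    · right
      rw [MvPolynomial.totalDegree_mul_of_isDomain hg hf] at h
      push_cast at h
      omega

theorem C_mul_mem_degLT {n : ℤ} {f : MvPolynomial (Fin 2) K} (c : K) (hf : f ∈ degLT K n) :
    MvPolynomial.C c * f ∈ degLT K n := by
  rw [← MvPolynomial.smul_eq_C_mul]
  exact Submodule.smul_mem _ _ hf

theorem pderiv_mem_degLT {n : ℤ} {f : MvPolynomial (Fin 2) K} (i : Fin 2) (hf : f ∈ degLT K n) :
    MvPolynomial.pderiv i f ∈ degLT K (n - 1) := by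
  rw [mem_degLT] at *
  intro m hm
  rw [MvPolynomial.coeff_pderiv] at hm
  have := hf _ (left_ne_zero_of_mul hm)
  simp at this
  omega

/-- The Jacobian determinant of a pair of polynomials. -/
noncomputable def bracket (f g : MvPolynomial (Fin 2) K) : MvPolynomial (Fin 2) K :=
  MvPolynomial.pderiv 0 f * MvPolynomial.pderiv 1 g -
    MvPolynomial.pderiv 1 f * MvPolynomial.pderiv 0 g

/-- Two derivatives lower the product bound `a + b - 1` by two more. -/
theorem bracket_mem_degLT {a b : ℤ} {f g : MvPolynomial (Fin 2) K} (hf : f ∈ degLT K a)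
    (hg : g ∈ degLT K b) : bracket f g ∈ degLT K (a + b - 3) := by
  refine sub_mem ?_ ?_ <;>
  exact degLT_mono (by omega)
    (mul_mem_degLT (pderiv_mem_degLT _ hf) (pderiv_mem_degLT _ hg))

theorem bracket_add_left (f g h : MvPolynomial (Fin 2) K) :
    bracket (f + g) h = bracket f h + bracket g h := by
  simp only [bracket, map_add]; ring

theorem bracket_add_right (f g h : MvPolynomial (Fin 2) K) :
    bracket f (g + h) = bracket f g + bracket f h := by
  simp only [bracket, map_add]; ring

theorem bracket_sub_right (f g h : MvPolynomial (Fin 2) K) :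
    bracket f (g - h) = bracket f g - bracket f h := by
  simp only [bracket, map_sub]; ring

theorem bracket_mul_left (f g h : MvPolynomial (Fin 2) K) :
    bracket (f * g) h = f * bracket g h + g * bracket f h := by
  simp only [bracket, MvPolynomial.pderiv_mul]; ring

theorem bracket_mul_right (f g h : MvPolynomial (Fin 2) K) :
    bracket f (g * h) = g * bracket f h + h * bracket f g := by
  simp only [bracket, MvPolynomial.pderiv_mul]; ring

theorem bracket_swap (f g : MvPolynomial (Fin 2) K) : bracket f g = - bracket g f := by
  simp only [bracket]; ring

theorem bracket_self (f : MvPolynomial (Fin 2) K) : bracket f f = 0 := by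
  simp only [bracket]; ring

theorem bracket_C_left (c : K) (f : MvPolynomial (Fin 2) K) :
    bracket (MvPolynomial.C c) f = 0 := by
  simp [bracket]

theorem bracket_C_mul_right (c : K) (f g : MvPolynomial (Fin 2) K) :
    bracket f (MvPolynomial.C c * g) = MvPolynomial.C c * bracket f g := by
  simp only [bracket, MvPolynomial.pderiv_C_mul]; ring

theorem bracket_pow_left (f g : MvPolynomial (Fin 2) K) (n : ℕ) :
    bracket (f ^ n) g = n * f ^ (n - 1) * bracket f g := by
  simp only [bracket, MvPolynomial.pderiv_pow]; ring

theorem bracket_pow_right (f g : MvPolynomial (Fin 2) K) (n : ℕ) :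
    bracket f (g ^ n) = n * g ^ (n - 1) * bracket f g := by
  simp only [bracket, MvPolynomial.pderiv_pow]; ring

/-- The homogeneous component of top degree. -/
noncomputable def leadForm (f : MvPolynomial (Fin 2) K) : MvPolynomial (Fin 2) K :=
  MvPolynomial.homogeneousComponent f.totalDegree f

theorem leadForm_isHomogeneous (f : MvPolynomial (Fin 2) K) :
    (leadForm f).IsHomogeneous f.totalDegree :=
  MvPolynomial.homogeneousComponent_isHomogeneous _ _

theorem homogeneousComponent_eq_zero_of_mem_degLT {n : ℕ} {f : MvPolynomial (Fin 2) K}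
    (hf : f ∈ degLT K n) : MvPolynomial.homogeneousComponent n f = 0 := by
  rcases mem_degLT_iff.1 hf with rfl | h
  · simp
  · exact MvPolynomial.homogeneousComponent_eq_zero _ _ (by exact_mod_cast h)

theorem mem_degLT_of_homogeneousComponent_eq_zero {n : ℕ} {f : MvPolynomial (Fin 2) K}
    (hf : f ∈ degLT K (n + 1)) (h : MvPolynomial.homogeneousComponent n f = 0) :
    f ∈ degLT K n := by
  rw [mem_degLT] at *
  intro m hm
  have h1 := hf m hm
  have h2 : m.degree ≠ n := by
    intro h2
    have := congrArg (MvPolynomial.coeff m) h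
    rw [MvPolynomial.coeff_homogeneousComponent, if_pos h2] at this
    exact hm this
  omega

theorem sub_leadForm_mem (f : MvPolynomial (Fin 2) K) : f - leadForm f ∈ degLT K f.totalDegree := by
  apply mem_degLT_of_homogeneousComponent_eq_zero
  · refine sub_mem (self_mem_degLT f) ?_
    have := (leadForm_isHomogeneous f).totalDegree_le
    exact mem_degLT_of_totalDegree_lt (by omega)
  · rw [map_sub, leadForm, MvPolynomial.homogeneousComponent_eq_self
      (MvPolynomial.homogeneousComponent_isHomogeneous _ _), sub_self]

theorem leadForm_ne_zero {f : MvPolynomial (Fin 2) K} (hf : f ≠ 0) : leadForm f ≠ 0 := by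
  intro h
  have := sub_leadForm_mem f
  rw [h, sub_zero] at this
  exact lt_irrefl _ (totalDegree_lt_of_mem_degLT this hf)

theorem totalDegree_leadForm (f : MvPolynomial (Fin 2) K) :
    (leadForm f).totalDegree = f.totalDegree := by
  by_cases hf : f = 0
  · subst hf; simp [leadForm]
  · exact (leadForm_isHomogeneous f).totalDegree (leadForm_ne_zero hf)

/-- A nonzero form of degree `n` that approximates `f` up to lower degree is its leading form. -/
theorem leadForm_eq_of_sub_mem {n : ℕ} {f l : MvPolynomial (Fin 2) K} (hl : l.IsHomogeneous n)
    (hl0 : l ≠ 0) (h : f - l ∈ degLT K n) : f ≠ 0 ∧ f.totalDegree = n ∧ leadForm f = l := by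
  have hc : MvPolynomial.homogeneousComponent n f = l := by
    have := homogeneousComponent_eq_zero_of_mem_degLT h
    rw [map_sub, MvPolynomial.homogeneousComponent_eq_self hl, sub_eq_zero] at this
    exact this
  have hf0 : f ≠ 0 := by
    rintro rfl
    simp at hc
    exact hl0 hc.symm
  have hle : n ≤ f.totalDegree := by
    by_contra hlt
    rw [MvPolynomial.homogeneousComponent_eq_zero _ _ (by omega)] at hc
    exact hl0 hc.symm
  have hmem : f ∈ degLT K (n + 1) := by
    have h2 : l ∈ degLT K (n + 1) := by
      have := hl.totalDegree_le
      exact mem_degLT_of_totalDegree_lt (by omega)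
    have := add_mem (degLT_mono (by omega) h : f - l ∈ degLT K (n + 1)) h2
    simpa using this
  have hge := totalDegree_lt_of_mem_degLT hmem hf0
  have he : f.totalDegree = n := by omega
  exact ⟨hf0, he, by rw [leadForm, he, hc]⟩

theorem leadForm_mul (f g : MvPolynomial (Fin 2) K) :
    leadForm (f * g) = leadForm f * leadForm g := by
  by_cases hf : f = 0
  · subst hf; simp [leadForm]
  by_cases hg : g = 0
  · subst hg; simp [leadForm]
  refine (leadForm_eq_of_sub_mem ((leadForm_isHomogeneous f).mul (leadForm_isHomogeneous g))
    (mul_ne_zero (leadForm_ne_zero hf) (leadForm_ne_zero hg)) ?_).2.2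
  have : f * g - leadForm f * leadForm g =
      g * (f - leadForm f) + leadForm f * (g - leadForm g) := by ring
  rw [this]
  push_cast
  refine add_mem (mul_mem_degLT_left _ (sub_leadForm_mem f) (by omega))
    (mul_mem_degLT_left _ (sub_leadForm_mem g) ?_)
  rw [totalDegree_leadForm]
  omega

theorem leadForm_C (c : K) : leadForm (MvPolynomial.C c : MvPolynomial (Fin 2) K) =
    MvPolynomial.C c := by
  rw [leadForm, MvPolynomial.totalDegree_C, MvPolynomial.homogeneousComponent_zero]
  simp

theorem leadForm_pow (f : MvPolynomial (Fin 2) K) (n : ℕ) :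
    leadForm (f ^ n) = leadForm f ^ n := by
  induction n with
  | zero => simpa using leadForm_C (1 : K)
  | succ n ih => rw [pow_succ, leadForm_mul, ih, pow_succ]

theorem totalDegree_pow_of_ne_zero {f : MvPolynomial (Fin 2) K} (hf : f ≠ 0) (n : ℕ) :
    (f ^ n).totalDegree = n * f.totalDegree := by
  induction n with
  | zero => simp
  | succ n ih =>
    rw [pow_succ, MvPolynomial.totalDegree_mul_of_isDomain (pow_ne_zero _ hf) hf, ih]; ring

theorem totalDegree_C_mul {c : K} (hc : c ≠ 0) (f : MvPolynomial (Fin 2) K) :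
    (MvPolynomial.C c * f).totalDegree = f.totalDegree := by
  by_cases hf : f = 0
  · simp [hf]
  · rw [MvPolynomial.totalDegree_mul_of_isDomain (by simpa using hc) hf]; simp

/-- Polynomials that agree up to lower degree have the same degree and leading form. -/
theorem leadForm_eq_of_sub_mem_degLT {f g : MvPolynomial (Fin 2) K} (hg : g ≠ 0)
    (h : f - g ∈ degLT K g.totalDegree) :
    f ≠ 0 ∧ f.totalDegree = g.totalDegree ∧ leadForm f = leadForm g := by
  refine leadForm_eq_of_sub_mem (leadForm_isHomogeneous g) (leadForm_ne_zero hg) ?_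
  have : f - leadForm g = (f - g) + (g - leadForm g) := by ring
  rw [this]
  exact add_mem h (sub_leadForm_mem g)

theorem sub_C_mul_mem_degLT {f g : MvPolynomial (Fin 2) K} {c : K}
    (hd : f.totalDegree = g.totalDegree) (h : leadForm f = MvPolynomial.C c * leadForm g) :
    f - MvPolynomial.C c * g ∈ degLT K f.totalDegree := by
  have : f - MvPolynomial.C c * g = (f - leadForm f) - MvPolynomial.C c * (g - leadForm g) := by
    rw [h]; ring
  rw [this]
  refine sub_mem (sub_leadForm_mem f) (C_mul_mem_degLT _ ?_)
  rw [hd]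
  exact sub_leadForm_mem g

/-- Forms whose powers are proportional are proportional. -/
theorem exists_eq_C_mul_of_pow_eq {f g : MvPolynomial (Fin 2) K} {r : ℕ} (hr : r ≠ 0) {c : K}
    (hf : f ≠ 0) (hg : g ≠ 0) (hd : f.totalDegree = g.totalDegree)
    (h : f ^ r = MvPolynomial.C c * g ^ r) : ∃ c' : K, c' ≠ 0 ∧ f = MvPolynomial.C c' * g := by
  -- The polynomial ring is integrally closed, so divisibility of `r`-th powers descends; the
  -- quotient then has degree zero.
  have hdvd : g ∣ f := by
    rw [← IsIntegrallyClosed.pow_dvd_pow_iff hr]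
    exact ⟨_, h.trans (mul_comm _ _)⟩
  obtain ⟨k, rfl⟩ := hdvd
  have hk : k ≠ 0 := right_ne_zero_of_mul hf
  rw [MvPolynomial.totalDegree_mul_of_isDomain hg hk] at hd
  have hk0 : k.totalDegree = 0 := by omega
  rw [MvPolynomial.totalDegree_eq_zero_iff_eq_C] at hk0
  refine ⟨k.coeff 0, ?_, by rw [← hk0, mul_comm]⟩
  intro h0
  rw [h0] at hk0
  exact hk (by simpa using hk0)

/-! ### Key polynomials for the degree function. -/

/-- A stage in the construction of key polynomials for the degree function on `K[p][q]`:
`F` is the evaluation `K[X][Y] → K[x, y]`, `φ` is the current key polynomial, `e` generates the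
group of degrees of the polynomials of smaller `Y`-degree, and `Ω` is the leading coefficient of
the Jacobian pairing with `φ`. -/
structure KeyState (F : K[X][X] →+* MvPolynomial (Fin 2) K) (p : MvPolynomial (Fin 2) K)
    (φ : K[X][X]) (κ e : ℕ) (Ω : MvPolynomial (Fin 2) K) : Prop where
  monic : φ.Monic
  natDegree_pos : 0 < φ.natDegree
  e_pos : 0 < e
  e_dvd : ∀ G, G ≠ 0 → G.natDegree < φ.natDegree → e ∣ (F G).totalDegree
  exists_deg : ∀ v : ℤ, (e : ℤ) ∣ v → (κ : ℤ) < v + p.totalDegree →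
    ∃ G, G ≠ 0 ∧ G.natDegree < φ.natDegree ∧ ((F G).totalDegree : ℤ) = v
  -- Up to constants, leading forms are fractional powers of that of `p`.
  lead : ∀ G, G ≠ 0 → G.natDegree < φ.natDegree → ∃ c : K, c ≠ 0 ∧
    leadForm (F G) ^ p.totalDegree = MvPolynomial.C c * leadForm p ^ (F G).totalDegree
  prod_ne : Ω ≠ 0
  prod_deg : Ω.totalDegree = κ
  bracket_lt : ∀ G H, G.natDegree < φ.natDegree → H.natDegree < φ.natDegree →
    bracket (F G) (F H) ∈ degLT K ((F G).totalDegree + (F H).totalDegree + κ - p.totalDegree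
      - (F φ).totalDegree)
  -- A generalised Euler relation. Its coefficient is the integer `deg (F G) / e`, so it makes sense
  -- in every characteristic.
  bracket_key : ∀ G (k : ℕ), G.natDegree < φ.natDegree → (F G).totalDegree = e * k →
    p * bracket (F G) (F φ) - (k : MvPolynomial (Fin 2) K) * (Ω * F G) ∈
      degLT K (κ + (F G).totalDegree)

namespace KeyState

variable {F : K[X][X] →+* MvPolynomial (Fin 2) K} {p : MvPolynomial (Fin 2) K}
  {φ : K[X][X]} {κ e : ℕ} {Ω : MvPolynomial (Fin 2) K}

theorem map_ne_zero (hF : Function.Injective F) {G : K[X][X]} (hG : G ≠ 0) : F G ≠ 0 :=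
  (map_ne_zero_iff F hF).2 hG

theorem natCast_eq_C (k : ℕ) : (k : MvPolynomial (Fin 2) K) = MvPolynomial.C (k : K) := by simp

/-- The lower bound on the degree of a key polynomial. -/
theorem deg_ge (S : KeyState F p φ κ e Ω) (hF : Function.Injective F) :
    κ + 2 ≤ (F φ).totalDegree + p.totalDegree := by
  -- Of the consecutive integers `κ + 1` and `κ + 2`, at least one is nonzero in `K`.
  obtain ⟨k, hk, hkK⟩ : ∃ k : ℕ, κ < k ∧ (k : K) ≠ 0 := by
    by_cases h : ((κ + 1 : ℕ) : K) = 0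
    · refine ⟨κ + 2, by omega, ?_⟩
      push_cast at h ⊢
      rw [show (κ : K) + 2 = (κ + 1) + 1 by ring, h]
      simp
    · exact ⟨κ + 1, by omega, h⟩
  have hek : κ < e * k := lt_of_lt_of_le hk (Nat.le_mul_of_pos_left _ S.e_pos)
  obtain ⟨G, hG0, hGd, hGt⟩ := S.exists_deg ((e * k : ℕ) : ℤ) ⟨k, by push_cast; ring⟩ (by omega)
  have hGt' : (F G).totalDegree = e * k := by exact_mod_cast hGt
  have h1 := S.bracket_key G k hGd hGt'
  -- By `bracket_key`, `p * bracket (F G) (F φ)` has the main term `k Ω F G`, of degree exactly `κ +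
  -- deg (F G)`. If the bound failed, the trivial estimate of the bracket would leave no room for
  -- this term.
  by_contra hlt
  have h2 : p * bracket (F G) (F φ) ∈ degLT K (κ + (F G).totalDegree) :=
    mul_mem_degLT_left _ (bracket_mem_degLT (self_mem_degLT (F G)) (self_mem_degLT (F φ)))
      (by omega)
  have h3 := sub_mem h2 h1
  rw [sub_sub_cancel, natCast_eq_C] at h3
  have hFG := map_ne_zero hF hG0
  have h4 := totalDegree_lt_of_mem_degLT h3
    (mul_ne_zero ((map_ne_zero_iff _ (MvPolynomial.C_injective _ _)).2 hkK) (mul_ne_zero S.prod_ne hFG))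
  rw [totalDegree_C_mul hkK, MvPolynomial.totalDegree_mul_of_isDomain S.prod_ne hFG,
    S.prod_deg] at h4
  push_cast at h4
  omega

theorem totalDegree_mul_pow (hF : Function.Injective F) (hφ : φ ≠ 0) {A : K[X][X]} (hA : A ≠ 0)
    (i : ℕ) : (F A * F φ ^ i).totalDegree = (F A).totalDegree + i * (F φ).totalDegree := by
  rw [MvPolynomial.totalDegree_mul_of_isDomain (map_ne_zero hF hA)
    (pow_ne_zero _ (map_ne_zero hF hφ)), totalDegree_pow_of_ne_zero (map_ne_zero hF hφ)]

/-- Polynomials of `Y`-degree less than `n · deg φ` are, up to lower degree, of the form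
`A φ ^ i`. -/
theorem exists_lead_term (S : KeyState F p φ κ e Ω) (hF : Function.Injective F) {n : ℕ}
    (hn : ∀ i, 0 < i → i < n → ¬ e ∣ i * (F φ).totalDegree) {k : ℕ} (hk : k ≤ n) {G : K[X][X]}
    (hG : G ≠ 0) (hGd : G.natDegree < k * φ.natDegree) :
    ∃ i < k, ∃ A, A ≠ 0 ∧ A.natDegree < φ.natDegree ∧
      (F G).totalDegree = (F A).totalDegree + i * (F φ).totalDegree ∧
      leadForm (F G) = leadForm (F A) * leadForm (F φ) ^ i ∧
      F G - F A * F φ ^ i ∈ degLT K (F G).totalDegree := by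
  have hφ0 : φ ≠ 0 := S.monic.ne_zero
  suffices h : ∃ i < k, ∃ A, A ≠ 0 ∧ A.natDegree < φ.natDegree ∧
      F G - F A * F φ ^ i ∈ degLT K ((F A * F φ ^ i).totalDegree) by
    obtain ⟨i, hi, A, hA, hAd, hm⟩ := h
    obtain ⟨_, hd, hl⟩ := leadForm_eq_of_sub_mem_degLT
      (mul_ne_zero (map_ne_zero hF hA) (pow_ne_zero _ (map_ne_zero hF hφ0))) hm
    refine ⟨i, hi, A, hA, hAd, ?_, ?_, ?_⟩
    · rw [hd, totalDegree_mul_pow hF hφ0 hA]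
    · rw [hl, leadForm_mul, leadForm_pow]
    · rwa [hd]
  induction k generalizing G with
  | zero => simp at hGd
  | succ k ih =>
    -- The lowest digit of the `φ`-adic expansion is split off; the quotient has a dominating term
    -- by induction.
    have hdecomp := modByMonic_add_div G φ
    set G₀ := G %ₘ φ with hG₀
    set G' := G /ₘ φ with hG'
    have hφ1 : φ ≠ 1 := by
      intro h
      have := S.natDegree_pos
      rw [h] at this
      simp at this
    have hG₀d : G₀.natDegree < φ.natDegree := natDegree_modByMonic_lt G S.monic hφ1
    by_cases hG'0 : G' = 0
    · rw [hG'0, mul_zero, add_zero] at hdecomp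
      refine ⟨0, by omega, G₀, by rwa [hdecomp], hG₀d, ?_⟩
      simp [hdecomp]
    have hG'd : G'.natDegree < k * φ.natDegree := by
      have h1 : G'.natDegree = G.natDegree - φ.natDegree := natDegree_divByMonic G S.monic
      have h2 : φ.natDegree ≤ G.natDegree := by
        by_contra hlt
        apply hG'0
        rw [hG', divByMonic_eq_zero_iff S.monic]
        exact degree_lt_degree (by omega)
      rw [add_mul, one_mul] at hGd
      omega
    obtain ⟨i, hi, A, hA, hAd, hm⟩ := ih (by omega) hG'0 hG'd
    have hFG : F G = F G₀ + F φ * F G' := by rw [← map_mul, ← map_add, hdecomp]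
    have hmul : F φ * (F G' - F A * F φ ^ i) ∈ degLT K ((F A * F φ ^ (i + 1)).totalDegree) := by
      apply mul_mem_degLT_left _ hm
      rw [totalDegree_mul_pow hF hφ0 hA, totalDegree_mul_pow hF hφ0 hA]
      push_cast
      linarith
    by_cases hG₀0 : G₀ = 0
    · refine ⟨i + 1, by omega, A, hA, hAd, ?_⟩
      rw [hFG, hG₀0, map_zero, zero_add, show F φ * F G' - F A * F φ ^ (i + 1) =
        F φ * (F G' - F A * F φ ^ i) by ring]
      exact hmul
    rcases lt_trichotomy (F G₀).totalDegree ((F A * F φ ^ (i + 1)).totalDegree) with h | h | h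
    · refine ⟨i + 1, by omega, A, hA, hAd, ?_⟩
      rw [hFG, show F G₀ + F φ * F G' - F A * F φ ^ (i + 1) =
        F G₀ + F φ * (F G' - F A * F φ ^ i) by ring]
      exact add_mem (mem_degLT_of_totalDegree_lt (by exact_mod_cast h)) hmul
    -- Degrees of digits are multiples of `e`, so a tie would make `e` divide `(i + 1) · deg (F φ)`.
    · exfalso
      rw [totalDegree_mul_pow hF hφ0 hA] at h
      refine hn (i + 1) (by omega) (by omega) ?_
      rw [← Nat.dvd_add_right (S.e_dvd A hA hAd), ← h]
      exact S.e_dvd _ hG₀0 hG₀d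
    · refine ⟨0, by omega, G₀, hG₀0, hG₀d, ?_⟩
      rw [hFG, pow_zero, mul_one, add_sub_cancel_left,
        show F φ * F G' = F φ * (F G' - F A * F φ ^ i) + F A * F φ ^ (i + 1) by ring]
      exact add_mem (degLT_mono (by exact_mod_cast h.le) hmul)
        (mem_degLT_of_totalDegree_lt (by exact_mod_cast h))

theorem natDegree_mul_pow_lt (hφ : φ.Monic) {A : K[X][X]} (hAd : A.natDegree < φ.natDegree)
    {i n : ℕ} (hi : i < n) : (A * φ ^ i).natDegree < n * φ.natDegree := by
  refine lt_of_le_of_lt natDegree_mul_le ?_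
  rw [hφ.natDegree_pow]
  nlinarith

/-- An additive estimate on the terms `A φ ^ i` extends to all polynomials. -/
theorem bound_of_terms (S : KeyState F p φ κ e Ω) (hF : Function.Injective F) {n : ℕ}
    (hn : ∀ i, 0 < i → i < n → ¬ e ∣ i * (F φ).totalDegree)
    (T : MvPolynomial (Fin 2) K → MvPolynomial (Fin 2) K) (hT : ∀ a b, T (a + b) = T a + T b)
    (s : ℤ) (h : ∀ (A : K[X][X]) (i : ℕ), A ≠ 0 → A.natDegree < φ.natDegree → i < n →
      T (F A * F φ ^ i) ∈ degLT K ((F A).totalDegree + i * (F φ).totalDegree + s))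
    {G : K[X][X]} (hGd : G.natDegree < n * φ.natDegree) :
    T (F G) ∈ degLT K ((F G).totalDegree + s) := by
  have hT0 : T 0 = 0 := by simpa using hT 0 0
  -- Subtracting the dominating term lowers the degree, so the remainder satisfies an even better
  -- estimate.
  induction hd : (F G).totalDegree using Nat.strong_induction_on generalizing G with
  | _ d ih =>
    by_cases hG : G = 0
    · simp [hG, hT0]
    obtain ⟨i, hi, A, hA, hAd, hdeg, -, hm⟩ := S.exists_lead_term hF hn le_rfl hG hGd
    have hrest : T (F (G - A * φ ^ i)) ∈ degLT K (d + s) := by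
      by_cases h0 : G - A * φ ^ i = 0
      · simp [h0, hT0]
      have hlt : (F (G - A * φ ^ i)).totalDegree < d := by
        have h1 : F (G - A * φ ^ i) ∈ degLT K (F G).totalDegree := by simpa using hm
        have := totalDegree_lt_of_mem_degLT h1 (map_ne_zero hF h0)
        omega
      refine degLT_mono (by omega) (ih _ hlt ?_ rfl)
      exact lt_of_le_of_lt (natDegree_sub_le _ _)
        (max_lt hGd (natDegree_mul_pow_lt S.monic hAd hi))
    have heq : F G = F A * F φ ^ i + F (G - A * φ ^ i) := by simp
    rw [heq, hT]
    refine add_mem ?_ hrest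
    have := h A i hA hAd hi
    rw [← hd, hdeg]
    push_cast
    exact this

/-- The main term in `bracket_key` has degree at most `κ + deg (F A)`; the factor `p` is cancelled.
-/
theorem bracket_key_le (S : KeyState F p φ κ e Ω) (hp : p ≠ 0) {A : K[X][X]}
    (hAd : A.natDegree < φ.natDegree) :
    bracket (F A) (F φ) ∈ degLT K ((F A).totalDegree + (κ - p.totalDegree + 1)) := by
  by_cases hA : A = 0
  · simp [hA, bracket]
  obtain ⟨k, hk⟩ := S.e_dvd A hA hAd
  have h1 := S.bracket_key A k hAd hk
  have h2 : (k : MvPolynomial (Fin 2) K) * (Ω * F A) ∈ degLT K (κ + (F A).totalDegree + 1) := by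
    rw [natCast_eq_C]
    refine C_mul_mem_degLT _ (mul_mem_degLT_left _ (self_mem_degLT _) ?_)
    rw [S.prod_deg]
    omega
  have h3 := add_mem (degLT_mono (by omega : _ ≤ (κ : ℤ) + (F A).totalDegree + 1) h1) h2
  rw [sub_add_cancel] at h3
  exact of_mul_mem_degLT hp h3 (by omega)

section Step
variable {n : ℕ}

/-- This estimate and the next two extend the bracket bounds from `Y`-degree below `deg φ` to below
`n · deg φ`. Here powers of `φ` contribute nothing, as `bracket (F φ) (F φ) = 0`. -/
theorem bracket_phi_le (S : KeyState F p φ κ e Ω) (hF : Function.Injective F) (hp : p ≠ 0)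
    (hn : ∀ i, 0 < i → i < n → ¬ e ∣ i * (F φ).totalDegree) {G : K[X][X]}
    (hGd : G.natDegree < n * φ.natDegree) :
    bracket (F G) (F φ) ∈ degLT K ((F G).totalDegree + (κ - p.totalDegree + 1)) := by
  refine S.bound_of_terms hF hn (fun f => bracket f (F φ)) (fun a b => bracket_add_left a b _)
    _ ?_ hGd
  intro A i hA hAd _
  rw [bracket_mul_left, bracket_pow_left, bracket_self, mul_zero, mul_zero, zero_add]
  refine degLT_mono ?_ (mul_mem_degLT (pow_mem_degLT (F φ) i) (S.bracket_key_le hp hAd))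
  omega

/-- The strict inequality of `bracket_lt` weakens by one, because differentiating `φ ^ i` brings in
`bracket (F φ) (F H)`, which is bounded only by `bracket_key_le`. -/
theorem bracket_small_le (S : KeyState F p φ κ e Ω) (hF : Function.Injective F) (hp : p ≠ 0)
    (hn : ∀ i, 0 < i → i < n → ¬ e ∣ i * (F φ).totalDegree) {G H : K[X][X]}
    (hGd : G.natDegree < n * φ.natDegree) (hHd : H.natDegree < φ.natDegree) :
    bracket (F G) (F H) ∈ degLT K ((F G).totalDegree +
      ((F H).totalDegree + κ - p.totalDegree - (F φ).totalDegree + 1)) := by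
  refine S.bound_of_terms hF hn (fun f => bracket f (F H)) (fun a b => bracket_add_left a b _)
    _ ?_ hGd
  intro A i hA hAd _
  rw [bracket_mul_left, bracket_pow_left]
  refine add_mem ?_ ?_
  · rcases i with _ | i
    · simp
    rw [natCast_eq_C, Nat.add_sub_cancel, show F A * (MvPolynomial.C ((i + 1 : ℕ) : K) * F φ ^ i *
      bracket (F φ) (F H)) = MvPolynomial.C ((i + 1 : ℕ) : K) *
        (F A * (F φ ^ i * bracket (F φ) (F H))) by ring, bracket_swap]
    refine C_mul_mem_degLT _ (degLT_mono ?_ (mul_mem_degLT (self_mem_degLT (F A))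
      (mul_mem_degLT (pow_mem_degLT (F φ) i) (neg_mem (S.bracket_key_le hp hHd)))))
    push_cast
    linarith
  · refine degLT_mono ?_ (mul_mem_degLT (pow_mem_degLT (F φ) i) (S.bracket_lt A H hAd hHd))
    omega

theorem bracket_le (S : KeyState F p φ κ e Ω) (hF : Function.Injective F) (hp : p ≠ 0)
    (hn : ∀ i, 0 < i → i < n → ¬ e ∣ i * (F φ).totalDegree) {G H : K[X][X]}
    (hGd : G.natDegree < n * φ.natDegree) (hHd : H.natDegree < n * φ.natDegree) :
    bracket (F G) (F H) ∈ degLT K ((F H).totalDegree +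
      ((F G).totalDegree + κ - p.totalDegree - (F φ).totalDegree + 1)) := by
  refine S.bound_of_terms hF hn (fun f => bracket (F G) f) (fun a b => bracket_add_right _ a b)
    _ ?_ hHd
  intro A i hA hAd _
  rw [bracket_mul_right, bracket_pow_right]
  refine add_mem ?_ ?_
  · rcases i with _ | i
    · simp
    rw [natCast_eq_C, Nat.add_sub_cancel, show F A * (MvPolynomial.C ((i + 1 : ℕ) : K) * F φ ^ i *
      bracket (F G) (F φ)) = MvPolynomial.C ((i + 1 : ℕ) : K) *
        (F A * (F φ ^ i * bracket (F G) (F φ))) by ring]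
    refine C_mul_mem_degLT _ (degLT_mono ?_ (mul_mem_degLT (self_mem_degLT (F A))
      (mul_mem_degLT (pow_mem_degLT (F φ) i) (S.bracket_phi_le hF hp hn hGd))))
    push_cast
    linarith
  · refine degLT_mono ?_ (mul_mem_degLT (pow_mem_degLT (F φ) i)
      (S.bracket_small_le hF hp hn hGd hAd))
    omega

/-- The summand `n * k₁` comes from bracketing `A` with `φ ^ n`. The summand `i * k₂` comes from
bracketing `φ ^ i` with `c H`, where `c H` may be replaced by `φ ^ n` up to lower degree. -/
theorem bracket_key_term (S : KeyState F p φ κ e Ω) (hn0 : 0 < n) {c : K}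
    {H : K[X][X]} (hHd : H.natDegree < φ.natDegree)
    (hHt : (F H).totalDegree = n * (F φ).totalDegree)
    (hred : F φ ^ n - MvPolynomial.C c * F H ∈ degLT K (n * (F φ).totalDegree : ℕ))
    {A : K[X][X]} (hAd : A.natDegree < φ.natDegree) {k₁ k₂ : ℕ} (hk₁ : (F A).totalDegree = e * k₁)
    (hk₂ : (F H).totalDegree = e * k₂) (i : ℕ) :
    p * bracket (F A * F φ ^ i) (F φ ^ n - MvPolynomial.C c * F H) -
      ((n * k₁ + i * k₂ : ℕ) : MvPolynomial (Fin 2) K) *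
        (F φ ^ (n - 1) * Ω * (F A * F φ ^ i)) ∈
      degLT K (κ + (n - 1 : ℕ) * (F φ).totalDegree + ((F A).totalDegree +
        i * (F φ).totalDegree)) := by
  obtain ⟨m, rfl⟩ : ∃ m, n = m + 1 := ⟨n - 1, by omega⟩
  have h1 := S.bracket_key A k₁ hAd hk₁
  have h2 := S.bracket_lt A H hAd hHd
  have h3 := S.bracket_key H k₂ hHd hk₂
  rw [hHt] at h2 h3
  have hf := fun i => pow_mem_degLT (F φ) i
  set f := F φ
  set a := F A
  set h := F H
  simp only [Nat.add_sub_cancel]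
  push_cast at h2 h3 hred ⊢
  rcases i with _ | i
  · have : p * bracket (a * f ^ 0) (f ^ (m + 1) - MvPolynomial.C c * h) -
        (((m : MvPolynomial (Fin 2) K) + 1) * (k₁ : MvPolynomial (Fin 2) K) +
          ((0 : ℕ) : MvPolynomial (Fin 2) K) * (k₂ : MvPolynomial (Fin 2) K)) * (f ^ m * Ω * (a * f ^ 0)) =
        ((m + 1 : ℕ) : MvPolynomial (Fin 2) K) * (f ^ m * (p * bracket a f - (k₁ : MvPolynomial (Fin 2) K) * (Ω * a)))
        - MvPolynomial.C c * (p * bracket a h) := by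
      rw [pow_zero, mul_one, bracket_sub_right, bracket_C_mul_right, bracket_pow_right,
        Nat.add_sub_cancel]
      push_cast
      ring
    rw [this]
    refine sub_mem ?_ ?_
    · rw [natCast_eq_C]
      refine C_mul_mem_degLT _ (degLT_mono ?_ (mul_mem_degLT (hf m) h1))
      simp only [Nat.cast_zero, zero_mul]
      linarith
    · refine C_mul_mem_degLT _ (mul_mem_degLT_left _ h2 ?_)
      simp only [Nat.cast_zero, zero_mul]
      linarith
  -- An exact Leibniz expansion: the summands are controlled by `h1`, `h2`, `h3` and `hred`
  -- respectively.
  · have : p * bracket (a * f ^ (i + 1)) (f ^ (m + 1) - MvPolynomial.C c * h) -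
        (((m : MvPolynomial (Fin 2) K) + 1) * (k₁ : MvPolynomial (Fin 2) K) +
          ((i + 1 : ℕ) : MvPolynomial (Fin 2) K) * (k₂ : MvPolynomial (Fin 2) K)) *
          (f ^ m * Ω * (a * f ^ (i + 1))) =
        ((m + 1 : ℕ) : MvPolynomial (Fin 2) K) * (f ^ (m + i + 1) *
          (p * bracket a f - (k₁ : MvPolynomial (Fin 2) K) * (Ω * a)))
        - MvPolynomial.C c * (f ^ (i + 1) * (p * bracket a h))
        + ((i + 1 : ℕ) : MvPolynomial (Fin 2) K) * (MvPolynomial.C c * (f ^ i * (a *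
          (p * bracket h f - (k₂ : MvPolynomial (Fin 2) K) * (Ω * h)))))
        - ((i + 1 : ℕ) : MvPolynomial (Fin 2) K) * ((k₂ : MvPolynomial (Fin 2) K) * (f ^ i * (a *
          (Ω * (f ^ (m + 1) - MvPolynomial.C c * h))))) := by
      rw [bracket_mul_left, bracket_sub_right, bracket_sub_right, bracket_C_mul_right,
        bracket_C_mul_right, bracket_pow_left, bracket_pow_left, bracket_pow_right,
        bracket_pow_right, Nat.add_sub_cancel, Nat.add_sub_cancel, bracket_self, bracket_swap f h]
      push_cast
      ring
    rw [this]
    have hΩ := S.prod_deg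
    refine sub_mem (add_mem (sub_mem ?_ ?_) ?_) ?_
    · rw [natCast_eq_C]
      refine C_mul_mem_degLT _ (degLT_mono ?_ (mul_mem_degLT (hf _) h1))
      push_cast
      linarith
    · refine C_mul_mem_degLT _ (degLT_mono ?_ (mul_mem_degLT (hf _)
        (mul_mem_degLT (self_mem_degLT p) h2)))
      push_cast
      linarith
    · rw [natCast_eq_C]
      refine C_mul_mem_degLT _ (C_mul_mem_degLT _ (degLT_mono ?_ (mul_mem_degLT (hf _)
        (mul_mem_degLT (self_mem_degLT a) h3))))
      push_cast
      linarith
    · rw [natCast_eq_C, natCast_eq_C]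
      refine C_mul_mem_degLT _ (C_mul_mem_degLT _ (degLT_mono ?_ (mul_mem_degLT (hf _)
        (mul_mem_degLT (self_mem_degLT a) (mul_mem_degLT (self_mem_degLT Ω) hred)))))
      rw [hΩ]
      push_cast
      linarith

end Step

/-- The next key polynomial. -/
theorem step (S : KeyState F p φ κ e Ω) (hF : Function.Injective F)
    (hFC : ∀ c : K, F (C (C c)) = MvPolynomial.C c) (hp : 0 < p.totalDegree)
    (hδ : 2 ≤ (F φ).totalDegree)
    (hone : ∀ G, G.natDegree < φ.natDegree → (F G).totalDegree ≠ 1) {c₀ : K} (hc₀ : c₀ ≠ 0)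
    (hlead : leadForm (F φ) ^ p.totalDegree =
      MvPolynomial.C c₀ * leadForm p ^ (F φ).totalDegree) :
    ∃ n e' φ', 0 < n ∧ e = n * e' ∧ (e ∣ (F φ).totalDegree ∨ 2 ≤ n) ∧
      φ'.natDegree = n * φ.natDegree ∧ (F φ').totalDegree < n * (F φ).totalDegree ∧
      (∀ G, G.natDegree < φ'.natDegree → (F G).totalDegree ≠ 1) ∧
      KeyState F p φ' (κ + (n - 1) * (F φ).totalDegree) e' (F φ ^ (n - 1) * Ω) := by
  have hp0 : p ≠ 0 := by rintro rfl; simp at hp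
  have hφ0 : φ ≠ 0 := S.monic.ne_zero
  have hf0 : F φ ≠ 0 := map_ne_zero hF hφ0
  have hge := S.deg_ge hF
  have hepos := S.e_pos
  set δ := (F φ).totalDegree with hδdef
  -- With `e' = gcd e δ`, the number `n = e / e'` is the least positive one for which `n δ` is a
  -- multiple of `e`.
  obtain ⟨e', n, δ', he'pos, hcop, hen, hδ'⟩ : ∃ e' n δ' : ℕ, 0 < e' ∧ Nat.Coprime n δ' ∧
      e = n * e' ∧ δ = δ' * e' := by
    obtain ⟨n, δ', h1, h2, h3⟩ := Nat.exists_coprime e δ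
    exact ⟨Nat.gcd e δ, n, δ', Nat.gcd_pos_of_pos_left _ hepos, h1, h2, h3⟩
  have hn0 : 0 < n := Nat.pos_of_ne_zero (by rintro rfl; simp at hen; omega)
  have hn : ∀ i, 0 < i → i < n → ¬ e ∣ i * δ := by
    intro i hi hin hdvd
    rw [hen, hδ', ← mul_assoc] at hdvd
    have := hcop.dvd_of_dvd_mul_right (Nat.dvd_of_mul_dvd_mul_right he'pos hdvd)
    exact absurd (Nat.le_of_dvd hi this) (by omega)
  have hnδ : n * δ = e * δ' := by rw [hen, hδ']; ring
  have hδle : δ ≤ n * δ := Nat.le_mul_of_pos_left _ hn0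
  -- The lower bound `deg_ge` places `n δ ≥ δ` above the threshold of `exists_deg`.
  obtain ⟨H, hH0, hHd, hHt⟩ := S.exists_deg ((n * δ : ℕ) : ℤ) ⟨δ', by rw [hnδ]; push_cast; ring⟩
    (by omega)
  replace hHt : (F H).totalDegree = n * δ := by exact_mod_cast hHt
  have hFH := map_ne_zero hF hH0
  obtain ⟨c₁, hc₁, hHl⟩ := S.lead H hH0 hHd
  -- The `deg p`-th powers of both leading forms are multiples of `leadForm p ^ (n δ)`. Hence `φ ^ n
  -- - c H` loses its top degree and is the next key polynomial.
  obtain ⟨c, hc, hcl⟩ : ∃ c : K, c ≠ 0 ∧ leadForm (F φ ^ n) = MvPolynomial.C c * leadForm (F H) := by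
    refine exists_eq_C_mul_of_pow_eq (r := p.totalDegree) hp.ne' (c := c₀ ^ n * c₁⁻¹)
      (leadForm_ne_zero (pow_ne_zero _ hf0)) (leadForm_ne_zero hFH) ?_ ?_
    · rw [totalDegree_leadForm, totalDegree_leadForm, totalDegree_pow_of_ne_zero hf0, hHt]
    · rw [leadForm_pow, ← pow_mul, mul_comm, pow_mul, hlead, mul_pow, hHl, hHt, ← mul_assoc,
        ← MvPolynomial.C_mul, mul_assoc, inv_mul_cancel₀ hc₁, mul_one, ← pow_mul, mul_comm δ n,
        MvPolynomial.C_pow]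
  have hred : F φ ^ n - MvPolynomial.C c * F H ∈ degLT K (n * δ : ℕ) := by
    have := sub_C_mul_mem_degLT (f := F φ ^ n) (g := F H)
      (by rw [totalDegree_pow_of_ne_zero hf0, hHt]) hcl
    rwa [totalDegree_pow_of_ne_zero hf0] at this
  set φ' : K[X][X] := φ ^ n - C (C c) * H with hφ'
  have hFφ' : F φ' = F φ ^ n - MvPolynomial.C c * F H := by rw [hφ']; simp [hFC]
  have hNn : φ.natDegree ≤ n * φ.natDegree := Nat.le_mul_of_pos_left _ hn0
  have hdegH : (C (C c) * H).natDegree < (φ ^ n).natDegree := by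
    rw [S.monic.natDegree_pow]
    exact lt_of_le_of_lt (natDegree_C_mul_le _ _) (by omega)
  have hmonic' : φ'.Monic := by
    refine (S.monic.pow n).sub_of_left ?_
    exact degree_lt_degree hdegH
  have hdeg' : φ'.natDegree = n * φ.natDegree := by
    rw [hφ', natDegree_sub_eq_left_of_natDegree_lt hdegH, S.monic.natDegree_pow]
  have hφ't : (F φ').totalDegree < n * δ := by
    have := totalDegree_lt_of_mem_degLT (hFφ' ▸ hred) (map_ne_zero hF hmonic'.ne_zero)
    exact_mod_cast this
  refine ⟨n, e', φ', hn0, hen, ?_, hdeg', hφ't, ?_, ?_⟩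
  · by_cases h1 : n = 1
    · left
      rw [hen, hδ', h1, one_mul]
      exact Dvd.intro_left δ' rfl
    · right; omega
  · intro G hGd
    rw [hdeg'] at hGd
    by_cases hG : G = 0
    · simp [hG]
    obtain ⟨i, hi, A, hA, hAd, hdeg, -⟩ := S.exists_lead_term hF hn le_rfl hG hGd
    rw [hdeg]
    rcases i with _ | i
    · simpa using hone A hAd
    · rw [add_mul]
      omega
  have hκ : ((κ + (n - 1) * δ : ℕ) : ℤ) = κ + (n - 1 : ℕ) * δ := by push_cast; ring
  have hκ' : ((n - 1 : ℕ) : ℤ) * δ = n * δ - δ := by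
    rw [Nat.cast_sub hn0]; push_cast; ring
  constructor
  · exact hmonic'
  · rw [hdeg']; exact Nat.mul_pos hn0 S.natDegree_pos
  · exact he'pos
  · intro G hG hGd
    rw [hdeg'] at hGd
    obtain ⟨i, hi, A, hA, hAd, hdeg, -⟩ := S.exists_lead_term hF hn le_rfl hG hGd
    rw [hdeg]
    refine dvd_add ((Dvd.intro_left n hen.symm).trans (S.e_dvd A hA hAd)) ?_
    rw [← hδdef, hδ', ← mul_assoc]
    exact Dvd.intro_left _ rfl
  · intro v hv hvκ
    -- After division by `e'` this is a congruence modulo `n`, in which `δ'` is invertible; `b` is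
    -- its inverse by Bézout.
    obtain ⟨i, hi, hiv⟩ : ∃ i : ℕ, i < n ∧ (e : ℤ) ∣ v - i * δ := by
      obtain ⟨w, rfl⟩ := hv
      have hnn : (n : ℤ) ≠ 0 := by omega
      obtain ⟨a, b, hab⟩ : IsCoprime (n : ℤ) (δ' : ℤ) := Nat.isCoprime_iff_coprime.2 hcop
      refine ⟨((w * b) % n).toNat, ?_, ?_⟩
      · have := Int.emod_lt_of_pos (w * b) (by omega : (0 : ℤ) < n)
        have := Int.emod_nonneg (w * b) hnn
        omega
      · rw [Int.toNat_of_nonneg (Int.emod_nonneg _ hnn), hδ', hen]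
        push_cast
        rw [show (e' : ℤ) * w - w * b % n * (δ' * e') = (w - w * b % n * δ') * e' by ring]
        refine mul_dvd_mul_right ?_ _
        rw [Int.emod_def]
        refine ⟨w * a + w * b / n * δ', ?_⟩
        linear_combination (-w) * hab
    -- The increase of `κ` by `(n - 1) δ` is what keeps `v - i δ` above the old threshold.
    have hle : (i : ℤ) * δ ≤ (n - 1 : ℕ) * δ := by
      have : i ≤ n - 1 := by omega
      exact_mod_cast Nat.mul_le_mul_right δ this
    obtain ⟨A, hA, hAd, hAt⟩ := S.exists_deg _ hiv (by omega)
    refine ⟨A * φ ^ i, mul_ne_zero hA (pow_ne_zero _ hφ0), ?_, ?_⟩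
    · rw [hdeg']; exact natDegree_mul_pow_lt S.monic hAd hi
    · rw [map_mul, map_pow, totalDegree_mul_pow hF hφ0 hA]
      push_cast
      rw [hAt]
      ring
  · intro G hG hGd
    rw [hdeg'] at hGd
    obtain ⟨i, hi, A, hA, hAd, hdeg, hl, -⟩ := S.exists_lead_term hF hn le_rfl hG hGd
    obtain ⟨c₂, hc₂, hA2⟩ := S.lead A hA hAd
    refine ⟨c₂ * c₀ ^ i, mul_ne_zero hc₂ (pow_ne_zero _ hc₀), ?_⟩
    rw [hl, hdeg, mul_pow, hA2, ← pow_mul, mul_comm i, pow_mul, hlead, mul_pow, ← pow_mul, pow_add,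
      MvPolynomial.C_mul, MvPolynomial.C_pow, mul_comm i]
    ring
  · exact mul_ne_zero (pow_ne_zero _ hf0) S.prod_ne
  · rw [MvPolynomial.totalDegree_mul_of_isDomain (pow_ne_zero _ hf0) S.prod_ne,
      totalDegree_pow_of_ne_zero hf0, S.prod_deg, add_comm]
  · intro G H' hGd hHd'
    rw [hdeg'] at hGd hHd'
    -- The strict drop `deg (F φ') < n δ` makes up for the one lost in `bracket_le`.
    refine degLT_mono ?_ (S.bracket_le hF hp0 hn hGd hHd')
    rw [hκ, ← hδdef]
    have : ((F φ').totalDegree : ℤ) < n * δ := by exact_mod_cast hφ't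
    linarith
  · intro G k hGd hGk
    rw [hdeg'] at hGd
    by_cases hG : G = 0
    · simp [hG, bracket]
    obtain ⟨i, hi, A, hA, hAd, hdeg, -, hm⟩ := S.exists_lead_term hF hn le_rfl hG hGd
    obtain ⟨k₁, hk₁⟩ := S.e_dvd A hA hAd
    -- The coefficient in `bracket_key_term` is again the degree, now measured in units of `e'`.
    have hk : k = n * k₁ + i * δ' := by
      have : e' * k = e' * (n * k₁ + i * δ') := by
        rw [← hGk, hdeg, hk₁, hen, ← hδdef]
        nth_rewrite 1 [hδ']
        ring
      exact Nat.eq_of_mul_eq_mul_left he'pos this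
    have hterm := S.bracket_key_term hn0 hHd hHt hred hAd hk₁ (hHt.trans hnδ) i
    rw [← hk] at hterm
    have heq : F G = F A * F φ ^ i + F (G - A * φ ^ i) := by simp
    have hrestd : (G - A * φ ^ i).natDegree < n * φ.natDegree :=
      lt_of_le_of_lt (natDegree_sub_le _ _) (max_lt hGd (natDegree_mul_pow_lt S.monic hAd hi))
    have hrest1 := S.bracket_phi_le hF hp0 hn hrestd
    have hrest2 := S.bracket_small_le hF hp0 hn hrestd hHd
    have hrest : F (G - A * φ ^ i) ∈ degLT K (F G).totalDegree := by simpa using hm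
    by_cases hr0 : G - A * φ ^ i = 0
    · have hGeq : F G = F A * F φ ^ i := by rw [heq, hr0]; simp
      rw [hFφ', hκ, hdeg, hGeq]
      push_cast
      exact hterm
    have hrlt := totalDegree_lt_of_mem_degLT hrest (map_ne_zero hF hr0)
    set r := F (G - A * φ ^ i)
    -- Besides the dominating term there is only the remainder `r` of smaller degree, all of whose
    -- contributions are error terms.
    have hexp : p * bracket (F G) (F φ') - (k : MvPolynomial (Fin 2) K) *
        (F φ ^ (n - 1) * Ω * F G) =
        (p * bracket (F A * F φ ^ i) (F φ ^ n - MvPolynomial.C c * F H) -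
          (k : MvPolynomial (Fin 2) K) * (F φ ^ (n - 1) * Ω * (F A * F φ ^ i))) +
        (MvPolynomial.C (n : K) * (p * (F φ ^ (n - 1) * bracket r (F φ))) -
          MvPolynomial.C c * (p * bracket r (F H))
         - MvPolynomial.C (k : K) * (F φ ^ (n - 1) * (Ω * r))) := by
      rw [hFφ', heq, bracket_add_left, bracket_sub_right r, bracket_C_mul_right,
        bracket_pow_right, ← natCast_eq_C, ← natCast_eq_C]
      ring
    rw [hexp]
    refine add_mem ?_ (sub_mem (sub_mem ?_ ?_) ?_)
    · rw [hκ, hdeg]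
      push_cast
      exact hterm
    · refine C_mul_mem_degLT _ (degLT_mono ?_ (mul_mem_degLT (self_mem_degLT p)
        (mul_mem_degLT (pow_mem_degLT (F φ) (n - 1)) hrest1)))
      rw [hκ, ← hδdef]
      omega
    · refine C_mul_mem_degLT _ (degLT_mono ?_ (mul_mem_degLT (self_mem_degLT p) hrest2))
      rw [hκ, hHt]
      push_cast
      omega
    · refine C_mul_mem_degLT _ (degLT_mono ?_ (mul_mem_degLT (pow_mem_degLT (F φ) (n - 1))
        (mul_mem_degLT (self_mem_degLT Ω) hrest)))
      rw [hκ, S.prod_deg, ← hδdef]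
      omega

end KeyState

/-! ### Independent leading forms, and the absence of elements of degree one. -/

/-- Two nonzero forms of the same degree that are not proportional are separated by a prime. -/
theorem exists_prime_multiplicity_ne {f g : MvPolynomial (Fin 2) K} (hf : f ≠ 0) (hg : g ≠ 0)
    (hd : f.totalDegree = g.totalDegree) (h : ¬ ∃ c : K, c ≠ 0 ∧ f = MvPolynomial.C c * g) :
    ∃ π : MvPolynomial (Fin 2) K, Prime π ∧ multiplicity π f ≠ multiplicity π g := by
  by_contra hcon
  push Not at hcon
  apply h
  have hdvd : f ∣ g := by
    rw [UniqueFactorizationMonoid.dvd_iff_emultiplicity_le hf]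
    intro π hπ
    rw [(FiniteMultiplicity.of_prime_left hπ hf).emultiplicity_eq_multiplicity,
      (FiniteMultiplicity.of_prime_left hπ hg).emultiplicity_eq_multiplicity, hcon π hπ]
  obtain ⟨k, rfl⟩ := hdvd
  have hk : k ≠ 0 := right_ne_zero_of_mul hg
  rw [MvPolynomial.totalDegree_mul_of_isDomain hf hk] at hd
  have hk0 : k.totalDegree = 0 := by omega
  rw [MvPolynomial.totalDegree_eq_zero_iff_eq_C] at hk0
  have hc : k.coeff 0 ≠ 0 := by
    intro h0
    rw [h0] at hk0
    exact hk (by simpa using hk0)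
  refine ⟨(k.coeff 0)⁻¹, inv_ne_zero hc, ?_⟩
  rw [mul_comm f k]
  nth_rewrite 2 [hk0]
  rw [← mul_assoc, ← MvPolynomial.C_mul, inv_mul_cancel₀ hc, MvPolynomial.C_1, one_mul]

theorem multiplicity_mul_of_ne_zero {π f g : MvPolynomial (Fin 2) K} (hπ : Prime π) (hf : f ≠ 0)
    (hg : g ≠ 0) : multiplicity π (f * g) = multiplicity π f + multiplicity π g :=
  multiplicity_mul hπ (FiniteMultiplicity.of_prime_left hπ (mul_ne_zero hf hg))

theorem multiplicity_pow_of_ne_zero {π f : MvPolynomial (Fin 2) K} (hπ : Prime π) (hf : f ≠ 0)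
    (n : ℕ) : multiplicity π (f ^ n) = n * multiplicity π f :=
  FiniteMultiplicity.multiplicity_pow hπ (FiniteMultiplicity.of_prime_left hπ hf)

namespace KeyState

variable {F : K[X][X] →+* MvPolynomial (Fin 2) K} {p : MvPolynomial (Fin 2) K}
  {φ : K[X][X]} {κ e : ℕ} {Ω : MvPolynomial (Fin 2) K}

/-- For small `Y`-degree, the multiplicity of any prime in the leading form is proportional to the
degree, with the ratio of `p`. -/
theorem multiplicity_lead (S : KeyState F p φ κ e Ω) (hF : Function.Injective F) (hp : p ≠ 0)
    {π : MvPolynomial (Fin 2) K} (hπ : Prime π) {A : K[X][X]} (hA : A ≠ 0)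
    (hAd : A.natDegree < φ.natDegree) :
    p.totalDegree * multiplicity π (leadForm (F A)) =
      (F A).totalDegree * multiplicity π (leadForm p) := by
  obtain ⟨c, hc, h⟩ := S.lead A hA hAd
  have h1 := congrArg (multiplicity π) h
  have hc' : IsUnit (MvPolynomial.C c : MvPolynomial (Fin 2) K) := (isUnit_iff_ne_zero.2 hc).map _
  rw [multiplicity_pow_of_ne_zero hπ (leadForm_ne_zero (map_ne_zero hF hA)),
    multiplicity_mul_of_ne_zero hπ hc'.ne_zero (pow_ne_zero _ (leadForm_ne_zero hp)),
    multiplicity_pow_of_ne_zero hπ (leadForm_ne_zero hp),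
    multiplicity_of_isUnit_right hπ.not_isUnit hc', zero_add] at h1
  exact h1

/-- If the leading form of the key polynomial is not dependent on that of `p`, no cancellation
occurs in `φ`-adic expansions. -/
theorem natDegree_lt_of_indep (S : KeyState F p φ κ e Ω) (hF : Function.Injective F)
    (hp : p ≠ 0)
    (hindep : ¬ ∃ c : K, c ≠ 0 ∧ leadForm (F φ) ^ p.totalDegree =
      MvPolynomial.C c * leadForm p ^ (F φ).totalDegree)
    {G : K[X][X]} (hG : (F G).totalDegree < (F φ).totalDegree) : G.natDegree < φ.natDegree := by
  have hφ0 : φ ≠ 0 := S.monic.ne_zero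
  have hf0 := map_ne_zero hF hφ0
  have hlf0 := leadForm_ne_zero hf0
  have hlp0 := leadForm_ne_zero hp
  -- Independence yields a prime for which `φ` violates the proportionality in `multiplicity_lead`.
  obtain ⟨π, hπ, hne⟩ := exists_prime_multiplicity_ne (pow_ne_zero _ hlf0) (pow_ne_zero _ hlp0)
    (by rw [totalDegree_pow_of_ne_zero hlf0, totalDegree_pow_of_ne_zero hlp0,
      totalDegree_leadForm, totalDegree_leadForm, mul_comm]) hindep
  rw [multiplicity_pow_of_ne_zero hπ hlf0, multiplicity_pow_of_ne_zero hπ hlp0] at hne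
  -- Some term `A φ ^ i` accounts for the degree and the `π`-multiplicity at once; the induction
  -- needs both.
  suffices h : ∀ G : K[X][X], G ≠ 0 → ∃ (i : ℕ) (A : K[X][X]), A ≠ 0 ∧ A.natDegree < φ.natDegree ∧
      (F G).totalDegree = (F A).totalDegree + i * (F φ).totalDegree ∧
      multiplicity π (leadForm (F G)) =
        multiplicity π (leadForm (F A)) + i * multiplicity π (leadForm (F φ)) ∧
      (G.natDegree < φ.natDegree ∨ (F φ).totalDegree ≤ (F G).totalDegree) by
    by_cases hG0 : G = 0
    · rw [hG0]; simpa using S.natDegree_pos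
    obtain ⟨i, A, -, -, -, -, h | h⟩ := h G hG0
    · exact h
    · omega
  clear hG G
  intro G hG
  induction hd : G.natDegree using Nat.strong_induction_on generalizing G with
  | _ d ih =>
    have hdecomp := modByMonic_add_div G φ
    set G₀ := G %ₘ φ with hG₀
    set G' := G /ₘ φ with hG'
    have hφ1 : φ ≠ 1 := by
      intro h
      have := S.natDegree_pos
      rw [h] at this
      simp at this
    have hG₀d : G₀.natDegree < φ.natDegree := natDegree_modByMonic_lt G S.monic hφ1
    by_cases hG'0 : G' = 0
    · rw [hG'0, mul_zero, add_zero] at hdecomp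
      refine ⟨0, G, hG, by rwa [← hdecomp], by simp, by simp, Or.inl ?_⟩
      rwa [← hd, ← hdecomp]
    have hG'd : G'.natDegree < d := by
      have h1 : G'.natDegree = G.natDegree - φ.natDegree := natDegree_divByMonic G S.monic
      have h2 : φ.natDegree ≤ G.natDegree := by
        by_contra hlt
        apply hG'0
        rw [hG', divByMonic_eq_zero_iff S.monic]
        exact degree_lt_degree (by omega)
      have := S.natDegree_pos
      omega
    obtain ⟨i, A, hA, hAd, hdeg, hmul, -⟩ := ih _ hG'd G' hG'0 rfl
    have hFG' := map_ne_zero hF hG'0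
    have hFG : F G = F G₀ + F φ * F G' := by rw [← map_mul, ← map_add, hdecomp]
    set f₁ := F φ * F G' with hf₁
    have hf₁0 : f₁ ≠ 0 := mul_ne_zero hf0 hFG'
    have hf₁d : f₁.totalDegree = (F A).totalDegree + (i + 1) * (F φ).totalDegree := by
      rw [hf₁, MvPolynomial.totalDegree_mul_of_isDomain hf0 hFG', hdeg]
      ring
    have hf₁m : multiplicity π (leadForm f₁) =
        multiplicity π (leadForm (F A)) + (i + 1) * multiplicity π (leadForm (F φ)) := by
      rw [hf₁, leadForm_mul, multiplicity_mul_of_ne_zero hπ hlf0 (leadForm_ne_zero hFG'), hmul]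
      ring
    have hf₁ge : (F φ).totalDegree ≤ f₁.totalDegree := by
      rw [hf₁, MvPolynomial.totalDegree_mul_of_isDomain hf0 hFG']
      omega
    by_cases hG₀0 : G₀ = 0
    · rw [hG₀0, map_zero, zero_add] at hFG
      exact ⟨i + 1, A, hA, hAd, by rw [hFG, hf₁d], by rw [hFG, hf₁m], Or.inr (by rwa [hFG])⟩
    have hFG₀ := map_ne_zero hF hG₀0
    rcases lt_trichotomy (F G₀).totalDegree f₁.totalDegree with h | h | h
    · obtain ⟨-, h1, h2⟩ := leadForm_eq_of_sub_mem_degLT (f := F G) hf₁0 (by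
        rw [hFG, add_sub_cancel_right]
        exact mem_degLT_of_totalDegree_lt (by exact_mod_cast h))
      exact ⟨i + 1, A, hA, hAd, by rw [h1, hf₁d], by rw [h2, hf₁m], Or.inr (by rwa [h1])⟩
    -- Equal degrees force different multiplicities, so the leading forms cannot cancel and their
    -- sum has the smaller multiplicity.
    · have hne' : multiplicity π (leadForm (F G₀)) ≠ multiplicity π (leadForm f₁) := by
        intro heq
        rw [hf₁m] at heq
        have e1 := S.multiplicity_lead hF hp hπ hA hAd
        have e2 := S.multiplicity_lead hF hp hπ hG₀0 hG₀d
        rw [h, hf₁d, heq] at e2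
        apply hne
        have : (i + 1) * (p.totalDegree * multiplicity π (leadForm (F φ))) =
            (i + 1) * ((F φ).totalDegree * multiplicity π (leadForm p)) := by
          linarith
        exact Nat.eq_of_mul_eq_mul_left (by omega) this
      have hmin := multiplicity_add_eq_min
        (FiniteMultiplicity.of_prime_left hπ (leadForm_ne_zero hFG₀))
        (FiniteMultiplicity.of_prime_left hπ (leadForm_ne_zero hf₁0)) hne'
      have hsum0 : leadForm (F G₀) + leadForm f₁ ≠ 0 := by
        intro h0
        apply hne'
        rw [eq_neg_of_add_eq_zero_left h0, multiplicity_neg]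
      obtain ⟨-, h1, h2⟩ := leadForm_eq_of_sub_mem (f := F G) (n := f₁.totalDegree)
        ((h ▸ leadForm_isHomogeneous (F G₀)).add (leadForm_isHomogeneous f₁)) hsum0 (by
          rw [hFG, show F G₀ + f₁ - (leadForm (F G₀) + leadForm f₁) =
            (F G₀ - leadForm (F G₀)) + (f₁ - leadForm f₁) by ring]
          exact add_mem (h ▸ sub_leadForm_mem _) (sub_leadForm_mem _))
      rcases min_choice (multiplicity π (leadForm (F G₀))) (multiplicity π (leadForm f₁))
        with hc | hc
      · exact ⟨0, G₀, hG₀0, hG₀d, by rw [h1, ← h]; simp, by rw [h2, hmin, hc]; simp,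
          Or.inr (by rwa [h1])⟩
      · exact ⟨i + 1, A, hA, hAd, by rw [h1, hf₁d], by rw [h2, hmin, hc, hf₁m],
          Or.inr (by rwa [h1])⟩
    · obtain ⟨-, h1, h2⟩ := leadForm_eq_of_sub_mem_degLT (f := F G) hFG₀ (by
        rw [hFG, add_sub_cancel_left]
        exact mem_degLT_of_totalDegree_lt (by exact_mod_cast h))
      exact ⟨0, G₀, hG₀0, hG₀d, by rw [h1]; simp, by rw [h2]; simp, Or.inr (by omega)⟩

/-- No element of `K[p, q]` has degree one. -/
theorem totalDegree_ne_one (S : KeyState F p φ κ e Ω) (hF : Function.Injective F)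
    (hFC : ∀ c : K, F (C (C c)) = MvPolynomial.C c) (hp : 0 < p.totalDegree)
    (hδ : 2 ≤ (F φ).totalDegree)
    (hκ : p.totalDegree ≤ κ ∨ (¬ e ∣ (F φ).totalDegree ∧ p.totalDegree ≤ (F φ).totalDegree))
    (hone : ∀ G, G.natDegree < φ.natDegree → (F G).totalDegree ≠ 1)
    (G : K[X][X]) : (F G).totalDegree ≠ 1 := by
  have hp0 : p ≠ 0 := by rintro rfl; simp at hp
  -- Passing to the next key polynomial either raises its `Y`-degree (`n ≥ 2`, outer induction) or
  -- keeps it and lowers the degree of its image (`n = 1`, inner induction).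
  induction hm : G.natDegree + 1 - φ.natDegree using Nat.strong_induction_on
    generalizing φ κ e Ω with
  | _ m ihm =>
  induction hd : (F φ).totalDegree using Nat.strong_induction_on generalizing φ κ e Ω with
  | _ d ihd =>
    by_cases hlt : G.natDegree < φ.natDegree
    · exact hone G hlt
    by_cases hlead : ∃ c : K, c ≠ 0 ∧ leadForm (F φ) ^ p.totalDegree =
      MvPolynomial.C c * leadForm p ^ (F φ).totalDegree
    · obtain ⟨c₀, hc₀, hl⟩ := hlead
      obtain ⟨n, e', φ', hn0, -, hor, hdeg', ht', hone', S'⟩ :=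
        S.step hF hFC hp hδ hone hc₀ hl
      -- From now on `deg p ≤ κ`, so `deg_ge` keeps all later key polynomials at degree at least
      -- two.
      have hκ' : p.totalDegree ≤ κ + (n - 1) * (F φ).totalDegree := by
        rcases hκ with h | ⟨h1, h2⟩
        · omega
        · have h3 : 2 ≤ n := hor.resolve_left h1
          have : 1 * (F φ).totalDegree ≤ (n - 1) * (F φ).totalDegree :=
            Nat.mul_le_mul_right _ (by omega)
          omega
      have hge' := S'.deg_ge hF
      have hpos := S.natDegree_pos
      by_cases hn1 : n = 1
      · subst hn1
        rw [one_mul] at hdeg' ht'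
        exact ihd _ (by omega) S' (by omega) (Or.inl hκ') hone' (by omega) rfl
      · have : 2 * φ.natDegree ≤ n * φ.natDegree := Nat.mul_le_mul_right _ (by omega)
        exact ihm _ (by omega) S' (by omega) (Or.inl hκ') hone' rfl
    -- An element of degree `1 < deg (F φ)` would have small `Y`-degree, which is excluded here.
    · intro h1
      exact hlt (S.natDegree_lt_of_indep hF hp0 hlead (by omega))

end KeyState

/-! ### Jacobian determinants and degree reduction of automorphisms. -/

theorem pderiv_aeval_pair (i : Fin 2) (u v f : MvPolynomial (Fin 2) K) :
    MvPolynomial.pderiv i (MvPolynomial.aeval ![u, v] f) =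
      MvPolynomial.aeval ![u, v] (MvPolynomial.pderiv 0 f) * MvPolynomial.pderiv i u +
      MvPolynomial.aeval ![u, v] (MvPolynomial.pderiv 1 f) * MvPolynomial.pderiv i v := by
  induction f using MvPolynomial.induction_on with
  | C a => simp
  | add f g hf hg => simp only [map_add, hf, hg]; ring
  | mul_X f j hf =>
    have h0 : MvPolynomial.pderiv (0 : Fin 2) (MvPolynomial.X 1 : MvPolynomial (Fin 2) K) = 0 :=
      MvPolynomial.pderiv_X_of_ne (by decide)
    have h1 : MvPolynomial.pderiv (1 : Fin 2) (MvPolynomial.X 0 : MvPolynomial (Fin 2) K) = 0 :=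
      MvPolynomial.pderiv_X_of_ne (by decide)
    fin_cases j
    · simp only [Fin.zero_eta, map_mul, MvPolynomial.aeval_X, MvPolynomial.pderiv_mul, hf, map_add,
        MvPolynomial.pderiv_X_self, h1, Matrix.cons_val_zero, map_one, map_zero]
      ring
    · simp only [Fin.mk_one, map_mul, MvPolynomial.aeval_X, MvPolynomial.pderiv_mul, hf, map_add,
        MvPolynomial.pderiv_X_self, h0, Matrix.cons_val_one, map_one, map_zero,
        Matrix.cons_val_fin_one]
      ring

/-- The chain rule. -/
theorem bracket_aeval (u v f g : MvPolynomial (Fin 2) K) :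
    bracket (MvPolynomial.aeval ![u, v] f) (MvPolynomial.aeval ![u, v] g) =
      MvPolynomial.aeval ![u, v] (bracket f g) * bracket u v := by
  simp only [bracket, pderiv_aeval_pair, map_sub, map_mul]
  ring

theorem jacobianDet_eq_bracket (g : GA2 K) : jacobianDet g = bracket g.val.P g.val.Q := rfl

theorem jacobianDet_mul (f g : GA2 K) : jacobianDet (f * g) =
    MvPolynomial.aeval ![g.val.P, g.val.Q] (jacobianDet f) * jacobianDet g := by
  simp only [jacobianDet_eq_bracket]
  rw [Units.val_mul, PolyMap.mul_def, bracket_aeval]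

theorem jacobianDet_one : jacobianDet (1 : GA2 K) = 1 := by
  simp [jacobianDet_eq_bracket, bracket, PolyMap.one_def, MvPolynomial.pderiv_X]

/-- The Jacobian determinant of an automorphism is a nonzero constant. -/
theorem exists_jacobianDet_eq_C (g : GA2 K) :
    ∃ J : K, J ≠ 0 ∧ jacobianDet g = MvPolynomial.C J := by
  have h1 : jacobianDet (g⁻¹ * g) = 1 := by rw [inv_mul_cancel, jacobianDet_one]
  rw [jacobianDet_mul] at h1
  have h2 : IsUnit (jacobianDet g) := IsUnit.of_mul_eq_one_right _ h1
  rw [MvPolynomial.isUnit_iff_eq_C_of_isReduced] at h2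
  obtain ⟨J, hJ, h3⟩ := h2
  exact ⟨J, hJ.ne_zero, h3⟩

/-- Evaluation of `K[X][Y]` at `X = p`, `Y = q`. -/
noncomputable def planeEval (p q : MvPolynomial (Fin 2) K) : K[X][X] →+* MvPolynomial (Fin 2) K :=
  eval₂RingHom (aeval p : K[X] →ₐ[K] MvPolynomial (Fin 2) K).toRingHom q

@[simp]
theorem planeEval_X (p q : MvPolynomial (Fin 2) K) : planeEval p q X = q := by
  simp [planeEval]

@[simp]
theorem planeEval_C (p q : MvPolynomial (Fin 2) K) (g : K[X]) : planeEval p q (C g) = aeval p g := by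
  simp [planeEval]

theorem planeEval_C_C (p q : MvPolynomial (Fin 2) K) (c : K) :
    planeEval p q (C (C c)) = MvPolynomial.C c := by
  simp [MvPolynomial.algebraMap_eq]

theorem planeEval_eq_aeval (p q : MvPolynomial (Fin 2) K) :
    planeEval p q = (MvPolynomial.aeval ![p, q] : _ →ₐ[K] _).toRingHom.comp
      (planeEval (MvPolynomial.X 0) (MvPolynomial.X 1)) := by
  refine Polynomial.ringHom_ext' ?_ (by simp)
  refine Polynomial.ringHom_ext' ?_ (by simp)
  ext c
  simp

theorem planeEval_aeval (p q f : MvPolynomial (Fin 2) K) :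
    planeEval p q (MvPolynomial.aeval ![(C X : K[X][X]), X] f) =
      MvPolynomial.aeval ![p, q] f := by
  induction f using MvPolynomial.induction_on with
  | C a => simp [Polynomial.algebraMap_eq, Polynomial.algebraMap_apply]
  | add f g hf hg => simp only [map_add, hf, hg]
  | mul_X f j hf =>
    fin_cases j <;> simp [hf]

/-- Substituting the components of `g` is undone by substituting those of `g⁻¹`. -/
theorem planeEval_injective (g : GA2 K) : Function.Injective (planeEval g.val.P g.val.Q) := by
  have h1 : Function.Injective (planeEval (MvPolynomial.X 0 : MvPolynomial (Fin 2) K)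
      (MvPolynomial.X 1)) := by
    have h : ((MvPolynomial.aeval ![(C X : K[X][X]), X] : MvPolynomial (Fin 2) K →ₐ[K] _) :
        MvPolynomial (Fin 2) K →+* K[X][X]).comp
        (planeEval (MvPolynomial.X 0) (MvPolynomial.X 1)) = RingHom.id _ := by
      refine Polynomial.ringHom_ext' ?_ (by simp)
      refine Polynomial.ringHom_ext' ?_ (by simp)
      ext c
      simp [Polynomial.algebraMap_apply]
    intro a b hab
    have := congrArg (MvPolynomial.aeval ![(C X : K[X][X]), X] : MvPolynomial (Fin 2) K →ₐ[K] _) hab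
    have ha := RingHom.congr_fun h a
    have hb := RingHom.congr_fun h b
    simp only [RingHom.comp_apply, RingHom.id_apply] at ha hb
    rw [← ha, ← hb]
    exact this
  have h2 : Function.Injective (MvPolynomial.aeval ![g.val.P, g.val.Q] :
      MvPolynomial (Fin 2) K →ₐ[K] MvPolynomial (Fin 2) K) := by
    intro a b hab
    have h := congrArg (MvPolynomial.aeval ![g⁻¹.val.P, g⁻¹.val.Q]) hab
    rw [PolyMap.aeval_aeval, PolyMap.aeval_aeval, ← Units.val_mul, mul_inv_cancel] at h
    have hX : (![MvPolynomial.X 0, MvPolynomial.X 1] : Fin 2 → MvPolynomial (Fin 2) K)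
        = MvPolynomial.X := by
      ext i : 1
      fin_cases i <;> rfl
    simpa [PolyMap.one_def, hX] using h
  rw [planeEval_eq_aeval]
  exact h2.comp h1

theorem aeval_mem_degLT {p : MvPolynomial (Fin 2) K} (hp : 0 < p.totalDegree) {g : K[X]} {n : ℕ}
    (hg : g.degree < n) : aeval p g ∈ degLT K (n * p.totalDegree : ℕ) := by
  by_cases h0 : g = 0
  · simp [h0]
  rw [aeval_eq_sum_range' (n := n) ((natDegree_lt_iff_degree_lt h0).2 hg)]
  refine sum_mem fun i hi => Submodule.smul_mem _ _ (degLT_mono ?_ (pow_mem_degLT p i))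
  rw [Finset.mem_range] at hi
  have : (i + 1) * p.totalDegree ≤ n * p.totalDegree := Nat.mul_le_mul_right _ hi
  push_cast
  zify at this
  nlinarith

theorem aeval_leading {p : MvPolynomial (Fin 2) K} (hp : 0 < p.totalDegree) {g : K[X]}
    (hg : g ≠ 0) : (aeval p g).totalDegree = g.natDegree * p.totalDegree ∧
      leadForm (aeval p g) = MvPolynomial.C g.leadingCoeff * leadForm p ^ g.natDegree := by
  have hp0 : p ≠ 0 := by rintro rfl; simp at hp
  have hlc : g.leadingCoeff ≠ 0 := leadingCoeff_ne_zero.2 hg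
  have hd : (MvPolynomial.C g.leadingCoeff * p ^ g.natDegree).totalDegree =
      g.natDegree * p.totalDegree := by
    rw [totalDegree_C_mul hlc, totalDegree_pow_of_ne_zero hp0]
  have hmem : aeval p g - MvPolynomial.C g.leadingCoeff * p ^ g.natDegree ∈
      degLT K (g.natDegree * p.totalDegree : ℕ) := by
    have h1 : aeval p g - MvPolynomial.C g.leadingCoeff * p ^ g.natDegree =
        aeval p (g - C g.leadingCoeff * X ^ g.natDegree) := by
      rw [map_sub, map_mul, aeval_C, map_pow, aeval_X, MvPolynomial.algebraMap_eq]
    rw [h1]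
    refine aeval_mem_degLT hp ?_
    rw [C_mul_X_pow_eq_monomial, ← degree_eq_natDegree hg]
    exact degree_sub_lt_left (by rw [degree_monomial _ hlc, degree_eq_natDegree hg]) hg
      (by simp)
  obtain ⟨-, h1, h2⟩ := leadForm_eq_of_sub_mem_degLT (f := aeval p g)
    (mul_ne_zero ((map_ne_zero_iff _ (MvPolynomial.C_injective _ _)).2 hlc)
      (pow_ne_zero _ hp0)) (by rw [hd]; exact hmem)
  refine ⟨h1.trans hd, ?_⟩
  rw [h2, leadForm_mul, leadForm_C, leadForm_pow]

theorem bracket_aeval_left (p q : MvPolynomial (Fin 2) K) (g : K[X]) :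
    bracket (aeval p g) q = aeval p (derivative g) * bracket p q := by
  simp only [bracket, Derivation.map_aeval, smul_eq_mul]
  ring

theorem bracket_aeval_aeval (p : MvPolynomial (Fin 2) K) (g h : K[X]) :
    bracket (aeval p g) (aeval p h) = 0 := by
  rw [bracket_aeval_left, bracket_swap, bracket_aeval_left, bracket_self]
  simp

/-- The small polynomials are the `g(p)`. Their mutual brackets vanish, `bracket (g(p)) q = J
g'(p)`, and `X g' - (deg g) g` has degree below `deg g`. -/
theorem KeyState.initial {p q : MvPolynomial (Fin 2) K} (hp : 0 < p.totalDegree) {J : K}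
    (hJ : J ≠ 0) (hpq : bracket p q = MvPolynomial.C J) :
    KeyState (planeEval p q) p X 0 p.totalDegree (MvPolynomial.C J) := by
  have hC : ∀ G : K[X][X], G.natDegree < (X : K[X][X]).natDegree → ∃ g : K[X], G = C g := by
    intro G hG
    rw [natDegree_X] at hG
    exact ⟨_, eq_C_of_natDegree_eq_zero (by omega)⟩
  refine ⟨monic_X, by simp, hp, ?_, ?_, ?_, ?_, ?_, ?_, ?_⟩
  · intro G hG hGd
    obtain ⟨g, rfl⟩ := hC G hGd
    rw [planeEval_C, (aeval_leading hp (by simpa using hG)).1]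
    exact Dvd.intro_left _ rfl
  · rintro v ⟨w, rfl⟩ hv
    have hw : 0 ≤ w := by
      by_contra hneg
      have : (p.totalDegree : ℤ) * w ≤ p.totalDegree * (-1) :=
        mul_le_mul_of_nonneg_left (by omega) (by omega)
      push_cast at hv
      linarith
    lift w to ℕ using hw
    refine ⟨C (X ^ w), by simp, by simp, ?_⟩
    rw [planeEval_C, (aeval_leading hp (by simp)).1, natDegree_X_pow]
    push_cast
    ring
  · intro G hG hGd
    obtain ⟨g, rfl⟩ := hC G hGd
    have hg : g ≠ 0 := by simpa using hG
    obtain ⟨h1, h2⟩ := aeval_leading hp hg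
    refine ⟨g.leadingCoeff ^ p.totalDegree, pow_ne_zero _ (leadingCoeff_ne_zero.2 hg), ?_⟩
    rw [planeEval_C, h1, h2, mul_pow, ← pow_mul, MvPolynomial.C_pow]
  · simpa using hJ
  · simp
  · intro G H hGd hHd
    obtain ⟨g, rfl⟩ := hC G hGd
    obtain ⟨h, rfl⟩ := hC H hHd
    rw [planeEval_C, planeEval_C, bracket_aeval_aeval]
    exact zero_mem _
  · intro G k hGd hk
    obtain ⟨g, rfl⟩ := hC G hGd
    by_cases hg : g = 0
    · simp [hg, bracket]
    rw [planeEval_C] at hk ⊢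
    have hd := (aeval_leading hp hg).1
    have hkn : k = g.natDegree := by
      rw [hk, mul_comm] at hd
      exact Nat.eq_of_mul_eq_mul_right hp hd
    have heq : p * bracket (aeval p g) (planeEval p q X) -
        (k : MvPolynomial (Fin 2) K) * (MvPolynomial.C J * aeval p g) =
        MvPolynomial.C J * aeval p (X * derivative g - C (k : K) * g) := by
      rw [planeEval_X, bracket_aeval_left, hpq]
      simp
      ring
    rw [heq, hd, Nat.cast_zero, zero_add]
    refine C_mul_mem_degLT _ (aeval_mem_degLT hp ?_)
    rw [degree_lt_iff_coeff_zero]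
    intro m hm
    rcases m with _ | m
    · have : g.natDegree = 0 := by omega
      simp [hkn, this]
    · rw [coeff_sub, coeff_X_mul, coeff_derivative, coeff_C_mul, hkn]
      rcases hm.eq_or_lt with h | h
      · rw [h]; push_cast; ring
      · rw [coeff_eq_zero_of_natDegree_lt h]; ring

/-- A nonaffine automorphism can be simplified: the component of larger degree is, up to lower
degree, a multiple of a power of the other. -/
theorem exists_degree_reduction (g : GA2 K) (hle : g.val.P.totalDegree ≤ g.val.Q.totalDegree)
    (h2 : 2 ≤ g.val.Q.totalDegree) : ∃ (c : K) (k : ℕ),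
      (g.val.Q - MvPolynomial.C c * g.val.P ^ k).totalDegree < g.val.Q.totalDegree := by
  obtain ⟨J, hJ, hpq⟩ := exists_jacobianDet_eq_C g
  rw [jacobianDet_eq_bracket] at hpq
  have hF := planeEval_injective g
  -- Invertibility enters here: the components of `g⁻¹` express `x` and `y` through `p` and `q`.
  have hX : ∃ Gx, planeEval g.val.P g.val.Q Gx = MvPolynomial.X 0 := by
    refine ⟨_, (planeEval_aeval _ _ g⁻¹.val.P).trans ?_⟩
    exact congrArg PolyMap.P g.inv_val
  have hY : ∃ Gy, planeEval g.val.P g.val.Q Gy = MvPolynomial.X 1 := by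
    refine ⟨_, (planeEval_aeval _ _ g⁻¹.val.Q).trans ?_⟩
    exact congrArg PolyMap.Q g.inv_val
  set p := g.val.P
  set q := g.val.Q
  have hp : 0 < p.totalDegree := by
    by_contra h0
    have h0' : p.totalDegree = 0 := by omega
    rw [MvPolynomial.totalDegree_eq_zero_iff_eq_C] at h0'
    rw [h0', bracket_C_left] at hpq
    exact hJ (by simpa using hpq.symm)
  have hp0 : p ≠ 0 := by rintro h; simp [h] at hp
  have hq0 : q ≠ 0 := by rintro h; simp [h] at h2
  have S := KeyState.initial hp hJ hpq
  obtain ⟨Gx, hGx⟩ := hX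
  obtain ⟨Gy, hGy⟩ := hY
  have hX1 : ∀ i : Fin 2, (MvPolynomial.X i : MvPolynomial (Fin 2) K).totalDegree = 1 := by simp
  by_cases hdvd : p.totalDegree ∣ q.totalDegree
  · obtain ⟨k, hk⟩ := hdvd
    by_cases hlead : ∃ c : K, c ≠ 0 ∧ leadForm (planeEval p q X) ^ p.totalDegree =
      MvPolynomial.C c * leadForm p ^ (planeEval p q X).totalDegree
    · obtain ⟨c₀, hc₀, hl⟩ := hlead
      rw [planeEval_X] at hl
      have hqd : q.totalDegree = (p ^ k).totalDegree := by
        rw [totalDegree_pow_of_ne_zero hp0, hk, mul_comm]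
      obtain ⟨c, hc, hcl⟩ : ∃ c : K, c ≠ 0 ∧ leadForm q = MvPolynomial.C c * leadForm (p ^ k) := by
        refine exists_eq_C_mul_of_pow_eq (r := p.totalDegree) hp.ne' (c := c₀)
          (leadForm_ne_zero hq0) (leadForm_ne_zero (pow_ne_zero _ hp0)) ?_ ?_
        · rw [totalDegree_leadForm, totalDegree_leadForm, hqd]
        · rw [hl, hk, leadForm_pow, ← pow_mul, mul_comm k]
      refine ⟨c, k, ?_⟩
      have := sub_C_mul_mem_degLT hqd hcl
      rcases mem_degLT_iff.1 this with h | h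
      · rw [h]; simp; omega
      · exact_mod_cast h
    -- With independent leading forms, elements of degree one would lie in `K[p]`; but `x` and `y`
    -- have bracket one, and elements of `K[p]` have bracket zero.
    · exfalso
      have hsmall : ∀ G i, planeEval p q G = MvPolynomial.X i → ∃ g : K[X], G = C g := by
        intro G i hG
        have := S.natDegree_lt_of_indep hF hp0 hlead (G := G)
          (by rw [hG, hX1, planeEval_X]; omega)
        rw [natDegree_X] at this
        exact ⟨_, eq_C_of_natDegree_eq_zero (by omega)⟩
      obtain ⟨gx, rfl⟩ := hsmall Gx 0 hGx
      obtain ⟨gy, rfl⟩ := hsmall Gy 1 hGy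
      rw [planeEval_C] at hGx hGy
      have h0 := bracket_aeval_aeval p gx gy
      rw [hGx, hGy] at h0
      simp [bracket, MvPolynomial.pderiv_X] at h0
  · exfalso
    have hp2 : 2 ≤ p.totalDegree := by
      by_contra h
      apply hdvd
      rw [show p.totalDegree = 1 by omega]
      exact one_dvd _
    -- Without divisibility `deg p ≥ 2`, so no `g(p)` has degree one, and neither has any element of
    -- `K[p, q]`, contradicting `x ∈ K[p, q]`.
    refine S.totalDegree_ne_one hF (planeEval_C_C p q) hp (by rwa [planeEval_X])
      (Or.inr ⟨by rwa [planeEval_X], by rwa [planeEval_X]⟩) ?_ Gx (by rw [hGx, hX1])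
    intro G hG h1
    rw [natDegree_X] at hG
    obtain ⟨g', rfl⟩ : ∃ g : K[X], G = C g := ⟨_, eq_C_of_natDegree_eq_zero (by omega)⟩
    rw [planeEval_C] at h1
    by_cases hg : g' = 0
    · simp [hg] at h1
    · rw [(aeval_leading hp hg).1] at h1
      have := Nat.eq_one_of_mul_eq_one_left h1
      omega

/-! ### Reduced words in an amalgam of two subgroups. -/

/-- The list `w` alternates between `S t` and `S !t`, starting with `S t`. -/
def Alt {G : Type*} (S : Bool → Set G) : Bool → List G → Prop
  | _, [] => True
  | t, g :: w => g ∈ S t ∧ Alt S (!t) w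

section Alternating

variable {G : Type*} {S : Bool → Set G}

@[simp]
theorem alt_nil (t : Bool) : Alt S t [] := trivial

@[simp]
theorem alt_cons {t : Bool} {g : G} {w : List G} :
    Alt S t (g :: w) ↔ g ∈ S t ∧ Alt S (!t) w := Iff.rfl

theorem alt_append {t : Bool} {u v : List G} :
    Alt S t (u ++ v) ↔ Alt S t u ∧ Alt S (t ^^ u.length.bodd) v := by
  induction u generalizing t with
  | nil => simp
  | cons g u ih =>
    rw [List.cons_append, alt_cons, ih, alt_cons, List.length_cons, Nat.bodd_succ, and_assoc]
    cases t <;> cases u.length.bodd <;> simp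

theorem Alt.mono {S' : Bool → Set G} (h : ∀ t, S t ⊆ S' t) {t : Bool} {w : List G}
    (hw : Alt S t w) : Alt S' t w := by
  induction w generalizing t with
  | nil => trivial
  | cons g w ih => exact ⟨h t hw.1, ih hw.2⟩

theorem bodd_eq_false_of_even {n : ℕ} (h : Even n) : n.bodd = false := by
  obtain ⟨k, rfl⟩ := h
  simp

theorem bodd_eq_true_of_odd {n : ℕ} (h : Odd n) : n.bodd = true := by
  obtain ⟨k, rfl⟩ := h
  simp [Nat.bodd_two]

end Alternating

section Amalgam

variable {G : Type*} [Group G] (H : Bool → Subgroup G)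

/-- The letters of type `t` of reduced words: elements of one factor outside the other. -/
def letters (t : Bool) : Set G := {g | g ∈ H t ∧ g ∉ H (!t)}

/-- The intersection of the two factors. -/
def base : Subgroup G := H true ⊓ H false

/-- The subgroups `H true`, `H false` generate `G` as the amalgam over their intersection. -/
structure IsAmalgam : Prop where
  generate : Subgroup.closure ((H true : Set G) ∪ H false) = ⊤
  free : ∀ t w, Alt (letters H) t w → w ≠ [] → w.prod ∉ base H

variable {H}

theorem mem_of_mem_base {b : G} (hb : b ∈ base H) (t : Bool) : b ∈ H t := by
  cases t
  · exact hb.2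
  · exact hb.1

theorem mem_base_of_mem {b : G} {t : Bool} (h : b ∈ H t) (h' : b ∈ H (!t)) : b ∈ base H := by
  cases t
  · exact ⟨h', h⟩
  · exact ⟨h, h'⟩

theorem mem_letters_of_notMem_base {g : G} {t : Bool} (h : g ∈ H t) (h' : g ∉ base H) :
    g ∈ letters H t := ⟨h, fun h2 => h' (mem_base_of_mem h h2)⟩

theorem notMem_base_of_mem_letters {g : G} {t : Bool} (h : g ∈ letters H t) : g ∉ base H :=
  fun h' => h.2 (mem_of_mem_base h' _)

theorem base_mul_mem_letters {b g : G} {t : Bool} (hb : b ∈ base H) (hg : g ∈ letters H t) :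
    b * g ∈ letters H t :=
  ⟨mul_mem (mem_of_mem_base hb t) hg.1,
    fun h => hg.2 ((Subgroup.mul_mem_cancel_left _ (mem_of_mem_base hb _)).1 h)⟩

theorem mul_base_mem_letters {b g : G} {t : Bool} (hb : b ∈ base H) (hg : g ∈ letters H t) :
    g * b ∈ letters H t :=
  ⟨mul_mem hg.1 (mem_of_mem_base hb t),
    fun h => hg.2 ((Subgroup.mul_mem_cancel_right _ (mem_of_mem_base hb _)).1 h)⟩

theorem inv_mem_letters {g : G} {t : Bool} (hg : g ∈ letters H t) : g⁻¹ ∈ letters H t :=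
  ⟨inv_mem hg.1, fun h => hg.2 (inv_mem_iff.1 h)⟩

/-- The word representing the inverse. -/
def invWord (w : List G) : List G := (w.map (·⁻¹)).reverse

theorem invWord_prod (w : List G) : (invWord w).prod = w.prod⁻¹ := (List.prod_inv_reverse w).symm

@[simp]
theorem invWord_length (w : List G) : (invWord w).length = w.length := by simp [invWord]

/-- For nonempty `w`, the type `!t ^^ w.length.bodd` is that of its last letter. -/
theorem alt_invWord {t : Bool} {w : List G} (hw : Alt (letters H) t w) :
    Alt (letters H) (!t ^^ w.length.bodd) (invWord w) := by
  induction w generalizing t with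
  | nil => trivial
  | cons g w ih =>
    have h1 := ih hw.2
    have h2 : invWord (g :: w) = invWord w ++ [g⁻¹] := by simp [invWord]
    rw [h2, alt_append, List.length_cons, Nat.bodd_succ]
    refine ⟨by convert h1 using 1; cases t <;> cases w.length.bodd <;> rfl, ?_, trivial⟩
    have : (!t ^^ !w.length.bodd ^^ (invWord w).length.bodd) = t := by
      rw [invWord_length]
      cases t <;> cases w.length.bodd <;> rfl
    rw [this]
    exact inv_mem_letters hw.1

/-- The type of the letter after the inverse word matches that before the first letter. -/
theorem alt_invWord_append {t : Bool} {w v : List G} (hw : Alt (letters H) t w)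
    (hv : Alt (letters H) (!t) v) :
    Alt (letters H) (!t ^^ w.length.bodd) (invWord w ++ v) := by
  rw [alt_append]
  refine ⟨alt_invWord hw, ?_⟩
  rw [invWord_length]
  convert hv using 1
  cases t <;> cases w.length.bodd <;> rfl

theorem alt_base_mul {b g : G} {t : Bool} {w : List G} (hb : b ∈ base H)
    (hw : Alt (letters H) t (g :: w)) : Alt (letters H) t (b * g :: w) :=
  ⟨base_mul_mem_letters hb hw.1, hw.2⟩

theorem alt_mul_base {b g : G} {t : Bool} {w : List G} (hb : b ∈ base H)
    (hw : Alt (letters H) t (w ++ [g])) : Alt (letters H) t (w ++ [g * b]) := by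
  rw [alt_append] at *
  exact ⟨hw.1, mul_base_mem_letters hb hw.2.1, trivial⟩

/-- A function on `G` that is invariant under multiplication by the intersection. -/
def BaseInvariant (H : Bool → Subgroup G) (δ : G → ℕ) : Prop :=
  ∀ g, ∀ b ∈ base H, δ (b * g) = δ g ∧ δ (g * b) = δ g

namespace IsAmalgam

theorem eq_nil (hH : IsAmalgam H) {t : Bool} {w : List G} (hw : Alt (letters H) t w)
    (h : w.prod ∈ base H) : w = [] := by
  by_contra h0
  exact hH.free t w hw h0 h

/-- Reduced words are unique up to the intersection of the factors. -/
theorem map_eq_of_prod_eq (hH : IsAmalgam H) {δ : G → ℕ} (hδ : BaseInvariant H δ) {t t' : Bool}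
    {w w' : List G} (hw : Alt (letters H) t w) (hw' : Alt (letters H) t' w') {b : G}
    (hb : b ∈ base H) (h : w.prod = b * w'.prod) : w.map δ = w'.map δ := by
  induction w generalizing t t' w' b with
  | nil =>
    have : w' = [] := by
      refine hH.eq_nil hw' ?_
      have h1 : w'.prod = b⁻¹ := by
        rw [List.prod_nil] at h
        exact (inv_eq_of_mul_eq_one_right h.symm).symm
      rw [h1]
      exact inv_mem hb
    rw [this]
  | cons g u ih =>
    rcases w' with _ | ⟨k, u'⟩
    · rw [List.prod_nil, mul_one] at h
      exact absurd (hH.eq_nil hw (h ▸ hb)) (by simp)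
    have hw'' := alt_base_mul hb hw'
    rw [List.prod_cons, List.prod_cons] at h
    -- First letters of the same type must agree up to the base, or else `u⁻¹ (g⁻¹ b k) u'` is a
    -- nonempty reduced word for the identity. For different types, the inverse word followed by the
    -- other is already reduced.
    by_cases htt : t' = t
    · subst htt
      have hmem : g⁻¹ * (b * k) ∈ H t' := mul_mem (inv_mem hw.1.1) hw''.1.1
      by_cases hbase : g⁻¹ * (b * k) ∈ base H
      · have hu : u.prod = g⁻¹ * (b * k) * u'.prod := by
          rw [mul_assoc, mul_assoc, ← h, inv_mul_cancel_left]
        rw [List.map_cons, List.map_cons, ih hw.2 hw'.2 hbase hu]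
        congr 1
        have : b * k = g * (g⁻¹ * (b * k)) := by group
        rw [← (hδ k b hb).1, this, (hδ g _ hbase).2]
      · exfalso
        have hred : Alt (letters H) (!!t' ^^ u.length.bodd)
            (invWord u ++ (g⁻¹ * (b * k)) :: u') := by
          refine alt_invWord_append hw.2 ?_
          rw [Bool.not_not]
          exact ⟨mem_letters_of_notMem_base hmem hbase, hw'.2⟩
        refine absurd (hH.eq_nil hred ?_) (by simp)
        rw [List.prod_append, invWord_prod, List.prod_cons]
        have : u.prod⁻¹ * (g⁻¹ * (b * k) * u'.prod) = 1 := by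
          rw [mul_assoc, mul_assoc, ← h]
          group
        rw [this]
        exact one_mem _
    · exfalso
      have ht : t' = !t := by cases t <;> cases t' <;> simp_all
      subst ht
      have hred := alt_invWord_append hw hw''
      refine absurd (hH.eq_nil hred ?_) (by simp)
      rw [List.prod_append, invWord_prod, List.prod_cons, List.prod_cons, mul_assoc, ← h,
        inv_mul_cancel]
      exact one_mem _

/-- Every element outside the intersection is represented by a reduced word. -/
theorem exists_word (hH : IsAmalgam H) (g : G) :
    g ∈ base H ∨ ∃ t w, w ≠ [] ∧ Alt (letters H) t w ∧ g = w.prod := by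
  have key : ∀ s, ∀ h ∈ H s, ∀ y : G, (y ∈ base H ∨ ∃ t w, w ≠ [] ∧ Alt (letters H) t w ∧
      y = w.prod) → (h * y ∈ base H ∨ ∃ t w, w ≠ [] ∧ Alt (letters H) t w ∧ h * y = w.prod) := by
    rintro s h hh y (hy | ⟨t, w, hw0, hw, rfl⟩)
    · by_cases hb : h * y ∈ base H
      · exact Or.inl hb
      · refine Or.inr ⟨s, [h * y], by simp, ⟨?_, trivial⟩, by simp⟩
        exact mem_letters_of_notMem_base (mul_mem hh (mem_of_mem_base hy s)) hb
    · rcases w with _ | ⟨g, u⟩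
      · exact absurd rfl hw0
      by_cases hgt : h ∈ H t
      · by_cases hb : h * g ∈ base H
        · rcases u with _ | ⟨g', u⟩
          · left; simpa using hb
          · exact Or.inr ⟨!t, (h * g) * g' :: u, by simp, alt_base_mul hb hw.2,
              by simp [mul_assoc]⟩
        · exact Or.inr ⟨t, h * g :: u, by simp,
            ⟨mem_letters_of_notMem_base (mul_mem hgt hw.1.1) hb, hw.2⟩, by simp [mul_assoc]⟩
      · have hs : s = !t := by cases s <;> cases t <;> simp_all
        subst hs
        refine Or.inr ⟨!t, h :: g :: u, by simp, ⟨⟨hh, by simpa using hgt⟩, ?_⟩, by simp⟩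
        rw [Bool.not_not]
        exact hw
  have hg : g ∈ Subgroup.closure ((H true : Set G) ∪ H false) := by
    rw [hH.generate]; exact Subgroup.mem_top g
  induction hg using Subgroup.closure_induction_left with
  | one => exact Or.inl (one_mem _)
  | mul_left x hx y _ ih =>
    rcases hx with hx | hx
    · exact key true x hx y ih
    · exact key false x hx y ih
  | inv_mul_cancel x hx y _ ih =>
    rcases hx with hx | hx
    · exact key true _ (inv_mem hx) y ih
    · exact key false _ (inv_mem hx) y ih

/-- Involutions are conjugate into one of the factors. -/
theorem exists_isConj_of_mul_self (hH : IsAmalgam H) {s : G} (hs : s * s = 1) :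
    ∃ t, ∃ σ ∈ H t, IsConj s σ := by
  rcases hH.exists_word s with hb | ⟨t, w, -, hw, rfl⟩
  · exact ⟨true, s, mem_of_mem_base hb _, IsConj.refl s⟩
  induction hn : w.length using Nat.strong_induction_on generalizing t w with
  | _ n ih =>
    rcases w with _ | ⟨g, u⟩
    · exact ⟨t, 1, one_mem _, by simp⟩
    rcases List.eq_nil_or_concat u with rfl | ⟨m, h, rfl⟩
    · exact ⟨t, g, hw.1.1, by rw [List.prod_singleton]⟩
    rw [List.concat_eq_append] at *
    have hw' := hw
    rw [alt_cons, alt_append] at hw'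
    obtain ⟨hg, hm, hh, -⟩ := hw'
    -- If `m` has even length, so does the word, and its square is reduced as it stands. Otherwise
    -- the end letters have the same type: either `h g` is basic and conjugating by `g⁻¹` shortens
    -- the word, or merging `h g` makes the square reduced.
    rcases Nat.even_or_odd (m.length) with hev | hodd
    · exfalso
      have hred : Alt (letters H) t ((g :: (m ++ [h])) ++ (g :: (m ++ [h]))) := by
        rw [alt_append]
        refine ⟨hw, ?_⟩
        rw [bodd_eq_false_of_even, Bool.xor_false]
        · exact hw
        · simpa [add_assoc] using hev.add even_two
      refine absurd (hH.eq_nil hred ?_) (by simp)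
      rw [List.prod_append, hs]
      exact one_mem _
    · rw [bodd_eq_true_of_odd hodd] at hh
      have hh' : h ∈ letters H t := by simpa using hh
      have hprod : (g :: (m ++ [h])).prod = g * m.prod * h := by simp [mul_assoc]
      rw [hprod] at hs ⊢
      by_cases hb : h * g ∈ base H
      · rcases List.eq_nil_or_concat m with rfl | ⟨m', x, rfl⟩
        · simp at hodd
        rw [List.concat_eq_append] at *
        have hconj : IsConj (g * (m' ++ [x]).prod * h) (m' ++ [x * (h * g)]).prod := by
          rw [isConj_iff]
          refine ⟨g⁻¹, ?_⟩
          simp [mul_assoc]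
        obtain ⟨k, hk⟩ := isConj_iff.1 hconj
        obtain ⟨t', σ, hσ, hc⟩ := ih (m' ++ [x * (h * g)]).length (by simp at hn ⊢; omega) _ _
          (alt_mul_base hb hm) (by
            rw [← hk]
            calc k * (g * (m' ++ [x]).prod * h) * k⁻¹ * (k * (g * (m' ++ [x]).prod * h) * k⁻¹)
                = k * ((g * (m' ++ [x]).prod * h) * (g * (m' ++ [x]).prod * h)) * k⁻¹ := by group
              _ = 1 := by rw [hs]; group) rfl
        exact ⟨t', σ, hσ, hconj.trans hc⟩
      · exfalso
        have hred : Alt (letters H) t ((g :: m) ++ (h * g) :: (m ++ [h])) := by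
          rw [alt_append, alt_cons, alt_cons, List.length_cons, Nat.bodd_succ,
            bodd_eq_true_of_odd hodd]
          refine ⟨⟨hg, hm⟩, ?_, ?_⟩
          · simpa using mem_letters_of_notMem_base (mul_mem hh'.1 hg.1) hb
          · simpa using hw.2
        refine absurd (hH.eq_nil hred ?_) (by simp)
        have : ((g :: m) ++ (h * g) :: (m ++ [h])).prod = g * m.prod * h * (g * m.prod * h) := by
          simp [mul_assoc]
        rw [this, hs]
        exact one_mem _

end IsAmalgam

theorem eq_not_of_mem_of_notMem {g : G} {s t : Bool} (h : g ∈ H s) (h' : g ∉ H t) : s = !t := by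
  refine Bool.eq_not.2 ?_
  rintro rfl
  exact h' h

/-! ### Conjugates of cyclically reduced words. -/

/-- The conjugates of an element with a reduced word of even length: either they have such a word
themselves, or they have a reduced word `v z y (x z⁻¹) v⁻¹` of odd length. Here `L` is, up to
rotation, the list of values of `δ` on the letters of the cyclically reduced word. -/
inductive CycClass (H : Bool → Subgroup G) (δ : G → ℕ) (L : List ℕ) : G → Prop
  | core (t : Bool) (g x : G) (y : List G) (hred : Alt (letters H) t (g :: (y ++ [x])))
      (heven : Even y.length) (hrot : (g :: (y ++ [x])).map δ ~r L) :
      CycClass H δ L (g * y.prod * x)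
  -- As `y` has odd length, `x` and `z` have the same type, and `hstuck` makes `x z⁻¹` a letter.
  | conj (t : Bool) (v : List G) (z x : G) (y : List G)
      (hred : Alt (letters H) t (v ++ z :: (y ++ [x])))
      (hodd : Odd y.length) (hstuck : x * z⁻¹ ∉ base H) (hrot : (y ++ [x]).map δ ~r L) :
      CycClass H δ L (v.prod * z * (y.prod * x) * (v.prod * z)⁻¹)

namespace CycClass

variable {δ : G → ℕ} {L : List ℕ}

theorem of_word {t : Bool} {w : List G} (hw : Alt (letters H) t w) (h0 : w ≠ [])
    (heven : Even w.length) (hrot : w.map δ ~r L) : CycClass H δ L w.prod := by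
  rcases w with _ | ⟨g, u⟩
  · exact absurd rfl h0
  rcases List.eq_nil_or_concat u with rfl | ⟨y, x, rfl⟩
  · simp at heven
  rw [List.concat_eq_append] at *
  have : (g :: (y ++ [x])).prod = g * y.prod * x := by simp [mul_assoc]
  rw [this]
  refine core t g x y hw ?_ hrot
  simpa [add_assoc, Nat.even_add] using heven

/-- The end letters have different types, so a letter `h` can interact with only one of them. If it
cancels that letter up to the base, the word is rotated by one place; otherwise a stuck conjugate
arises. -/
theorem conj_core {s t : Bool} {h g x : G} {y : List G} (hδ : BaseInvariant H δ) (hh : h ∈ H s)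
    (hred : Alt (letters H) t (g :: (y ++ [x]))) (heven : Even y.length)
    (hrot : (g :: (y ++ [x])).map δ ~r L) : CycClass H δ L (h * (g * y.prod * x) * h⁻¹) := by
  have hred' := hred
  rw [alt_cons, alt_append, bodd_eq_false_of_even heven, Bool.xor_false] at hred'
  obtain ⟨hg, hy, hx, -⟩ := hred'
  by_cases hb : h ∈ base H
  · have : h * (g * y.prod * x) * h⁻¹ = (h * g) * y.prod * (x * h⁻¹) := by group
    rw [this]
    refine core t (h * g) (x * h⁻¹) y ⟨base_mul_mem_letters hb hg, ?_⟩ heven ?_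
    · exact alt_mul_base (inv_mem hb) hred.2
    · simpa [(hδ g h hb).1, (hδ x _ (inv_mem hb)).2] using hrot
  have hhs := mem_letters_of_notMem_base hh hb
  by_cases hst : s = t
  · subst hst
    -- If `h g` is basic, `h⁻¹` is `g` up to the base, so `g` moves to the end. Otherwise `h g`
    -- becomes the letter `z`, with core `y x g`.
    by_cases hhg : h * g ∈ base H
    · obtain ⟨l, r, hlr⟩ : ∃ l r, y ++ [x] = l :: r := by
        rcases y with _ | ⟨a, y⟩
        · exact ⟨x, [], rfl⟩
        · exact ⟨a, y ++ [x], rfl⟩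
      have hprod : y.prod * x = l * r.prod := by
        rw [← List.prod_cons, ← hlr]; simp
      have hredlr : Alt (letters H) (!s) (l :: r) := hlr ▸ hred.2
      have hlen : Odd (l :: r).length := by rw [← hlr]; simpa using heven.add_one
      have : h * (g * y.prod * x) * h⁻¹ = ((h * g * l) :: (r ++ [h⁻¹])).prod := by
        rw [List.prod_cons, List.prod_append, List.prod_singleton]
        calc h * (g * y.prod * x) * h⁻¹ = h * g * (y.prod * x) * h⁻¹ := by group
          _ = _ := by rw [hprod]; group
      rw [this]
      refine of_word (t := !s) ?_ (by simp) (by simpa [Nat.even_add_one, Nat.odd_add_one] using hlen) ?_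
      · rw [← List.cons_append, alt_append]
        refine ⟨alt_base_mul hhg hredlr, ?_, trivial⟩
        have : (h * g * l :: r).length.bodd = true := bodd_eq_true_of_odd (by simpa using hlen)
        rw [this]
        simpa using inv_mem_letters hhs
      · have h1 : δ h⁻¹ = δ g := by
          have : h⁻¹ = g * (h * g)⁻¹ := by group
          rw [this, (hδ g _ (inv_mem hhg)).2]
        have h2 : (h * g * l :: (r ++ [h⁻¹])).map δ = (l :: r).map δ ++ [δ g] := by
          simp [(hδ l _ hhg).1, h1]
        rw [h2]
        refine List.IsRotated.trans ?_ hrot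
        rw [List.map_cons, hlr]
        exact (List.isRotated_append (l := [δ g]) (l' := (l :: r).map δ)).symm
    · have : h * (g * y.prod * x) * h⁻¹ =
          ([] : List G).prod * (h * g) * ((y ++ [x]).prod * g) * (([] : List G).prod * (h * g))⁻¹ := by
        simp only [List.prod_nil, List.prod_append, List.prod_singleton]
        group
      rw [this]
      refine conj s [] (h * g) g (y ++ [x]) ?_ (by simpa using heven.add_one) ?_ ?_
      · refine ⟨mem_letters_of_notMem_base (mul_mem hh hg.1) hhg, ?_⟩
        rw [alt_append]
        refine ⟨hred.2, ?_, trivial⟩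
        rw [bodd_eq_true_of_odd (by simpa using heven.add_one)]
        simpa using hg
      · have : g * (h * g)⁻¹ = h⁻¹ := by group
        rw [this]
        exact fun h' => hb (inv_mem_iff.1 h')
      · refine List.IsRotated.trans ?_ hrot
        rw [List.map_append, List.map_cons]
        exact (List.isRotated_append (l := [δ g]) (l' := (y ++ [x]).map δ)).symm
  · have hst' : t = !s := by cases s <;> cases t <;> simp_all
    subst hst'
    by_cases hxh : x * h⁻¹ ∈ base H
    · obtain ⟨r, l, hlr⟩ : ∃ r l, g :: y = r ++ [l] := by
        rcases List.eq_nil_or_concat (g :: y) with h | ⟨r, l, h⟩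
        · simp at h
        · exact ⟨r, l, by simpa using h⟩
      have hprod : g * y.prod = r.prod * l := by
        rw [← List.prod_cons, hlr]; simp
      have hredlr : Alt (letters H) (!s) (r ++ [l]) := by
        rw [← hlr]; exact ⟨hg, hy⟩
      have : h * (g * y.prod * x) * h⁻¹ = (h :: (r ++ [l * (x * h⁻¹)])).prod := by
        rw [List.prod_cons, List.prod_append, List.prod_singleton, hprod]
        group
      rw [this]
      have hlen : Odd (r ++ [l]).length := by rw [← hlr]; simpa using heven.add_one
      refine of_word (t := s) ⟨hhs, alt_mul_base hxh hredlr⟩ (by simp)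
        (by simpa [Nat.even_add_one, Nat.odd_add_one] using hlen) ?_
      have h1 : δ h = δ x := by
        have : x = (x * h⁻¹) * h := by group
        rw [this, (hδ h _ hxh).1]
      have h2 : (h :: (r ++ [l * (x * h⁻¹)])).map δ = [δ x] ++ (g :: y).map δ := by
        rw [hlr]
        simp [(hδ l _ hxh).2, h1]
      rw [h2]
      refine List.IsRotated.trans ?_ hrot
      rw [← List.cons_append, List.map_append]
      exact List.isRotated_append
    · have : h * (g * y.prod * x) * h⁻¹ =
          ([] : List G).prod * h * ((g :: y).prod * x) * (([] : List G).prod * h)⁻¹ := by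
        simp only [List.prod_nil, List.prod_cons]
        group
      rw [this]
      exact conj s [] h x (g :: y) ⟨hhs, hred⟩ (by simpa using heven.add_one) hxh hrot

/-- For stuck conjugates only the front of the conjugating word changes. The core is affected only
when that word is the single letter `z`, of the type of `h`; this is `conj_core` again. -/
theorem conj_mem (hδ : BaseInvariant H δ) {s : Bool} {h a : G} (hh : h ∈ H s)
    (ha : CycClass H δ L a) : CycClass H δ L (h * a * h⁻¹) := by
  rcases ha with ⟨t, g, x, y, hred, heven, hrot⟩ | ⟨t, v, z, x, y, hred, hodd, hstuck, hrot⟩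
  · exact conj_core hδ hh hred heven hrot
  · rcases v with _ | ⟨g, v⟩
    · by_cases hht : h ∈ H t
      · obtain ⟨g, y', rfl⟩ : ∃ g y', y = g :: y' := by
          rcases y with _ | ⟨g, y'⟩
          · simp at hodd
          · exact ⟨g, y', rfl⟩
        have : h * (([] : List G).prod * z * ((g :: y').prod * x) * (([] : List G).prod * z)⁻¹) * h⁻¹
            = (h * z) * (g * y'.prod * x) * (h * z)⁻¹ := by
          simp only [List.prod_nil, List.prod_cons]
          group
        rw [this]
        refine conj_core hδ (mul_mem hht hred.1.1) hred.2 ?_ hrot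
        simpa [Nat.odd_add_one] using hodd
      · have hs : s = !t := eq_not_of_mem_of_notMem hh hht
        subst hs
        have : h * (([] : List G).prod * z * (y.prod * x) * (([] : List G).prod * z)⁻¹) * h⁻¹
            = [h].prod * z * (y.prod * x) * ([h].prod * z)⁻¹ := by
          simp only [List.prod_nil, List.prod_singleton]
          group
        rw [this]
        refine conj (!t) [h] z x y ⟨⟨hh, by simpa using hht⟩, ?_⟩ hodd hstuck hrot
        rw [Bool.not_not]
        exact hred
    · by_cases hht : h ∈ H t
      · by_cases hb : h * g ∈ base H
        · rcases v with _ | ⟨g', v⟩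
          · have : h * ([g].prod * z * (y.prod * x) * ([g].prod * z)⁻¹) * h⁻¹
                = ([] : List G).prod * (h * g * z) * (y.prod * x) *
                  (([] : List G).prod * (h * g * z))⁻¹ := by
              simp only [List.prod_nil, List.prod_singleton]
              group
            rw [this]
            refine conj (!t) [] (h * g * z) x y ?_ hodd ?_ hrot
            · exact alt_base_mul hb hred.2
            · rw [mul_inv_rev, ← mul_assoc, Subgroup.mul_mem_cancel_right _ (inv_mem hb)]
              exact hstuck
          · have : h * ((g :: g' :: v).prod * z * (y.prod * x) * ((g :: g' :: v).prod * z)⁻¹) * h⁻¹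
                = (h * g * g' :: v).prod * z * (y.prod * x) *
                  ((h * g * g' :: v).prod * z)⁻¹ := by
              simp only [List.prod_cons]
              group
            rw [this]
            exact conj (!t) (h * g * g' :: v) z x y (alt_base_mul hb hred.2) hodd hstuck hrot
        · have : h * ((g :: v).prod * z * (y.prod * x) * ((g :: v).prod * z)⁻¹) * h⁻¹
              = (h * g :: v).prod * z * (y.prod * x) * ((h * g :: v).prod * z)⁻¹ := by
            simp only [List.prod_cons]
            group
          rw [this]
          exact conj t (h * g :: v) z x y
            ⟨mem_letters_of_notMem_base (mul_mem hht hred.1.1) hb, hred.2⟩ hodd hstuck hrot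
      · have hs : s = !t := eq_not_of_mem_of_notMem hh hht
        subst hs
        have : h * ((g :: v).prod * z * (y.prod * x) * ((g :: v).prod * z)⁻¹) * h⁻¹
            = (h :: g :: v).prod * z * (y.prod * x) * ((h :: g :: v).prod * z)⁻¹ := by
          simp only [List.prod_cons]
          group
        rw [this]
        refine conj (!t) (h :: g :: v) z x y ⟨⟨hh, by simpa using hht⟩, ?_⟩ hodd hstuck hrot
        rw [Bool.not_not]
        exact hred

theorem of_isConj (hH : IsAmalgam H) (hδ : BaseInvariant H δ) {a a' : G}
    (ha : CycClass H δ L a) (h : IsConj a a') : CycClass H δ L a' := by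
  obtain ⟨c, rfl⟩ := isConj_iff.1 h
  have hc : c ∈ Subgroup.closure ((H true : Set G) ∪ H false) := by
    rw [hH.generate]; exact Subgroup.mem_top c
  clear h
  have key : ∀ s, ∀ x ∈ H s, ∀ y : G, CycClass H δ L (y * a * y⁻¹) →
      CycClass H δ L (x * y * a * (x * y)⁻¹) := by
    intro s x hx y hy
    have := conj_mem hδ hx hy
    convert this using 1
    group
  induction hc using Subgroup.closure_induction_left with
  | one => simpa using ha
  | mul_left x hx y _ ih =>
    rcases hx with hx | hx
    · exact key true x hx y ih
    · exact key false x hx y ih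
  | inv_mul_cancel x hx y _ ih =>
    rcases hx with hx | hx
    · exact key true _ (inv_mem hx) y ih
    · exact key false _ (inv_mem hx) y ih

/-- A member of the class has a reduced word, which if its length is even realizes `L` up to
rotation, and which has at least two letters. -/
theorem exists_word {a : G} (ha : CycClass H δ L a) : ∃ t w, Alt (letters H) t w ∧ a = w.prod ∧
    2 ≤ w.length ∧ (Odd w.length ∨ w.map δ ~r L) := by
  rcases ha with ⟨t, g, x, y, hred, heven, hrot⟩ | ⟨t, v, z, x, y, hred, hodd, hstuck, hrot⟩
  · exact ⟨t, _, hred, by simp [mul_assoc], by simp, Or.inr hrot⟩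
  · refine ⟨t, v ++ z :: (y ++ (x * z⁻¹) :: invWord v), ?_, ?_, by simp; omega, Or.inl ?_⟩
    · rw [alt_append, alt_cons, alt_append, alt_cons] at *
      obtain ⟨hv, hz, hy, hx, -⟩ := hred
      refine ⟨hv, hz, hy, mem_letters_of_notMem_base ?_ hstuck, ?_⟩
      · refine mul_mem hx.1 (inv_mem ?_)
        rw [bodd_eq_true_of_odd hodd]
        simpa using hz.1
      · rw [bodd_eq_true_of_odd hodd]
        have := alt_invWord hv
        convert this using 1
        cases t <;> cases v.length.bodd <;> rfl
    · simp only [List.prod_append, List.prod_cons, invWord_prod]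
      group
    · have : (v ++ z :: (y ++ (x * z⁻¹) :: invWord v)).length = (v.length + v.length) + (y.length + 1 + 1) := by
        simp; omega
      rw [this]
      exact Even.add_odd ⟨_, rfl⟩ hodd.add_one.add_one

/-- The length of a reduced word is determined by its product, and stuck conjugates have odd length.
-/
theorem isRotated_of_word (hH : IsAmalgam H) (hδ : BaseInvariant H δ) {t : Bool} {w : List G}
    (hw : Alt (letters H) t w) (heven : Even w.length) (h : CycClass H δ L w.prod) :
    w.map δ ~r L := by
  obtain ⟨t', w', hw', hprod, -, hor⟩ := h.exists_word
  have := hH.map_eq_of_prod_eq hδ hw hw' (one_mem _) (by rw [one_mul, hprod])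
  rcases hor with hodd | hrot
  · have hl := congrArg List.length this
    simp only [List.length_map] at hl
    rw [← hl] at hodd
    exact absurd heven (Nat.not_even_iff_odd.2 hodd)
  · rwa [this]

/-- Elements of a factor have length at most one, members of the class at least two. -/
theorem notMem (hH : IsAmalgam H) {a : G} (ha : CycClass H δ L a) (s : Bool) : a ∉ H s := by
  intro hs
  obtain ⟨t, w, hw, rfl, hlen, -⟩ := ha.exists_word
  have hδ0 : BaseInvariant H (fun _ => 0) := fun _ _ _ => ⟨rfl, rfl⟩
  by_cases hb : w.prod ∈ base H
  · have := hH.eq_nil hw hb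
    simp [this] at hlen
  · have h1 : Alt (letters H) s [w.prod] := ⟨mem_letters_of_notMem_base hs hb, trivial⟩
    have := congrArg List.length
      (hH.map_eq_of_prod_eq hδ0 hw h1 (one_mem _) (by simp))
    simp only [List.length_map, List.length_singleton] at this
    omega

end CycClass

/-! ### Products of two involutions, and normal forms. -/

namespace IsAmalgam

/-- A product of two involutions that is not conjugate into a factor is conjugate to
`c σ c⁻¹ τ` with involutions `σ`, `τ` in the factors and no cancellation. -/
theorem exists_involution_form (hH : IsAmalgam H) {f s r : G} (hf : f = s * r) (hs : s * s = 1)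
    (hr : r * r = 1) (hnot : ∀ t, ∀ a ∈ H t, ¬ IsConj f a) :
    ∃ t τ w σ, Alt (letters H) t (τ :: (w ++ [σ])) ∧ σ * σ = 1 ∧ τ * τ = 1 ∧
      IsConj f (w.prod * σ * w.prod⁻¹ * τ) := by
  -- The conjugating word is shortened from either end by conjugating the adjacent involution
  -- whenever it lies in the factor of the end letter.
  have key : ∀ (n : ℕ) (i j t : Bool) (σ τ : G) (w : List G), w.length = n → Alt (letters H) t w →
      σ ∈ H i → τ ∈ H j → σ * σ = 1 → τ * τ = 1 → IsConj f (w.prod * σ * w.prod⁻¹ * τ) →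
      ∃ t τ w σ, Alt (letters H) t (τ :: (w ++ [σ])) ∧ σ * σ = 1 ∧ τ * τ = 1 ∧
      IsConj f (w.prod * σ * w.prod⁻¹ * τ) := by
    intro n
    induction n with
    | zero =>
      intro i j t σ τ w hw0 _ hσ hτ hσ2 hτ2 hc
      obtain rfl := List.length_eq_zero_iff.1 hw0
      have hc' : IsConj f (σ * τ) := by simpa using hc
      -- With nothing left to absorb, a common factor of `σ` and `τ` would contain a conjugate of
      -- `f`.
      have hσb : σ ∉ base H := fun hb => hnot j _ (mul_mem (mem_of_mem_base hb j) hτ) hc'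
      have hτb : τ ∉ base H := fun hb => hnot i _ (mul_mem hσ (mem_of_mem_base hb i)) hc'
      have hij : i = !j :=
        eq_not_of_mem_of_notMem hσ fun h => hnot j _ (mul_mem h hτ) hc'
      subst hij
      exact ⟨j, τ, [], σ, ⟨mem_letters_of_notMem_base hτ hτb,
        mem_letters_of_notMem_base hσ hσb, trivial⟩, hσ2, hτ2, hc⟩
    | succ n ih =>
      intro i j t σ τ w hwn hw hσ hτ hσ2 hτ2 hc
      have hconjsq : ∀ a b : G, a * a = 1 → b * a * b⁻¹ * (b * a * b⁻¹) = 1 := by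
        intro a b h
        calc b * a * b⁻¹ * (b * a * b⁻¹) = b * (a * a) * b⁻¹ := by group
          _ = 1 := by rw [h]; group
      by_cases hτt : τ ∈ H t
      · rcases w with _ | ⟨g, u⟩
        · simp at hwn
        refine ih i t (!t) σ (g⁻¹ * τ * g⁻¹⁻¹) u (by simpa using hwn) hw.2 hσ
          (mul_mem (mul_mem (inv_mem hw.1.1) hτt) (inv_mem (inv_mem hw.1.1))) hσ2
          (hconjsq _ _ hτ2) (hc.trans ?_)
        rw [isConj_iff]
        refine ⟨g⁻¹, ?_⟩
        simp only [List.prod_cons]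
        group
      have hj : j = !t := eq_not_of_mem_of_notMem hτ hτt
      subst hj
      have hτl : τ ∈ letters H (!t) := ⟨hτ, by simpa using hτt⟩
      rcases List.eq_nil_or_concat w with rfl | ⟨u, x, rfl⟩
      · simp at hwn
      rw [List.concat_eq_append] at *
      have hw' := hw
      rw [alt_append] at hw'
      obtain ⟨hu, hx, -⟩ := hw'
      by_cases hσx : σ ∈ H (t ^^ u.length.bodd)
      · refine ih (t ^^ u.length.bodd) (!t) t (x * σ * x⁻¹) τ u (by simpa using hwn) hu
          (mul_mem (mul_mem hx.1 hσx) (inv_mem hx.1)) hτ (hconjsq _ _ hσ2) hτ2 ?_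
        convert hc using 1
        simp only [List.prod_append, List.prod_singleton]
        group
      · refine ⟨!t, τ, u ++ [x], σ, ⟨hτl, ?_⟩, hσ2, hτ2, hc⟩
        rw [Bool.not_not, alt_append]
        refine ⟨hw, ?_, trivial⟩
        have : i = !(t ^^ u.length.bodd) := eq_not_of_mem_of_notMem hσ hσx
        rw [List.length_append, List.length_singleton, Nat.bodd_succ]
        subst this
        have h2 : (!(t ^^ u.length.bodd)) = (t ^^ !u.length.bodd) := by
          cases t <;> cases u.length.bodd <;> rfl
        rw [← h2]
        exact ⟨hσ, by simpa using hσx⟩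
  obtain ⟨i, σ, hσ, hsσ⟩ := hH.exists_isConj_of_mul_self hs
  obtain ⟨j, τ, hτ, hrτ⟩ := hH.exists_isConj_of_mul_self hr
  obtain ⟨a, ha⟩ := isConj_iff.1 hsσ
  obtain ⟨b, hb⟩ := isConj_iff.1 hrτ
  have hσ2 : σ * σ = 1 := by
    rw [← ha]
    calc a * s * a⁻¹ * (a * s * a⁻¹) = a * (s * s) * a⁻¹ := by group
      _ = 1 := by rw [hs]; group
  have hτ2 : τ * τ = 1 := by
    rw [← hb]
    calc b * r * b⁻¹ * (b * r * b⁻¹) = b * (r * r) * b⁻¹ := by group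
      _ = 1 := by rw [hr]; group
  have hconj : IsConj f ((b * a⁻¹) * σ * (b * a⁻¹)⁻¹ * τ) := by
    rw [isConj_iff]
    refine ⟨b, ?_⟩
    rw [hf, ← ha, ← hb]
    group
  rcases hH.exists_word (b * a⁻¹) with hbase | ⟨t, w, -, hw, hprod⟩
  · refine key 0 i j true ((b * a⁻¹) * σ * (b * a⁻¹)⁻¹) τ [] rfl trivial
      (mul_mem (mul_mem (mem_of_mem_base hbase i) hσ) (inv_mem (mem_of_mem_base hbase i)))
      hτ ?_ hτ2 (by simpa using hconj)
    calc _ = (b * a⁻¹) * (σ * σ) * (b * a⁻¹)⁻¹ := by group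
      _ = 1 := by rw [hσ2]; group
  · exact key _ i j t σ τ w rfl hw hσ hτ hσ2 hτ2 (hprod ▸ hconj)

end IsAmalgam

/-- Normal forms: a reduced word is rewritten with coset representatives. -/
theorem exists_normal_word {R : Bool → Set G} {δ : G → ℕ} (hδ : BaseInvariant H δ)
    (hR : ∀ t, ∀ g ∈ letters H t, ∃ b ∈ base H, ∃ r ∈ R t, g = b * r) {t : Bool} {w : List G}
    (hw : Alt (letters H) t w) : ∃ b ∈ base H, ∃ w', Alt R t w' ∧ w.prod = b * w'.prod ∧
      w'.map δ = w.map δ := by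
  induction w generalizing t with
  | nil => exact ⟨1, one_mem _, [], trivial, by simp, rfl⟩
  | cons g u ih =>
    -- The word is rewritten from right to left; the basic part of the tail is absorbed by the
    -- preceding letter.
    obtain ⟨b, hb, u', hu', hprod, hmap⟩ := ih hw.2
    obtain ⟨b', hb', r, hr, hgr⟩ := hR t (g * b) (mul_base_mem_letters hb hw.1)
    refine ⟨b', hb', r :: u', ⟨hr, hu'⟩, ?_, ?_⟩
    · rw [List.prod_cons, hprod, List.prod_cons, ← mul_assoc, ← mul_assoc, hgr]
    · rw [List.map_cons, List.map_cons, hmap, ← (hδ g b hb).2, hgr, (hδ r b' hb').1]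

end Amalgam

/-! ### Explicit elementary and affine maps, and the letters they give. -/

/-- The polynomial map `x' = α x + P(y)`, `y' = β y + v`. -/
noncomputable def elemMap (α : K) (P : K[X]) (β v : K) : PolyMap K :=
  ⟨MvPolynomial.C α * MvPolynomial.X 0 + aeval (MvPolynomial.X 1) P,
    MvPolynomial.C β * MvPolynomial.X 1 + MvPolynomial.C v⟩

/-- The polynomial map `x' = m₀₀ x + m₀₁ y + u`, `y' = m₁₀ x + m₁₁ y + v`. -/
noncomputable def affMap (M : Matrix (Fin 2) (Fin 2) K) (u v : K) : PolyMap K :=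
  ⟨MvPolynomial.C (M 0 0) * MvPolynomial.X 0 + MvPolynomial.C (M 0 1) * MvPolynomial.X 1
    + MvPolynomial.C u,
   MvPolynomial.C (M 1 0) * MvPolynomial.X 0 + MvPolynomial.C (M 1 1) * MvPolynomial.X 1
    + MvPolynomial.C v⟩

theorem isElemMap_iff {g : GA2 K} {α : K} {P : K[X]} {β v : K} :
    IsElemMap g α P β v ↔ g.val = elemMap α P β v := by
  rw [PolyMap.ext_iff]; rfl

theorem isAffineMap_iff {g : GA2 K} {M : Matrix (Fin 2) (Fin 2) K} {u v : K} :
    IsAffineMap g M u v ↔ g.val = affMap M u v := by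
  rw [PolyMap.ext_iff]; rfl

theorem mem_elementary {g : GA2 K} :
    g ∈ elementary K ↔ ∃ (α β v : K) (P : K[X]), α * β ≠ 0 ∧ g.val = elemMap α P β v := by
  simp only [elementary, isElemMap_iff]
  rfl

theorem mem_affine {g : GA2 K} :
    g ∈ affine K ↔ ∃ (M : Matrix (Fin 2) (Fin 2) K) (u v : K), M.det ≠ 0 ∧
      g.val = affMap M u v := by
  simp only [affine, isAffineMap_iff]
  rfl

theorem aeval_aeval_X_one (p q : MvPolynomial (Fin 2) K) (P : K[X]) :
    MvPolynomial.aeval ![p, q] (aeval (MvPolynomial.X 1 : MvPolynomial (Fin 2) K) P) =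
      aeval q P := by
  rw [← Polynomial.aeval_algHom_apply]
  simp

theorem elemMap_mul_P (α : K) (P : K[X]) (β v : K) (g : PolyMap K) :
    (elemMap α P β v * g).P = MvPolynomial.C α * g.P + aeval g.Q P := by
  simp only [PolyMap.mul_def, elemMap, map_add, map_mul, aeval_aeval_X_one,
    MvPolynomial.aeval_X, MvPolynomial.aeval_C, MvPolynomial.algebraMap_eq,
    Matrix.cons_val_zero]

theorem elemMap_mul_Q (α : K) (P : K[X]) (β v : K) (g : PolyMap K) :
    (elemMap α P β v * g).Q = MvPolynomial.C β * g.Q + MvPolynomial.C v := by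
  simp only [PolyMap.mul_def, elemMap, map_add, map_mul,
    MvPolynomial.aeval_X, MvPolynomial.aeval_C, MvPolynomial.algebraMap_eq,
    Matrix.cons_val_one, Matrix.cons_val_fin_one]

theorem affMap_mul_P (M : Matrix (Fin 2) (Fin 2) K) (u v : K) (g : PolyMap K) :
    (affMap M u v * g).P =
      MvPolynomial.C (M 0 0) * g.P + MvPolynomial.C (M 0 1) * g.Q + MvPolynomial.C u := by
  simp only [PolyMap.mul_def, affMap, map_add, map_mul,
    MvPolynomial.aeval_X, MvPolynomial.aeval_C, MvPolynomial.algebraMap_eq,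
    Matrix.cons_val_one, Matrix.cons_val_fin_one, Matrix.cons_val_zero]

theorem affMap_mul_Q (M : Matrix (Fin 2) (Fin 2) K) (u v : K) (g : PolyMap K) :
    (affMap M u v * g).Q =
      MvPolynomial.C (M 1 0) * g.P + MvPolynomial.C (M 1 1) * g.Q + MvPolynomial.C v := by
  simp only [PolyMap.mul_def, affMap, map_add, map_mul,
    MvPolynomial.aeval_X, MvPolynomial.aeval_C, MvPolynomial.algebraMap_eq,
    Matrix.cons_val_one, Matrix.cons_val_fin_one, Matrix.cons_val_zero]

theorem elemMap_mul (α : K) (P : K[X]) (β v α' : K) (P' : K[X]) (β' v' : K) :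
    elemMap α P β v * elemMap α' P' β' v' =
      elemMap (α * α') (C α * P' + P.comp (C β' * X + C v')) (β * β') (β * v' + v) := by
  ext1
  · rw [elemMap_mul_P]
    simp only [elemMap, map_add, map_mul, aeval_comp, aeval_C, aeval_X,
      MvPolynomial.algebraMap_eq]
    ring
  · rw [elemMap_mul_Q]
    simp only [elemMap, map_add, map_mul]
    ring

theorem elemMap_one : elemMap (1 : K) 0 1 0 = 1 := by
  simp [elemMap, PolyMap.one_def]

theorem affMap_mul (M : Matrix (Fin 2) (Fin 2) K) (u v : K) (M' : Matrix (Fin 2) (Fin 2) K)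
    (u' v' : K) : affMap M u v * affMap M' u' v' =
      affMap (M * M') (M 0 0 * u' + M 0 1 * v' + u) (M 1 0 * u' + M 1 1 * v' + v) := by
  ext1
  · rw [affMap_mul_P]
    simp only [affMap, map_add, map_mul, Matrix.mul_apply, Fin.sum_univ_two]
    ring
  · rw [affMap_mul_Q]
    simp only [affMap, map_add, map_mul, Matrix.mul_apply, Fin.sum_univ_two]
    ring

theorem affMap_one : affMap (1 : Matrix (Fin 2) (Fin 2) K) 0 0 = 1 := by
  simp [affMap, PolyMap.one_def]

theorem elemMap_inj {α : K} {P : K[X]} {β v α' : K} {P' : K[X]} {β' v' : K}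
    (h : elemMap α P β v = elemMap α' P' β' v') : α = α' ∧ P = P' ∧ β = β' ∧ v = v' := by
  obtain ⟨h1, h2⟩ := PolyMap.ext_iff.1 h
  simp only [elemMap] at h1 h2
  have hP : P = P' := by
    have := congrArg (MvPolynomial.aeval ![(0 : K[X]), X]) h1
    simpa [← Polynomial.aeval_algHom_apply] using this
  subst hP
  have hα : α = α' := by
    have := congrArg (fun f => (MvPolynomial.aeval ![(X : K[X]), 0] f).coeff 1) h1
    simpa using this
  have hβ := congrArg (MvPolynomial.aeval ![(0 : K[X]), X]) h2
  have hβ1 := congrArg (fun f => f.coeff 1) hβ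
  have hβ0 := congrArg (fun f => f.coeff 0) hβ
  simp [coeff_C] at hβ1 hβ0
  exact ⟨hα, rfl, hβ1, hβ0⟩

theorem affMap_inj {M : Matrix (Fin 2) (Fin 2) K} {u v : K} {M' : Matrix (Fin 2) (Fin 2) K}
    {u' v' : K} (h : affMap M u v = affMap M' u' v') : M = M' ∧ u = u' ∧ v = v' := by
  obtain ⟨h1, h2⟩ := PolyMap.ext_iff.1 h
  simp only [affMap] at h1 h2
  have e : ∀ {a b c a' b' c' : K}, (MvPolynomial.C a * MvPolynomial.X 0 + MvPolynomial.C b *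
      MvPolynomial.X 1 + MvPolynomial.C c : MvPolynomial (Fin 2) K) =
      MvPolynomial.C a' * MvPolynomial.X 0 + MvPolynomial.C b' *
      MvPolynomial.X 1 + MvPolynomial.C c' → a = a' ∧ b = b' ∧ c = c' := by
    intro a b c a' b' c' h
    have hx := congrArg (MvPolynomial.aeval ![(X : K[X]), 0]) h
    have hy := congrArg (MvPolynomial.aeval ![(0 : K[X]), X]) h
    have hx1 := congrArg (fun f => f.coeff 1) hx
    have hx0 := congrArg (fun f => f.coeff 0) hx
    have hy1 := congrArg (fun f => f.coeff 1) hy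
    simp [coeff_C] at hx1 hx0 hy1
    exact ⟨hx1, hy1, hx0⟩
  obtain ⟨a, b, c⟩ := e h1
  obtain ⟨a', b', c'⟩ := e h2
  refine ⟨?_, c, c'⟩
  ext i j
  fin_cases i <;> fin_cases j <;> assumption

/-- The automorphism with components `α x + P(y)` and `β y + v`. -/
theorem exists_elem {α : K} (hα : α ≠ 0) (P : K[X]) {β : K} (hβ : β ≠ 0) (v : K) :
    ∃ g : GA2 K, g.val = elemMap α P β v ∧
      g⁻¹.val = elemMap α⁻¹ (-C α⁻¹ * P.comp (C β⁻¹ * X + C (-(β⁻¹ * v)))) β⁻¹ (-(β⁻¹ * v)) := by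
  have h1 : elemMap α P β v *
      elemMap α⁻¹ (-C α⁻¹ * P.comp (C β⁻¹ * X + C (-(β⁻¹ * v)))) β⁻¹ (-(β⁻¹ * v)) = 1 := by
    rw [elemMap_mul, ← elemMap_one]
    congr 1
    · field_simp
    · rw [neg_mul, mul_neg, ← mul_assoc, ← C_mul, mul_inv_cancel₀ hα, C_1, one_mul, neg_add_cancel]
    · field_simp
    · field_simp; ring
  have h2 : elemMap α⁻¹ (-C α⁻¹ * P.comp (C β⁻¹ * X + C (-(β⁻¹ * v)))) β⁻¹ (-(β⁻¹ * v)) *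
      elemMap α P β v = 1 := by
    rw [elemMap_mul, ← elemMap_one]
    congr 1
    · field_simp
    · have : (C β⁻¹ * X + C (-(β⁻¹ * v)) : K[X]).comp (C β * X + C v) = X := by
        simp only [add_comp, mul_comp, C_comp, X_comp, C_neg, C_mul]
        rw [mul_add, ← mul_assoc, ← C_mul, inv_mul_cancel₀ hβ, C_1, one_mul]
        simp
      rw [mul_comp, comp_assoc, this, neg_comp, C_comp, comp_X, neg_mul, add_neg_cancel]
    · field_simp
    · field_simp; ring
  exact ⟨⟨_, _, h1, h2⟩, rfl, rfl⟩

theorem exists_affine {M : Matrix (Fin 2) (Fin 2) K} (hM : M.det ≠ 0) (u v : K) :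
    ∃ g : GA2 K, g.val = affMap M u v ∧ ∃ u' v', g⁻¹.val = affMap M⁻¹ u' v' := by
  have hu : IsUnit M.det := isUnit_iff_ne_zero.2 hM
  have e1 := Matrix.mul_nonsing_inv M hu
  have e2 := Matrix.nonsing_inv_mul M hu
  set N := M⁻¹
  have h1 : affMap M u v * affMap N (-(N 0 0 * u + N 0 1 * v)) (-(N 1 0 * u + N 1 1 * v)) = 1 := by
    rw [affMap_mul, ← affMap_one, e1]
    have a00 := congrFun (congrFun e1 0) 0
    have a01 := congrFun (congrFun e1 0) 1
    have a10 := congrFun (congrFun e1 1) 0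
    have a11 := congrFun (congrFun e1 1) 1
    simp only [Matrix.mul_apply, Fin.sum_univ_two, Matrix.one_apply] at a00 a01 a10 a11
    simp at a00 a01 a10 a11
    congr 1
    · linear_combination (-u) * a00 - v * a01
    · linear_combination (-u) * a10 - v * a11
  have h2 : affMap N (-(N 0 0 * u + N 0 1 * v)) (-(N 1 0 * u + N 1 1 * v)) * affMap M u v = 1 := by
    rw [affMap_mul, ← affMap_one, e2]
    congr 1 <;> ring
  exact ⟨⟨_, _, h1, h2⟩, rfl, _, _, rfl⟩

/-- The subgroup of elementary automorphisms. -/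
def elemSubgroup (K : Type*) [Field K] : Subgroup (GA2 K) where
  carrier := elementary K
  mul_mem' := by
    intro a b ha hb
    obtain ⟨α, β, v, P, h, ha⟩ := mem_elementary.1 ha
    obtain ⟨α', β', v', P', h', hb⟩ := mem_elementary.1 hb
    have h3 := elemMap_mul α P β v α' P' β' v'
    rw [← ha, ← hb, ← Units.val_mul] at h3
    refine mem_elementary.2 ⟨_, _, _, _, ?_, h3⟩
    rw [mul_mul_mul_comm]
    exact mul_ne_zero h h'
  one_mem' := mem_elementary.2 ⟨1, 1, 0, 0, by simp, elemMap_one.symm⟩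
  inv_mem' := by
    intro a ha
    obtain ⟨α, β, v, P, h, ha⟩ := mem_elementary.1 ha
    have hα := left_ne_zero_of_mul h
    have hβ := right_ne_zero_of_mul h
    obtain ⟨g, hg, hinv⟩ := exists_elem hα P hβ v
    obtain rfl : a = g := Units.ext (ha.trans hg.symm)
    exact mem_elementary.2 ⟨α⁻¹, β⁻¹, _, _, mul_ne_zero (inv_ne_zero hα) (inv_ne_zero hβ), hinv⟩

/-- The subgroup of affine automorphisms. -/
def affSubgroup (K : Type*) [Field K] : Subgroup (GA2 K) where
  carrier := affine K
  mul_mem' := by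
    intro a b ha hb
    obtain ⟨M, u, v, h, ha⟩ := mem_affine.1 ha
    obtain ⟨M', u', v', h', hb⟩ := mem_affine.1 hb
    have h3 := affMap_mul M u v M' u' v'
    rw [← ha, ← hb, ← Units.val_mul] at h3
    refine mem_affine.2 ⟨_, _, _, ?_, h3⟩
    rw [Matrix.det_mul]
    exact mul_ne_zero h h'
  one_mem' := mem_affine.2 ⟨1, 0, 0, by simp, affMap_one.symm⟩
  inv_mem' := by
    intro a ha
    obtain ⟨M, u, v, h, ha⟩ := mem_affine.1 ha
    obtain ⟨g, hg, u', v', hinv⟩ := exists_affine h u v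
    obtain rfl : a = g := Units.ext (ha.trans hg.symm)
    refine mem_affine.2 ⟨M⁻¹, u', v', ?_, hinv⟩
    exact (Matrix.isUnit_nonsing_inv_det M (isUnit_iff_ne_zero.2 h)).ne_zero

/-- The two factors: the elementary (`true`) and the affine (`false`) automorphisms. -/
def factor (K : Type*) [Field K] : Bool → Subgroup (GA2 K)
  | true => elemSubgroup K
  | false => affSubgroup K

theorem mem_base_factor {g : GA2 K} : g ∈ base (factor K) ↔ g ∈ basic K :=
  and_comm

theorem elemMap_eq_affMap (α γ u β v : K) :
    elemMap α (C γ * X + C u) β v = affMap !![α, γ; 0, β] u v := by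
  simp only [elemMap, affMap]
  ext1 <;> simp [MvPolynomial.algebraMap_eq, add_assoc]

theorem mem_affine_iff_natDegree_le {g : GA2 K} {α : K} {P : K[X]} {β v : K} (h : α * β ≠ 0)
    (hg : g.val = elemMap α P β v) : g ∈ affine K ↔ P.natDegree ≤ 1 := by
  constructor
  · intro ha
    obtain ⟨M, u, v', -, hM⟩ := mem_affine.1 ha
    have h1 := (PolyMap.ext_iff.1 (hg.symm.trans hM)).1
    have h2 := congrArg (MvPolynomial.aeval ![(0 : K[X]), X]) h1
    simp [elemMap, affMap, ← Polynomial.aeval_algHom_apply] at h2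
    rw [h2]
    exact natDegree_linear_le
  · intro hP
    obtain ⟨γ, u, rfl⟩ := exists_eq_X_add_C_of_natDegree_le_one hP
    rw [elemMap_eq_affMap] at hg
    refine mem_affine.2 ⟨_, _, _, ?_, hg⟩
    rw [Matrix.det_fin_two_of]
    simpa using h

theorem mem_base_iff {g : GA2 K} : g ∈ base (factor K) ↔
    ∃ α γ u β v : K, α * β ≠ 0 ∧ g.val = elemMap α (C γ * X + C u) β v := by
  constructor
  · rintro ⟨h1, h2⟩
    obtain ⟨α, β, v, P, h, hg⟩ := mem_elementary.1 h1
    have hP := (mem_affine_iff_natDegree_le h hg).1 h2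
    obtain ⟨γ, u, rfl⟩ := exists_eq_X_add_C_of_natDegree_le_one hP
    exact ⟨α, γ, u, β, v, h, hg⟩
  · rintro ⟨α, γ, u, β, v, h, hg⟩
    exact ⟨mem_elementary.2 ⟨_, _, _, _, h, hg⟩,
      (mem_affine_iff_natDegree_le h hg).2 natDegree_linear_le⟩

theorem mem_letters_true {g : GA2 K} : g ∈ letters (factor K) true ↔
    ∃ (α β v : K) (P : K[X]), α * β ≠ 0 ∧ 2 ≤ P.natDegree ∧ g.val = elemMap α P β v := by
  constructor
  · rintro ⟨h1, h2⟩
    obtain ⟨α, β, v, P, h, hg⟩ := mem_elementary.1 h1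
    refine ⟨α, β, v, P, h, ?_, hg⟩
    by_contra hlt
    exact h2 ((mem_affine_iff_natDegree_le h hg).2 (by omega))
  · rintro ⟨α, β, v, P, h, hd, hg⟩
    refine ⟨mem_elementary.2 ⟨_, _, _, _, h, hg⟩, fun h2 => ?_⟩
    have := (mem_affine_iff_natDegree_le h hg).1 h2
    omega

theorem mem_letters_false {g : GA2 K} : g ∈ letters (factor K) false ↔
    ∃ (M : Matrix (Fin 2) (Fin 2) K) (u v : K), M.det ≠ 0 ∧ M 1 0 ≠ 0 ∧
      g.val = affMap M u v := by
  constructor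
  · rintro ⟨h1, h2⟩
    obtain ⟨M, u, v, h, hg⟩ := mem_affine.1 h1
    refine ⟨M, u, v, h, fun h0 => h2 ?_, hg⟩
    refine mem_elementary.2 ⟨M 0 0, M 1 1, v, C (M 0 1) * X + C u, ?_, ?_⟩
    · rw [Matrix.det_fin_two, h0, mul_zero, sub_zero] at h
      exact h
    · rw [hg, elemMap_eq_affMap]
      congr 1
      rw [← h0]
      exact Matrix.eta_fin_two M
  · rintro ⟨M, u, v, h, h0, hg⟩
    refine ⟨mem_affine.2 ⟨_, _, _, h, hg⟩, fun h2 => h0 ?_⟩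
    obtain ⟨α, γ, u', β, v', -, hinv⟩ := mem_base_iff.1
      (show g ∈ base (factor K) from ⟨h2, mem_affine.2 ⟨_, _, _, h, hg⟩⟩)
    rw [hg, elemMap_eq_affMap] at hinv
    rw [(affMap_inj hinv).1]
    simp

/-! ### Degrees of reduced words and the amalgam structure. -/

theorem totalDegree_linear_le (a b c : K) (f g : MvPolynomial (Fin 2) K) :
    (MvPolynomial.C a * f + MvPolynomial.C b * g + MvPolynomial.C c).totalDegree ≤
      max f.totalDegree g.totalDegree := by
  refine (MvPolynomial.totalDegree_add _ _).trans (max_le ?_ (by simp))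
  refine (MvPolynomial.totalDegree_add _ _).trans (max_le_max ?_ ?_) <;>
  · refine (MvPolynomial.totalDegree_mul _ _).trans ?_
    simp

theorem degree_affine_mul_le {a : GA2 K} (ha : a ∈ affine K) (g : GA2 K) :
    degree (a * g) ≤ degree g := by
  obtain ⟨M, u, v, -, hM⟩ := mem_affine.1 ha
  rw [degree, Units.val_mul, hM, affMap_mul_P, affMap_mul_Q]
  exact max_le (totalDegree_linear_le _ _ _ _ _) (totalDegree_linear_le _ _ _ _ _)

theorem totalDegree_aeval_le {p q : MvPolynomial (Fin 2) K} (hp : p.totalDegree ≤ 1)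
    (hq : q.totalDegree ≤ 1) (f : MvPolynomial (Fin 2) K) :
    (MvPolynomial.aeval ![p, q] f).totalDegree ≤ f.totalDegree := by
  rw [MvPolynomial.aeval_def, MvPolynomial.eval₂_eq']
  refine MvPolynomial.totalDegree_finsetSum_le fun m hm => ?_
  refine (MvPolynomial.totalDegree_mul _ _).trans ?_
  rw [MvPolynomial.algebraMap_eq, MvPolynomial.totalDegree_C, zero_add]
  refine le_trans ?_ (MvPolynomial.le_totalDegree hm)
  rw [Finsupp.sum_fintype _ _ (by simp), Fin.prod_univ_two, Fin.sum_univ_two]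
  refine (MvPolynomial.totalDegree_mul _ _).trans (add_le_add ?_ ?_) <;>
  · refine (MvPolynomial.totalDegree_pow _ _).trans ?_
    simp
    nlinarith

theorem degree_mul_affine_le {a : GA2 K} (ha : a ∈ affine K) (g : GA2 K) :
    degree (g * a) ≤ degree g := by
  obtain ⟨M, u, v, -, hM⟩ := mem_affine.1 ha
  have h1 : a.val.P.totalDegree ≤ 1 := by
    rw [hM]
    exact (totalDegree_linear_le _ _ _ _ _).trans (by simp)
  have h2 : a.val.Q.totalDegree ≤ 1 := by
    rw [hM]
    exact (totalDegree_linear_le _ _ _ _ _).trans (by simp)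
  rw [degree, Units.val_mul, PolyMap.mul_def]
  exact max_le_max (totalDegree_aeval_le h1 h2 _) (totalDegree_aeval_le h1 h2 _)

/-- Affine maps on either side do not raise the degree; applied to `b` and `b⁻¹` this gives
equality. -/
theorem degree_baseInvariant : BaseInvariant (factor K) (degree (K := K)) := by
  intro g b hb
  have h1 : b ∈ affine K := hb.2
  have h2 : b⁻¹ ∈ affine K := (affSubgroup K).inv_mem h1
  refine ⟨le_antisymm (degree_affine_mul_le h1 g) ?_, le_antisymm (degree_mul_affine_le h1 g) ?_⟩
  · simpa using degree_affine_mul_le h2 (b * g)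
  · simpa using degree_mul_affine_le h2 (g * b)

theorem degree_affine_lt {a : GA2 K} (ha : a ∈ affine K) : degree a < 2 := by
  have := degree_affine_mul_le ha 1
  rw [mul_one] at this
  have h1 : degree (1 : GA2 K) = 1 := by simp [degree, PolyMap.one_def]
  omega

theorem degree_elem {g : GA2 K} {α : K} {P : K[X]} {β v : K} (hP : 2 ≤ P.natDegree)
    (hg : g.val = elemMap α P β v) : degree g = P.natDegree := by
  have hP0 : P ≠ 0 := by rintro rfl; simp at hP
  have h1 : (aeval (MvPolynomial.X 1 : MvPolynomial (Fin 2) K) P).totalDegree = P.natDegree := by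
    rw [(aeval_leading (by simp) hP0).1, MvPolynomial.totalDegree_X, mul_one]
  have h2 : (MvPolynomial.C α * MvPolynomial.X 0 : MvPolynomial (Fin 2) K).totalDegree ≤ 1 := by
    refine (MvPolynomial.totalDegree_mul _ _).trans ?_
    simp
  have h3 : (MvPolynomial.C β * MvPolynomial.X 1 + MvPolynomial.C v :
      MvPolynomial (Fin 2) K).totalDegree ≤ 1 := by
    refine (MvPolynomial.totalDegree_add _ _).trans (max_le ?_ (by simp))
    refine (MvPolynomial.totalDegree_mul _ _).trans ?_
    simp
  rw [degree, hg]
  simp only [elemMap]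
  rw [MvPolynomial.totalDegree_add_eq_right_of_totalDegree_lt (by omega), h1]
  omega

theorem two_le_degree_of_mem_letters {g : GA2 K} (hg : g ∈ letters (factor K) true) :
    2 ≤ degree g := by
  obtain ⟨α, β, v, P, -, hP, hg⟩ := mem_letters_true.1 hg
  rwa [degree_elem hP hg]

theorem degree_inv_of_mem_letters {g : GA2 K} (hg : g ∈ letters (factor K) true) :
    degree g⁻¹ = degree g := by
  obtain ⟨α, β, v, P, h, hP, hg⟩ := mem_letters_true.1 hg
  have hα := left_ne_zero_of_mul h
  have hβ := right_ne_zero_of_mul h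
  obtain ⟨g', h1, h2⟩ := exists_elem hα P hβ v
  obtain rfl : g = g' := Units.ext (hg.trans h1.symm)
  have hd : (-C α⁻¹ * P.comp (C β⁻¹ * X + C (-(β⁻¹ * v)))).natDegree = P.natDegree := by
    rw [neg_mul, natDegree_neg, natDegree_C_mul (inv_ne_zero hα), natDegree_comp,
      natDegree_linear (inv_ne_zero hβ), mul_one]
  rw [degree_elem hP hg, degree_elem (by rw [hd]; exact hP) h2, hd]

/-- The degrees of the components of a reduced word. -/
theorem totalDegree_word {t : Bool} {w : List (GA2 K)} (hw : Alt (letters (factor K)) t w) :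
    1 ≤ w.prod.val.Q.totalDegree ∧
    ((t = false ∨ w = []) → w.prod.val.P.totalDegree ≤ w.prod.val.Q.totalDegree) ∧
    (t = true → w ≠ [] → w.prod.val.Q.totalDegree < w.prod.val.P.totalDegree) := by
  induction w generalizing t with
  | nil => simp [PolyMap.one_def]
  | cons g u ih =>
    obtain ⟨ih1, ih2, ih3⟩ := ih hw.2
    rw [List.prod_cons, Units.val_mul]
    set p := u.prod.val
    cases t with
    -- Since `deg R ≥ 2`, the term `R(Q)` outgrows both old components.
    | true =>
      obtain ⟨α, β, v, R, h, hR, hg⟩ := mem_letters_true.1 hw.1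
      have hPQ := ih2 (Or.inl rfl)
      have hR0 : R ≠ 0 := by rintro rfl; simp at hR
      have hd := (aeval_leading (K := K) (p := p.Q) (by omega) hR0).1
      have hlt : p.Q.totalDegree < (aeval p.Q R).totalDegree := by
        rw [hd]
        have : 2 * p.Q.totalDegree ≤ R.natDegree * p.Q.totalDegree := Nat.mul_le_mul_right _ hR
        omega
      have hQ : (MvPolynomial.C β * p.Q + MvPolynomial.C v).totalDegree = p.Q.totalDegree := by
        rw [MvPolynomial.totalDegree_add_eq_left_of_totalDegree_lt] <;>
        rw [totalDegree_C_mul (right_ne_zero_of_mul h)]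
        rw [MvPolynomial.totalDegree_C]
        omega
      have hP : (MvPolynomial.C α * p.P + aeval p.Q R).totalDegree = (aeval p.Q R).totalDegree := by
        apply MvPolynomial.totalDegree_add_eq_right_of_totalDegree_lt
        rw [totalDegree_C_mul (left_ne_zero_of_mul h)]
        omega
      rw [hg, elemMap_mul_P, elemMap_mul_Q, hQ, hP]
      exact ⟨ih1, by simp, fun _ _ => hlt⟩
    -- The entry `M 1 0 ≠ 0` carries the larger component `P` into the second place. The empty tail
    -- is separate, since both components of the identity have degree one.
    | false =>
      obtain ⟨M, u', v, h, h0, hg⟩ := mem_letters_false.1 hw.1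
      have hPle := totalDegree_linear_le (M 0 0) (M 0 1) u' p.P p.Q
      rw [hg, affMap_mul_P, affMap_mul_Q]
      by_cases hu : u = []
      · have hp : p = 1 := by simp [p, hu]
        rw [hp] at hPle ⊢
        simp only [PolyMap.one_def] at hPle ⊢
        have hQ : 1 ≤ (MvPolynomial.C (M 1 0) * MvPolynomial.X 0 + MvPolynomial.C (M 1 1) *
            MvPolynomial.X 1 + MvPolynomial.C v : MvPolynomial (Fin 2) K).totalDegree := by
          by_contra hlt
          have h00 := MvPolynomial.totalDegree_eq_zero_iff_eq_C.1 (Nat.lt_one_iff.1 (not_le.1 hlt))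
          have := congrArg (MvPolynomial.pderiv 0) h00
          simp [MvPolynomial.pderiv_X] at this
          exact h0 this
        simp only [MvPolynomial.totalDegree_X, max_self] at hPle
        exact ⟨hQ, fun _ => hPle.trans hQ, by simp⟩
      · have hlt := ih3 rfl hu
        have hQ : (MvPolynomial.C (M 1 0) * p.P + MvPolynomial.C (M 1 1) * p.Q +
            MvPolynomial.C v).totalDegree = p.P.totalDegree := by
          have e : (MvPolynomial.C (M 1 0) * p.P).totalDegree = p.P.totalDegree :=
            totalDegree_C_mul h0 _
          have e2 : (MvPolynomial.C (M 1 1) * p.Q).totalDegree ≤ p.Q.totalDegree := by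
            refine (MvPolynomial.totalDegree_mul _ _).trans ?_
            simp
          have e3 := MvPolynomial.totalDegree_add_eq_left_of_totalDegree_lt
            (p := MvPolynomial.C (M 1 0) * p.P) (q := MvPolynomial.C (M 1 1) * p.Q) (by omega)
          rw [MvPolynomial.totalDegree_add_eq_left_of_totalDegree_lt, e3, e]
          rw [e3, e, MvPolynomial.totalDegree_C]
          omega
        rw [hQ]
        exact ⟨by omega, fun _ => hPle.trans (by omega), by simp⟩

/-- A word starting with an elementary letter has `deg P > deg Q ≥ 1`, so it is not affine. A
leading affine letter can be removed without changing whether the product is affine. -/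
theorem word_notMem_base {t : Bool} {w : List (GA2 K)} (hw : Alt (letters (factor K)) t w)
    (h0 : w ≠ []) : w.prod ∉ base (factor K) := by
  have key : ∀ w : List (GA2 K), Alt (letters (factor K)) true w → w ≠ [] →
      w.prod ∉ affine K := by
    intro w hw h0 ha
    obtain ⟨h1, -, h3⟩ := totalDegree_word hw
    have h4 := h3 rfl h0
    have h5 := degree_affine_lt ha
    have : w.prod.val.P.totalDegree ≤ degree w.prod := le_max_left _ _
    omega
  cases t with
  | true => exact fun hb => key w hw h0 hb.2
  | false =>
    rcases w with _ | ⟨a, u⟩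
    · exact absurd rfl h0
    intro hb
    by_cases hu : u = []
    · subst hu
      rw [List.prod_singleton] at hb
      exact notMem_base_of_mem_letters hw.1 hb
    · refine key u hw.2 hu ?_
      rw [List.prod_cons] at hb
      exact (Subgroup.mul_mem_cancel_left (affSubgroup K) hw.1.1).1 hb.2

theorem eq_linear_of_totalDegree_le_one {f : MvPolynomial (Fin 2) K} (hf : f.totalDegree ≤ 1) :
    ∃ a b c : K, f = MvPolynomial.C a * MvPolynomial.X 0 + MvPolynomial.C b * MvPolynomial.X 1 +
      MvPolynomial.C c := by
  refine ⟨f.coeff (Finsupp.single 0 1), f.coeff (Finsupp.single 1 1), f.coeff 0, ?_⟩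
  ext m
  simp only [MvPolynomial.coeff_add, MvPolynomial.coeff_C_mul, MvPolynomial.coeff_X,
    MvPolynomial.coeff_C]
  by_cases hm : m.degree ≤ 1
  · have hdeg : m 0 + m 1 ≤ 1 := by simpa [Finsupp.degree_eq_sum, Fin.sum_univ_two] using hm
    have hcases : m = 0 ∨ m = Finsupp.single 0 1 ∨ m = Finsupp.single 1 1 := by
      have : (m 0 = 0 ∧ m 1 = 0) ∨ (m 0 = 1 ∧ m 1 = 0) ∨ (m 0 = 0 ∧ m 1 = 1) := by omega
      rcases this with ⟨a, b⟩ | ⟨a, b⟩ | ⟨a, b⟩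
      · left; ext i; fin_cases i <;> simp [a, b]
      · right; left; ext i; fin_cases i <;> simp [a, b]
      · right; right; ext i; fin_cases i <;> simp [a, b]
    rcases hcases with rfl | rfl | rfl
    · simp
    · simp [Finsupp.single_left_inj, eq_comm]
    · simp [Finsupp.single_left_inj, eq_comm]
  · have h0 : f.coeff m = 0 := by
      apply MvPolynomial.coeff_eq_zero_of_totalDegree_lt
      rw [Finsupp.degree_eq_sum] at hm
      refine lt_of_le_of_lt hf (lt_of_lt_of_le (not_le.1 hm) ?_)
      rw [← Finsupp.degree_eq_sum]
      rfl
    have e0 : Finsupp.single (0 : Fin 2) 1 ≠ m := by rintro rfl; simp at hm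
    have e1 : Finsupp.single (1 : Fin 2) 1 ≠ m := by rintro rfl; simp at hm
    have e2 : (0 : Fin 2 →₀ ℕ) ≠ m := by rintro rfl; simp at hm
    simp [h0, e0, e1, e2]

theorem swap_val_eq_affMap : (swap K).val = affMap !![0, 1; 1, 0] 0 0 := by
  simp [swap, affMap]

theorem swap_mem_affine : swap K ∈ affine K :=
  mem_affine.2 ⟨_, _, _, by simp [Matrix.det_fin_two_of], swap_val_eq_affMap⟩

theorem swap_mul_P (g : GA2 K) : (swap K * g).val.P = g.val.Q := by
  rw [Units.val_mul, swap_val_eq_affMap, affMap_mul_P]; simp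

theorem swap_mul_Q (g : GA2 K) : (swap K * g).val.Q = g.val.P := by
  rw [Units.val_mul, swap_val_eq_affMap, affMap_mul_Q]; simp

theorem swap_mul_self : swap K * swap K = 1 := by
  refine Units.ext (PolyMap.ext ?_ ?_)
  · rw [swap_mul_P]; rfl
  · rw [swap_mul_Q]; rfl

/-- The determinant of the linear part is the Jacobian determinant, hence nonzero. -/
theorem mem_affine_of_totalDegree_le {g : GA2 K} (hP : g.val.P.totalDegree ≤ 1)
    (hQ : g.val.Q.totalDegree ≤ 1) : g ∈ affine K := by
  obtain ⟨a, b, u, h1⟩ := eq_linear_of_totalDegree_le_one hP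
  obtain ⟨c, d, v, h2⟩ := eq_linear_of_totalDegree_le_one hQ
  refine mem_affine.2 ⟨!![a, b; c, d], u, v, ?_, PolyMap.ext (by simpa [affMap] using h1)
    (by simpa [affMap] using h2)⟩
  obtain ⟨J, hJ, hj⟩ := exists_jacobianDet_eq_C g
  rw [jacobianDet_eq_bracket, bracket, h1, h2] at hj
  rw [Matrix.det_fin_two_of]
  intro h0
  apply hJ
  have h0' : MvPolynomial.C (a * d - b * c) = (0 : MvPolynomial (Fin 2) K) := by rw [h0]; simp
  simp [MvPolynomial.pderiv_X] at hj h0'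
  rw [h0'] at hj
  exact (MvPolynomial.C_injective (Fin 2) K (by simpa using hj.symm))

/-- The theorem of Jung and van der Kulk: the affine and the elementary automorphisms generate. -/
theorem closure_eq_top :
    Subgroup.closure ((factor K true : Set (GA2 K)) ∪ factor K false) = ⊤ := by
  rw [eq_top_iff]
  intro g _
  set Γ := Subgroup.closure ((factor K true : Set (GA2 K)) ∪ factor K false)
  have hE : ∀ e ∈ elementary K, e ∈ Γ := fun e he => Subgroup.subset_closure (Or.inl he)
  have hA : ∀ e ∈ affine K, e ∈ Γ := fun e he => Subgroup.subset_closure (Or.inr he)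
  have hT := hA _ (swap_mem_affine (K := K))
  induction hn : g.val.P.totalDegree + g.val.Q.totalDegree using Nat.strong_induction_on
    generalizing g with
  | _ n ih =>
    have step : ∀ g : GA2 K, g.val.P.totalDegree + g.val.Q.totalDegree = n →
        g.val.P.totalDegree ≤ g.val.Q.totalDegree → g ∈ Γ := by
      intro g hgn hle
      by_cases h2 : 2 ≤ g.val.Q.totalDegree
      · obtain ⟨c, k, hck⟩ := exists_degree_reduction g hle h2
        obtain ⟨e, he, -⟩ := exists_elem (one_ne_zero (α := K)) (-C c * X ^ k)
          (one_ne_zero (α := K)) 0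
        have heΓ := hE e (mem_elementary.2 ⟨_, _, _, _, by simp, he⟩)
        -- Elementary maps modify the first component; conjugating by the swap subtracts `c P ^ k`
        -- from the second.
        have hP : (swap K * (e * (swap K * g))).val.P = g.val.P := by
          rw [swap_mul_P, Units.val_mul, he, elemMap_mul_Q, swap_mul_Q]
          simp
        have hQ : (swap K * (e * (swap K * g))).val.Q =
            g.val.Q - MvPolynomial.C c * g.val.P ^ k := by
          rw [swap_mul_Q, Units.val_mul, he, elemMap_mul_P, swap_mul_Q, swap_mul_P]
          simp only [map_mul, map_neg, map_pow, aeval_C, aeval_X, MvPolynomial.algebraMap_eq,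
            MvPolynomial.C_1]
          ring
        have hmem := ih (g.val.P.totalDegree +
          (g.val.Q - MvPolynomial.C c * g.val.P ^ k).totalDegree) (by omega)
          (g := swap K * (e * (swap K * g))) (Subgroup.mem_top _) (by rw [hP, hQ])
        rwa [Subgroup.mul_mem_cancel_left _ hT, Subgroup.mul_mem_cancel_left _ heΓ,
          Subgroup.mul_mem_cancel_left _ hT] at hmem
      · exact hA g (mem_affine_of_totalDegree_le (by omega) (by omega))
    rcases le_total g.val.P.totalDegree g.val.Q.totalDegree with h | h
    · exact step g hn h
    · rw [← Subgroup.mul_mem_cancel_left _ hT]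
      refine step _ ?_ ?_
      · rw [swap_mul_P, swap_mul_Q]; omega
      · rw [swap_mul_P, swap_mul_Q]; exact h

theorem isAmalgam : IsAmalgam (factor K) :=
  ⟨closure_eq_top, fun _ _ hw h0 => word_notMem_base hw h0⟩

/-! ### Coset representatives and involutions in the two factors. -/

/-- The coset representatives. -/
def reps (K : Type*) [Field K] : Bool → Set (GA2 K)
  | true => cosetJ K
  | false => cosetI K

theorem mem_cosetI {g : GA2 K} :
    g ∈ cosetI K ↔ ∃ β : K, g.val = affMap !![0, 1; 1, β] 0 0 := by
  simp only [cosetI, isAffineMap_iff]; rfl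

theorem mem_cosetJ {g : GA2 K} :
    g ∈ cosetJ K ↔ ∃ P : K[X], P ≠ 0 ∧ g.val = elemMap 1 (X ^ 2 * P) 1 0 := by
  simp only [cosetJ, isElemMap_iff]; rfl

theorem reps_subset (t : Bool) : reps K t ⊆ letters (factor K) t := by
  intro g hg
  cases t with
  | true =>
    obtain ⟨P, hP, hg⟩ := mem_cosetJ.1 hg
    refine mem_letters_true.2 ⟨_, _, _, _, by simp, ?_, hg⟩
    rw [natDegree_mul (by simp) hP]
    simp
  | false =>
    obtain ⟨β, hg⟩ := mem_cosetI.1 hg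
    exact mem_letters_false.2 ⟨_, _, _, by simp [Matrix.det_fin_two_of], by simp, hg⟩

/-- In the elementary case the terms of `P` of degree at most one go into `b`, and `α⁻¹` offsets the
scaling by `b`. In the affine case the second row forces `β = M 1 1 / M 1 0`. -/
theorem exists_reps (t : Bool) (g : GA2 K) (hg : g ∈ letters (factor K) t) :
    ∃ b ∈ base (factor K), ∃ r ∈ reps K t, g = b * r := by
  cases t with
  | true =>
    obtain ⟨α, β, v, P, h, hP, hg⟩ := mem_letters_true.1 hg
    have hα := left_ne_zero_of_mul h
    obtain ⟨b, hb, -⟩ := exists_elem hα (C (P.divX.coeff 0) * X + C (P.coeff 0))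
      (right_ne_zero_of_mul h) v
    obtain ⟨r, hr, -⟩ := exists_elem (one_ne_zero (α := K)) (X ^ 2 * (C α⁻¹ * P.divX.divX))
      (one_ne_zero (α := K)) 0
    have hPd : P = X ^ 2 * P.divX.divX + (C (P.divX.coeff 0) * X + C (P.coeff 0)) := by
      nth_rewrite 1 [← P.divX_mul_X_add, ← P.divX.divX_mul_X_add]
      ring
    refine ⟨b, mem_base_iff.2 ⟨_, _, _, _, _, h, hb⟩, r, mem_cosetJ.2 ⟨_, ?_, hr⟩, ?_⟩
    · refine mul_ne_zero (by simpa using hα) ?_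
      intro h0
      rw [h0, mul_zero, zero_add] at hPd
      rw [hPd] at hP
      have := natDegree_linear_le (a := P.divX.coeff 0) (b := P.coeff 0)
      omega
    · refine Units.ext ?_
      rw [Units.val_mul, hg, hb, hr, elemMap_mul]
      congr 1
      · simp
      · have : C α * (X ^ 2 * (C α⁻¹ * P.divX.divX)) = (C α * C α⁻¹) * (X ^ 2 * P.divX.divX) := by
          ring
        rw [this, ← C_mul, mul_inv_cancel₀ hα]
        nth_rewrite 1 [hPd]
        simp
      · simp
      · simp
  | false =>
    obtain ⟨M, u, v, h, h0, hg⟩ := mem_letters_false.1 hg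
    -- This number is `-det M / M 1 0`.
    have hα : M 0 1 - M 0 0 * (M 1 1 / M 1 0) ≠ 0 := by
      intro h1
      apply h
      rw [Matrix.det_fin_two]
      field_simp at h1
      linear_combination -h1
    obtain ⟨b, hb, -⟩ := exists_elem hα (C (M 0 0) * X + C u) h0 v
    obtain ⟨r, hr, -⟩ := exists_affine (M := !![0, 1; 1, M 1 1 / M 1 0])
      (by simp [Matrix.det_fin_two_of]) 0 0
    refine ⟨b, mem_base_iff.2 ⟨_, _, _, _, _, mul_ne_zero hα h0, hb⟩, r, mem_cosetI.2 ⟨_, hr⟩, ?_⟩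
    refine Units.ext ?_
    rw [Units.val_mul, hg, hb, hr, elemMap_eq_affMap, affMap_mul]
    congr 1
    · ext i j
      fin_cases i <;> fin_cases j <;> simp [Matrix.mul_apply, Fin.sum_univ_two]
      field_simp
    · simp
    · simp

theorem swap_mem_letters : swap K ∈ letters (factor K) false :=
  mem_letters_false.2 ⟨_, _, _, by simp [Matrix.det_fin_two_of], by simp, swap_val_eq_affMap⟩

/-- Affine involutions that are not basic are conjugate to the coordinate swap. -/
theorem exists_eq_conj_swap (h2 : (2 : K) ≠ 0) {σ : GA2 K} (hσ : σ ∈ letters (factor K) false)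
    (hσ2 : σ * σ = 1) : ∃ b ∈ base (factor K), σ = b * swap K * b⁻¹ := by
  obtain ⟨M, u, v, h, h0, hg⟩ := mem_letters_false.1 hσ
  have hsq := congrArg Units.val hσ2
  rw [Units.val_mul, hg, affMap_mul, Units.val_one, ← affMap_one] at hsq
  obtain ⟨hM, hu, hv⟩ := affMap_inj hsq
  have a00 := congrFun (congrFun hM 0) 0
  have a10 := congrFun (congrFun hM 1) 0
  simp [Matrix.mul_apply, Fin.sum_univ_two] at a00 a10
  have hk : M 1 1 = -M 0 0 := by
    have : M 1 0 * (M 0 0 + M 1 1) = 0 := by linear_combination a10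
    have := (mul_eq_zero.1 this).resolve_left h0
    linear_combination this
  -- The linear part of `b` has the columns `e₁` and `M e₁`, which `M` exchanges. Its translation
  -- part is the midpoint of `0` and `σ(0)`, a fixed point of `σ`.
  obtain ⟨b, hb, -⟩ := exists_elem (one_ne_zero (α := K)) (C (M 0 0) * X + C (u / 2)) h0 (v / 2)
  refine ⟨b, mem_base_iff.2 ⟨_, _, _, _, _, by simpa using h0, hb⟩, ?_⟩
  rw [eq_mul_inv_iff_mul_eq]
  refine Units.ext ?_
  rw [Units.val_mul, Units.val_mul, hg, hb, elemMap_eq_affMap, swap_val_eq_affMap, affMap_mul,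
    affMap_mul]
  congr 1
  · ext i j
    fin_cases i <;> fin_cases j <;> simp [Matrix.mul_apply, Fin.sum_univ_two]
    · linear_combination a00
    · rw [hk]; ring
  · simp
    field_simp
    linear_combination hu
  · simp
    field_simp
    linear_combination hv

/-- Squaring gives `β = ±1`. If `β = 1`, then `2 v = 0` and `(α + 1) P = 0`, whence `v = 0` and `α =
-1`; if `β = -1`, the symmetry of `P` appears. -/
theorem isElemInvolution_of_mul_self (h2 : (2 : K) ≠ 0) {σ : GA2 K}
    (hσ : σ ∈ letters (factor K) true) (hσ2 : σ * σ = 1) : IsElemInvolution σ := by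
  refine ⟨fun h => notMem_base_of_mem_letters hσ (mem_base_factor.2 h), ?_⟩
  obtain ⟨α, β, v, P, h, hP, hg⟩ := mem_letters_true.1 hσ
  have hP0 : P ≠ 0 := by rintro rfl; simp at hP
  have hsq := congrArg Units.val hσ2
  rw [Units.val_mul, hg, elemMap_mul, Units.val_one, ← elemMap_one] at hsq
  obtain ⟨hα, hPP, hβ, hv⟩ := elemMap_inj hsq
  rcases mul_self_eq_one_iff.1 hβ with rfl | rfl
  · left
    have hv0 : v = 0 := by
      have : 2 * v = 0 := by linear_combination hv
      exact (mul_eq_zero.1 this).resolve_left h2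
    subst hv0
    have h3 : (C α + 1) * P = 0 := by
      have : P.comp (C 1 * X + C 0) = P := by simp
      rw [this] at hPP
      linear_combination hPP
    have h4 : C (α + 1) = 0 := by simpa using (mul_eq_zero.1 h3).resolve_right hP0
    have h5 : α = -1 := eq_neg_of_add_eq_zero_left (C_eq_zero.1 h4)
    subst h5
    exact ⟨P, isElemMap_iff.2 hg⟩
  · right
    refine ⟨α, v, P, mul_self_eq_one_iff.1 hα, ?_, isElemMap_iff.2 hg⟩
    have : (C v - X : K[X]) = C (-1) * X + C v := by simp; ring
    rw [this]
    linear_combination hPP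

theorem IsElemInvolution.mem_letters {e : GA2 K} (he : IsElemInvolution e) :
    e ∈ letters (factor K) true := by
  obtain ⟨h0, h⟩ := he
  refine mem_letters_of_notMem_base ?_ (fun hb => h0 (mem_base_factor.1 hb))
  rcases h with ⟨P, h⟩ | ⟨α, v, P, hα, -, h⟩
  · exact mem_elementary.2 ⟨_, _, _, _, by simp, isElemMap_iff.1 h⟩
  · refine mem_elementary.2 ⟨_, _, _, _, ?_, isElemMap_iff.1 h⟩
    rcases hα with rfl | rfl <;> simp

theorem IsElemInvolution.mul_self {e : GA2 K} (he : IsElemInvolution e) : e * e = 1 := by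
  refine Units.ext ?_
  rw [Units.val_mul, Units.val_one, ← elemMap_one]
  rcases he.2 with ⟨P, h⟩ | ⟨α, v, P, hα, hP, h⟩
  · rw [isElemMap_iff.1 h, elemMap_mul]
    congr 1 <;> simp
  · rw [isElemMap_iff.1 h, elemMap_mul]
    have : (C (-1) * X + C v : K[X]) = C v - X := by simp; ring
    rw [this, hP]
    congr 1
    · rcases hα with rfl | rfl <;> simp
    · ring
    · simp
    · ring

/-- Elementary involutions are conjugate, by a basic map, to one of the special shapes. -/
theorem IsElemInvolution.exists_special (h2 : (2 : K) ≠ 0) {e : GA2 K} (he : IsElemInvolution e) :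
    ∃ b ∈ base (factor K), ∃ e', IsSpecialElemInvolution e' ∧ e = b * e' * b⁻¹ := by
  have : NeZero (2 : K) := ⟨h2⟩
  have hl := he.mem_letters
  rcases he.2 with ⟨P, h⟩ | ⟨α, v, P, hα, hP, h⟩
  · rw [isElemMap_iff] at h
    have hPdeg : ¬ P.natDegree ≤ 1 := fun hle =>
      hl.2 ((mem_affine_iff_natDegree_le (by simp) h).2 hle)
    have hPd : P = X ^ 2 * P.divX.divX + (C (P.divX.coeff 0) * X + C (P.coeff 0)) := by
      nth_rewrite 1 [← P.divX_mul_X_add, ← P.divX.divX_mul_X_add]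
      ring
    set γ := P.divX.coeff 0
    set u := P.coeff 0
    -- Conjugation by `x' = x + ℓ(y)` adds `2 ℓ` to the polynomial of `e'`, so half of the part of
    -- degree at most one is taken.
    obtain ⟨b, hb, -⟩ := exists_elem (one_ne_zero (α := K)) (C (γ / 2) * X + C (u / 2))
      (one_ne_zero (α := K)) 0
    obtain ⟨e', he', -⟩ := exists_elem (neg_ne_zero.2 (one_ne_zero (α := K)))
      (X ^ 2 * P.divX.divX) (one_ne_zero (α := K)) 0
    refine ⟨b, mem_base_iff.2 ⟨_, _, _, _, _, by simp, hb⟩, e',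
      Or.inl ⟨P.divX.divX, ?_, isElemMap_iff.2 he'⟩, ?_⟩
    · intro h0
      rw [h0, mul_zero, zero_add] at hPd
      apply hPdeg
      rw [hPd]
      exact natDegree_linear_le
    · rw [eq_mul_inv_iff_mul_eq]
      refine Units.ext ?_
      rw [Units.val_mul, Units.val_mul, h, hb, he', elemMap_mul, elemMap_mul]
      congr 1
      · simp
      · have e1 : P.comp (C 1 * X + C 0) = P := by simp
        have e2 : (C (γ / 2) * X + C (u / 2) : K[X]).comp (C 1 * X + C 0) =
            C (γ / 2) * X + C (u / 2) := by simp
        have e3 : (C γ : K[X]) = C (γ / 2) + C (γ / 2) := by rw [← C_add, add_halves]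
        have e4 : (C u : K[X]) = C (u / 2) + C (u / 2) := by rw [← C_add, add_halves]
        rw [e1, e2]
        nth_rewrite 1 [hPd]
        rw [e3, e4, C_neg, C_1]
        ring
  · rw [isElemMap_iff] at h
    have hαne : α ≠ 0 := by rcases hα with rfl | rfl <;> simp
    have hPdeg : ¬ P.natDegree ≤ 1 := fun hle =>
      hl.2 ((mem_affine_iff_natDegree_le (by simpa using hαne) h).2 hle)
    -- The reflection `y ↦ v - y` is centred at `v / 2`.
    obtain ⟨b, hb, -⟩ := exists_elem (one_ne_zero (α := K)) 0 (one_ne_zero (α := K)) (v / 2)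
    obtain ⟨e', he', -⟩ := exists_elem hαne (P.comp (X + C (v / 2)))
      (neg_ne_zero.2 (one_ne_zero (α := K))) 0
    have hdeg : (P.comp (X + C (v / 2))).natDegree = P.natDegree := by
      rw [natDegree_comp, natDegree_X_add_C, mul_one]
    have hsymm : (P.comp (X + C (v / 2))).comp (-X) = -C α * P.comp (X + C (v / 2)) := by
      have e1 : (X + C (v / 2) : K[X]).comp (-X) = (C v - X).comp (X + C (v / 2)) := by
        simp only [add_comp, X_comp, C_comp, sub_comp]
        have : (C v : K[X]) = C (v / 2) + C (v / 2) := by rw [← C_add, add_halves]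
        rw [this]
        ring
      rw [comp_assoc, e1, ← comp_assoc, hP]
      simp
    refine ⟨b, mem_base_iff.2 ⟨1, 0, 0, 1, v / 2, by simp, by simpa using hb⟩, e', ?_, ?_⟩
    · rcases hα with rfl | rfl
      · refine Or.inr (Or.inl ⟨_, by simpa using hsymm, ?_, isElemMap_iff.2 he'⟩)
        rw [hdeg]
        by_contra hlt
        -- An odd polynomial of degree two would have a leading coefficient equal to its negative.
        have hd2 : P.natDegree = 2 := by omega
        have hlc := congrArg leadingCoeff hsymm
        set P' := P.comp (X + C (v / 2))
        rw [leadingCoeff_comp (by rw [natDegree_neg, natDegree_X]; simp), leadingCoeff_neg,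
          leadingCoeff_X, hdeg, hd2, C_1, neg_one_mul, leadingCoeff_neg] at hlc
        have h3 : 2 * P'.leadingCoeff = 0 := by linear_combination hlc
        have h4 := leadingCoeff_eq_zero.1 ((mul_eq_zero.1 h3).resolve_left h2)
        rw [h4, natDegree_zero] at hdeg
        omega
      · refine Or.inr (Or.inr ⟨_, by simpa using hsymm, ?_, isElemMap_iff.2 he'⟩)
        rw [hdeg]
        omega
    · rw [eq_mul_inv_iff_mul_eq]
      refine Units.ext ?_
      rw [Units.val_mul, Units.val_mul, h, hb, he', elemMap_mul, elemMap_mul]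
      congr 1
      · simp
      · simp
      · simp
      · field_simp; ring

/-! ### Jacobians of the forms, normal forms and poly-degrees. -/

theorem jacobianDet_mul' (f g : GA2 K) : jacobianDet (f * g) = jacobianDet f * jacobianDet g := by
  obtain ⟨J, -, hJ⟩ := exists_jacobianDet_eq_C f
  rw [jacobianDet_mul, hJ, MvPolynomial.aeval_C, MvPolynomial.algebraMap_eq]

theorem jacobianDet_conj_mul (c σ τ : GA2 K) :
    jacobianDet (c * σ * c⁻¹ * τ) = jacobianDet σ * jacobianDet τ := by
  have h : jacobianDet c * jacobianDet c⁻¹ = 1 := by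
    rw [← jacobianDet_mul', mul_inv_cancel, jacobianDet_one]
  rw [jacobianDet_mul', jacobianDet_mul', jacobianDet_mul']
  linear_combination (jacobianDet σ * jacobianDet τ) * h

theorem jacobianDet_of_mul_self {σ : GA2 K} (h : σ * σ = 1) :
    jacobianDet σ = 1 ∨ jacobianDet σ = -1 := by
  rw [← mul_self_eq_one_iff, ← jacobianDet_mul', h, jacobianDet_one]

theorem isNormalForm_of_alt {b : GA2 K} (hb : b ∈ base (factor K)) {t : Bool} {w : List (GA2 K)}
    (hw : Alt (reps K) t w) : IsNormalForm (b * w.prod) b w := by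
  refine ⟨mem_base_factor.1 hb, ?_, ?_, rfl⟩
  · induction w generalizing t with
    | nil => simp
    | cons g u ih =>
      intro h hh
      rcases List.mem_cons.1 hh with rfl | hh
      · cases t
        · exact Or.inl hw.1
        · exact Or.inr hw.1
      · exact ih hw.2 h hh
  · induction w generalizing t with
    | nil => simp
    | cons g u ih =>
      rcases u with _ | ⟨g', u⟩
      · simp
      · rw [List.isChain_cons_cons]
        refine ⟨?_, ih hw.2⟩
        cases t
        · exact Or.inl ⟨hw.1, hw.2.1⟩
        · exact Or.inr ⟨hw.1, hw.2.1⟩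

theorem IsNormalForm.exists_alt {g b : GA2 K} {w : List (GA2 K)} (h : IsNormalForm g b w) :
    ∃ t, Alt (reps K) t w := by
  obtain ⟨-, hmem, hchain, -⟩ := h
  have hdisj : ∀ (s t : Bool) (a : GA2 K), a ∈ reps K s → a ∈ reps K t → s = t := by
    intro s t a hs ht
    by_contra hne
    have : t = !s := Bool.eq_not.2 fun h => hne h.symm
    subst this
    exact (reps_subset s hs).2 (reps_subset _ ht).1
  induction w with
  | nil => exact ⟨true, trivial⟩
  | cons a u ih =>
    rcases u with _ | ⟨a', u⟩
    · rcases hmem a (by simp) with h | h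
      · exact ⟨false, h, trivial⟩
      · exact ⟨true, h, trivial⟩
    · rw [List.isChain_cons_cons] at hchain
      obtain ⟨t, ht⟩ := ih (fun h hh => hmem h (List.mem_cons_of_mem _ hh)) hchain.2
      rcases hchain.1 with ⟨h1, h2⟩ | ⟨h1, h2⟩
      · obtain rfl := hdisj t true a' ht.1 h2
        exact ⟨false, h1, ht⟩
      · obtain rfl := hdisj t false a' ht.1 h2
        exact ⟨true, h1, ht⟩

-- Unlike membership in `cosetJ`, the condition `2 ≤ degree` is invariant under basic factors, so
-- poly-degrees can be read off arbitrary reduced words.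
open Classical in
theorem filter_map_degree {t : Bool} {w : List (GA2 K)} (hw : Alt (reps K) t w) :
    (w.filter (fun h => h ∈ cosetJ K)).map degree = (w.map degree).filter (2 ≤ ·) := by
  induction w generalizing t with
  | nil => simp
  | cons g u ih =>
    have hrec := ih hw.2
    cases t with
    | true =>
      have h1 : g ∈ cosetJ K := hw.1
      have h2 := two_le_degree_of_mem_letters (reps_subset true hw.1)
      simp only [List.filter_cons, h1, h2, List.map_cons, decide_true, if_true, hrec]
    | false =>
      have hl := reps_subset false hw.1
      have h1 : g ∉ cosetJ K := fun h => hl.2 (reps_subset true h).1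
      have h2 : ¬ 2 ≤ degree g := not_le.2 (degree_affine_lt hl.1)
      simp only [List.filter_cons, h1, h2, List.map_cons, decide_false]
      simpa [List.filter_cons, h1, h2] using hrec

/-- The list of the entries of a list of pairs. -/
def pairWord {G : Type*} (l : List (G × G)) : List G := l.flatMap fun p => [p.1, p.2]

@[simp]
theorem pairWord_cons {G : Type*} (p : G × G) (l : List (G × G)) :
    pairWord (p :: l) = p.1 :: p.2 :: pairWord l := rfl

theorem pairWord_length_bodd {G : Type*} (l : List (G × G)) : (pairWord l).length.bodd = false := by
  induction l with
  | nil => simp [pairWord]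
  | cons p l ih => simp [ih]

theorem pairWord_prod (l : List (GA2 K × GA2 K)) : (pairWord l).prod = InvForm.pairProd l := by
  induction l with
  | nil => rfl
  | cons p l ih =>
    rw [pairWord_cons, List.prod_cons, List.prod_cons, ih]
    simp [InvForm.pairProd, mul_assoc]

theorem alt_pairWord {G : Type*} {S : Bool → Set G} {t : Bool} {l : List (G × G)} :
    Alt S t (pairWord l) ↔ ∀ p ∈ l, p.1 ∈ S t ∧ p.2 ∈ S (!t) := by
  induction l with
  | nil => simp [pairWord]
  | cons p l ih => simp [ih, and_assoc]

theorem exists_eq_pairWord {G : Type*} {w : List G} (h : w.length.bodd = false) :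
    ∃ l, w = pairWord l := by
  induction hn : w.length using Nat.strong_induction_on generalizing w with
  | _ n ih =>
    rcases w with _ | ⟨a, _ | ⟨b, w⟩⟩
    · exact ⟨[], rfl⟩
    · simp at h
    · obtain ⟨l, rfl⟩ := ih w.length (by simp at hn; omega) (by simpa using h) rfl
      exact ⟨(a, b) :: l, rfl⟩

theorem pairWord_degrees_false {l : List (GA2 K × GA2 K)}
    (h : ∀ p ∈ l, p.1 ∈ cosetI K ∧ p.2 ∈ cosetJ K) :
    ((pairWord l).map degree).filter (2 ≤ ·) = l.map fun p => degree p.2 := by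
  induction l with
  | nil => rfl
  | cons p l ih =>
    have hp := h p (by simp)
    have h1 : ¬ 2 ≤ degree p.1 := not_le.2 (degree_affine_lt (reps_subset false hp.1).1)
    have h2 := two_le_degree_of_mem_letters (reps_subset true hp.2)
    simp [h1, h2, ← ih fun q hq => h q (List.mem_cons_of_mem _ hq)]

theorem pairWord_degrees_true {l : List (GA2 K × GA2 K)}
    (h : ∀ p ∈ l, p.1 ∈ cosetJ K ∧ p.2 ∈ cosetI K) :
    ((pairWord l).map degree).filter (2 ≤ ·) = l.map fun p => degree p.1 := by
  induction l with
  | nil => rfl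
  | cons p l ih =>
    have hp := h p (by simp)
    have h1 : ¬ 2 ≤ degree p.2 := not_le.2 (degree_affine_lt (reps_subset false hp.2).1)
    have h2 := two_le_degree_of_mem_letters (reps_subset true hp.1)
    simp [h1, h2, ← ih fun q hq => h q (List.mem_cons_of_mem _ hq)]

theorem degree_eq_one_of_mem_affine {a : GA2 K} (ha : a ∈ affine K) : degree a = 1 := by
  have h1 : degree (1 : GA2 K) = 1 := by simp [degree, PolyMap.one_def]
  have h2 := degree_affine_mul_le ((affSubgroup K).inv_mem ha) a
  rw [inv_mul_cancel, h1] at h2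
  have h3 := degree_affine_lt ha
  omega

theorem degree_inv_letter {t : Bool} {g : GA2 K} (hg : g ∈ letters (factor K) t) :
    degree g⁻¹ = degree g := by
  cases t
  · have ha : g ∈ affine K := hg.1
    rw [degree_eq_one_of_mem_affine ha,
      degree_eq_one_of_mem_affine ((affSubgroup K).inv_mem ha)]
  · exact degree_inv_of_mem_letters hg

/-! ### The forms (1)–(3) as reduced words. -/

namespace InvForm

/-- The data of a well-formed normal form in terms of reduced words. -/
theorem WellFormed.exists_word {D : InvForm K} (hD : D.WellFormed) :
    ∃ t w, D.lead ∈ base (factor K) ∧ Alt (reps K) (!t) w ∧ D.word = D.lead * w.prod ∧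
      D.outer ∈ letters (factor K) t ∧ D.inner ∈ letters (factor K) (!t ^^ w.length.bodd) ∧
      D.inner * D.inner = 1 ∧ D.outer * D.outer = 1 ∧
      D.degrees = (w.map degree ++ [degree D.inner] ++ (w.map degree).reverse ++
        [degree D.outer]).filter (2 ≤ ·) := by
  -- The filter drops the swap, which matches the entries absent from `degrees` in the first two
  -- forms.
  have hT : ¬ 2 ≤ degree (swap K) := not_le.2 (degree_affine_lt swap_mem_affine)
  rcases D with ⟨b, e, l⟩ | ⟨b, l, ehat⟩ | ⟨b, a, l, ehat, ebar⟩
  · obtain ⟨hb, he, hl⟩ := hD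
    refine ⟨false, e :: pairWord l, mem_base_factor.2 hb, ⟨he, alt_pairWord.2 hl⟩, ?_,
      swap_mem_letters, ?_, swap_mul_self, swap_mul_self, ?_⟩
    · simp [word, lead, pairWord_prod, mul_assoc]
    · simpa [inner, pairWord_length_bodd] using swap_mem_letters
    · have h2 := two_le_degree_of_mem_letters (reps_subset true he)
      simp [degrees, inner, outer, List.filter_append, List.filter_reverse,
        hT, h2, pairWord_degrees_false hl]
  · obtain ⟨hb, hl, he⟩ := hD
    refine ⟨false, pairWord l, mem_base_factor.2 hb, alt_pairWord.2 hl, ?_,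
      swap_mem_letters, ?_, he.mul_self, swap_mul_self, ?_⟩
    · simp [word, lead, pairWord_prod]
    · simpa [inner, pairWord_length_bodd] using he.mem_letters
    · have h2 := two_le_degree_of_mem_letters he.mem_letters
      simp [degrees, inner, outer, List.filter_append, List.filter_reverse,
        hT, h2, pairWord_degrees_true hl]
  · obtain ⟨hb, ha, hl, he, he'⟩ := hD
    refine ⟨true, a :: pairWord l, mem_base_factor.2 hb, ⟨ha, alt_pairWord.2 hl⟩, ?_,
      he'.mem_letters, ?_, he.mul_self, he'.mul_self, ?_⟩
    · simp [word, lead, pairWord_prod, mul_assoc]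
    · simpa [inner, pairWord_length_bodd] using he.mem_letters
    · have h1 : ¬ 2 ≤ degree a := not_le.2 (degree_affine_lt (reps_subset false ha).1)
      have h2 := two_le_degree_of_mem_letters he.mem_letters
      have h3 := two_le_degree_of_mem_letters he'.mem_letters
      simp [degrees, inner, outer, List.filter_append, List.filter_reverse,
        h1, h2, h3, pairWord_degrees_true hl]

theorem WellFormed.inner_mul_self {D : InvForm K} (hD : D.WellFormed) :
    D.inner * D.inner = 1 := by
  obtain ⟨t, w, -, -, -, -, -, h, -⟩ := hD.exists_word
  exact h

theorem WellFormed.outer_mul_self {D : InvForm K} (hD : D.WellFormed) :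
    D.outer * D.outer = 1 := by
  obtain ⟨t, w, -, -, -, -, -, -, h, -⟩ := hD.exists_word
  exact h

theorem WellFormed.outer_ne_one {D : InvForm K} (hD : D.WellFormed) : D.outer ≠ 1 := by
  obtain ⟨t, w, -, -, -, h, -⟩ := hD.exists_word
  intro h1
  exact notMem_base_of_mem_letters h (h1 ▸ one_mem _)

/-- A product `s τ` of two elements of square one is inverted by `τ`; `τ` has order two because, as
a letter, it is not the identity. -/
theorem WellFormed.isReversible {D : InvForm K} (hD : D.WellFormed) :
    IsReversibleByInvolution D.toGA2 := by
  have h1 := hD.inner_mul_self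
  have h2 := hD.outer_mul_self
  refine ⟨D.outer, ?_, ?_⟩
  · refine orderOf_eq_prime ?_ hD.outer_ne_one
    rw [pow_two, h2]
  · have e1 : D.inner⁻¹ = D.inner := inv_eq_of_mul_eq_one_left h1
    have e2 : D.outer⁻¹ = D.outer := inv_eq_of_mul_eq_one_left h2
    simp only [toGA2, mul_inv_rev, inv_inv, e1, e2, mul_assoc, h2, mul_one]

/-- The letters of the cyclically reduced word of a well-formed normal form. -/
theorem WellFormed.exists_reduced {D : InvForm K} (hD : D.WellFormed) :
    ∃ t b w, b ∈ base (factor K) ∧ Alt (letters (factor K)) t w ∧ w ≠ [] ∧ Even w.length ∧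
      D.toGA2 = b * w.prod ∧ D.degrees = (w.map degree).filter (2 ≤ ·) := by
  obtain ⟨t, w, hb, hw, hword, hout, hinn, -, -, hdeg⟩ := hD.exists_word
  have hw' := hw.mono reps_subset
  have hinv : ∀ (s : Bool) (u : List (GA2 K)), Alt (letters (factor K)) s u →
      (invWord u).map degree = (u.map degree).reverse := by
    intro s u hu
    induction u generalizing s with
    | nil => rfl
    | cons g u ih =>
      have : invWord (g :: u) = invWord u ++ [g⁻¹] := by simp [invWord]
      rw [this, List.map_append, ih _ hu.2]
      simp [degree_inv_letter hu.1]
  -- The inverse of the leading basic map is absorbed by the last involution, leaving `2 |w| + 2`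
  -- letters.
  refine ⟨!t, D.lead, w ++ D.inner :: (invWord w ++ [D.lead⁻¹ * D.outer]), hb, ?_, by simp, ?_,
    ?_, ?_⟩
  · rw [alt_append, alt_cons]
    refine ⟨hw', hinn, ?_⟩
    have h3 : Alt (letters (factor K)) (!!t) [D.lead⁻¹ * D.outer] := by
      rw [Bool.not_not]
      exact ⟨base_mul_mem_letters (inv_mem hb) hout, trivial⟩
    convert alt_invWord_append hw' h3 using 1
    cases t <;> cases w.length.bodd <;> rfl
  · simp only [List.length_append, List.length_cons, invWord_length, List.length_nil]
    exact ⟨w.length + 1, by ring⟩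
  · rw [toGA2, hword]
    simp [invWord_prod, mul_assoc]
  · rw [hdeg]
    simp only [List.map_append, List.map_cons, List.map_nil, hinv _ _ hw',
      (degree_baseInvariant D.outer _ (inv_mem hb)).1, List.append_assoc, List.cons_append,
      List.nil_append]

theorem WellFormed.exists_normalForm {D : InvForm K} (hD : D.WellFormed) :
    ∃ t b w, b ∈ base (factor K) ∧ Alt (reps K) t w ∧ w ≠ [] ∧ Even w.length ∧
      D.toGA2 = b * w.prod ∧ D.degrees = (w.map degree).filter (2 ≤ ·) := by
  obtain ⟨t, b, w, hb, hw, h0, heven, hD1, hdeg⟩ := hD.exists_reduced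
  obtain ⟨b', hb', w', hw', hprod, hmap⟩ := exists_normal_word degree_baseInvariant exists_reps hw
  have hlen : w'.length = w.length := by simpa using congrArg List.length hmap
  refine ⟨t, b * b', w', mul_mem hb hb', hw', ?_, hlen ▸ heven, ?_, hmap ▸ hdeg⟩
  · rintro rfl
    exact h0 (List.length_eq_zero_iff.1 hlen.symm)
  · rw [hD1, hprod, mul_assoc]

theorem WellFormed.isCyclicallyReduced {D : InvForm K} (hD : D.WellFormed) :
    IsCyclicallyReduced D.toGA2 := by
  obtain ⟨t, b, w, hb, hw, h0, heven, hD1, -⟩ := hD.exists_normalForm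
  exact ⟨b, w, hD1 ▸ isNormalForm_of_alt hb hw, heven, List.length_pos_iff.2 h0⟩

theorem WellFormed.hasPolyDegree {D : InvForm K} (hD : D.WellFormed) :
    HasPolyDegree D.toGA2 D.degrees := by
  classical
  obtain ⟨t, b, w, hb, hw, -, -, hD1, hdeg⟩ := hD.exists_normalForm
  refine ⟨b, w, hD1 ▸ isNormalForm_of_alt hb hw, ?_⟩
  rw [hdeg, ← filter_map_degree hw]

end InvForm

/-! ### Conjugacy invariance of the poly-degree. -/

theorem isRotated_filter {α : Type*} (p : α → Bool) {l l' : List α} (h : l ~r l') :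
    l.filter p ~r l'.filter p := by
  obtain ⟨n, hn, rfl⟩ := List.isRotated_iff_mod.1 h
  rw [List.rotate_eq_drop_append_take hn, List.filter_append]
  nth_rewrite 1 [← List.take_append_drop n l]
  rw [List.filter_append]
  exact List.isRotated_append

/-- The basic factor of a normal form can be absorbed into the first letter. -/
theorem IsNormalForm.exists_reduced_word {g b : GA2 K} {w : List (GA2 K)} (h : IsNormalForm g b w)
    (heven : Even w.length) (h0 : 0 < w.length) :
    ∃ t w', Alt (letters (factor K)) t w' ∧ w' ≠ [] ∧ Even w'.length ∧ g = w'.prod ∧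
      w'.map degree = w.map degree := by
  obtain ⟨t, ht⟩ := h.exists_alt
  have hl := ht.mono reps_subset
  rcases w with _ | ⟨x, u⟩
  · simp at h0
  refine ⟨t, b * x :: u, alt_base_mul (mem_base_factor.2 h.1) hl, by simp, by simpa using heven,
    ?_, ?_⟩
  · rw [h.2.2.2]
    simp [mul_assoc]
  · simp [(degree_baseInvariant x b (mem_base_factor.2 h.1)).1]

theorem IsCyclicallyReduced.exists_cycClass {g : GA2 K} (h : IsCyclicallyReduced g) :
    ∃ L, CycClass (factor K) degree L g := by
  obtain ⟨b, w, hn, heven, h0⟩ := h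
  obtain ⟨t, w', hw', hne, heven', rfl, -⟩ := hn.exists_reduced_word heven h0
  exact ⟨_, CycClass.of_word hw' hne heven' (List.IsRotated.refl _)⟩

/-- This is the hypothesis under which the shortening of `c σ c⁻¹ τ` ends in a reduced word. -/
theorem IsCR.not_isConj {f : GA2 K} (hf : IsCR f) (t : Bool) {a : GA2 K} (ha : a ∈ factor K t) :
    ¬ IsConj f a := by
  intro hfa
  obtain ⟨g, hfg, hg⟩ := hf
  obtain ⟨L, hL⟩ := hg.exists_cycClass
  exact (hL.of_isConj isAmalgam degree_baseInvariant (hfg.symm.trans hfa)).notMem isAmalgam t ha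

theorem HasPolyDegree.isRotated {f f' : GA2 K} {L L' : List ℕ} (hf : IsCyclicallyReduced f)
    (hL : HasPolyDegree f L) (hf' : IsCyclicallyReduced f') (hL' : HasPolyDegree f' L')
    (h : IsConj f f') : L' ~r L ∧ ∀ n ∈ L', 2 ≤ n := by
  classical
  -- The two hypotheses may refer to different normal forms; uniqueness of reduced words up to the
  -- base reconciles their degrees.
  have key : ∀ (g : GA2 K) (M : List ℕ), IsCyclicallyReduced g → HasPolyDegree g M →
      ∃ t w, Alt (letters (factor K)) t w ∧ w ≠ [] ∧ Even w.length ∧ g = w.prod ∧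
        M = (w.map degree).filter (2 ≤ ·) := by
    rintro g M ⟨b, w, hn, heven, h0⟩ ⟨b', w', hn', rfl⟩
    obtain ⟨t, w₁, hw₁, hne, heven₁, rfl, hmap⟩ := hn.exists_reduced_word heven h0
    obtain ⟨t', ht'⟩ := hn'.exists_alt
    refine ⟨t, w₁, hw₁, hne, heven₁, rfl, ?_⟩
    rw [filter_map_degree ht', isAmalgam.map_eq_of_prod_eq degree_baseInvariant hw₁
      (ht'.mono reps_subset) (mem_base_factor.2 hn'.1) hn'.2.2.2]
  obtain ⟨t, w, hw, hne, heven, rfl, rfl⟩ := key f L hf hL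
  obtain ⟨t', w', hw', hne', heven', rfl, rfl⟩ := key f' L' hf' hL'
  have hC : CycClass (factor K) degree (w.map degree) w.prod :=
    CycClass.of_word hw hne heven (List.IsRotated.refl _)
  have hC' := hC.of_isConj isAmalgam degree_baseInvariant h
  refine ⟨isRotated_filter _ (hC'.isRotated_of_word isAmalgam degree_baseInvariant hw' heven'), ?_⟩
  intro n hn
  simpa using (List.mem_filter.1 hn).2

theorem IsReversibleByInvolution.of_isConj {f g : GA2 K} (hg : IsReversibleByInvolution g)
    (h : IsConj f g) : IsReversibleByInvolution f := by
  obtain ⟨c, rfl⟩ := isConj_iff.1 h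
  obtain ⟨r, hr, hrg⟩ := hg
  refine ⟨c⁻¹ * r * c, ?_, ?_⟩
  · have := (MulAut.conj c⁻¹).orderOf_eq r
    rw [MulAut.conj_apply, inv_inv] at this
    rw [this, hr]
  · have : c⁻¹ * r * c * f * (c⁻¹ * r * c)⁻¹ = c⁻¹ * (r * (c * f * c⁻¹) * r⁻¹) * c := by group
    rw [this, hrg]
    group

/-! ### Reversible elements are conjugate to the standard forms. -/

/-- The standard involutions in the two factors. -/
def IsStandardInvolution : Bool → GA2 K → Prop
  | true, e => IsSpecialElemInvolution e
  | false, e => e = swap K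

theorem exists_standard (h2 : (2 : K) ≠ 0) {t : Bool} {σ : GA2 K}
    (hσ : σ ∈ letters (factor K) t) (hσ2 : σ * σ = 1) :
    ∃ b ∈ base (factor K), ∃ σ' ∈ letters (factor K) t, IsStandardInvolution t σ' ∧
      σ' * σ' = 1 ∧ σ = b * σ' * b⁻¹ := by
  obtain ⟨b, hb, σ', hs, h⟩ : ∃ b ∈ base (factor K), ∃ σ', IsStandardInvolution t σ' ∧
      σ = b * σ' * b⁻¹ := by
    cases t
    · obtain ⟨b, hb, h⟩ := exists_eq_conj_swap h2 hσ hσ2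
      exact ⟨b, hb, _, rfl, h⟩
    · exact (isElemInvolution_of_mul_self h2 hσ hσ2).exists_special h2
  have h' : σ' = b⁻¹ * σ * b := by rw [h]; group
  refine ⟨b, hb, σ', ?_, hs, ?_, h⟩
  · rw [h']
    exact mul_base_mem_letters hb (base_mul_mem_letters (inv_mem hb) hσ)
  · have : σ' * σ' = b⁻¹ * (σ * σ) * b := by rw [h']; group
    rw [this, hσ2]
    group

/-- Elements that are inverted by an involution, in terms of reduced words. -/
theorem IsReversibleByInvolution.exists_word {f : GA2 K} (hf : IsCR f)
    (hr : IsReversibleByInvolution f) :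
    ∃ t τ w σ, Alt (letters (factor K)) t (τ :: (w ++ [σ])) ∧ σ * σ = 1 ∧ τ * τ = 1 ∧
      IsConj f (w.prod * σ * w.prod⁻¹ * τ) ∧ (t = true → w.length.bodd = true) := by
  obtain ⟨r, hr2, hrf⟩ := hr
  have hrr : r * r = 1 := by rw [← pow_two, ← hr2, pow_orderOf_eq_one]
  have hri : r⁻¹ = r := inv_eq_of_mul_eq_one_left hrr
  -- Thus `f = (f r) r` is a product of two elements of square one.
  have hs : (f * r) * (f * r) = 1 := by
    rw [hri] at hrf
    rw [mul_assoc, ← mul_assoc r f r, hrf, mul_inv_cancel]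
  obtain ⟨t, τ, w, σ, hw, hσ, hτ, hc⟩ := isAmalgam.exists_involution_form
    (f := f) (s := f * r) (r := r) (by rw [mul_assoc, hrr, mul_one]) hs hrr
    (fun t a ha => hf.not_isConj t ha)
  -- The remaining case has `τ` elementary and `σ` affine. Conjugation by `(w σ)⁻¹` exchanges them,
  -- turning it into the second form.
  by_cases ht : t = true → w.length.bodd = true
  · exact ⟨t, τ, w, σ, hw, hσ, hτ, hc, ht⟩
  · push Not at ht
    obtain ⟨rfl, hb⟩ := ht
    rw [Ne, Bool.not_eq_true] at hb
    rw [alt_cons, alt_append, hb] at hw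
    refine ⟨false, σ, invWord w, τ, ?_, hτ, hσ, ?_, by simp⟩
    · rw [alt_cons, alt_append, invWord_length, hb]
      refine ⟨hw.2.2.1, ?_, hw.1, trivial⟩
      simpa [hb] using alt_invWord hw.2.1
    · refine hc.trans (isConj_iff.2 ⟨(w.prod * σ)⁻¹, ?_⟩)
      rw [invWord_prod]
      group

/-- Both involutions are standardised by basic conjugators. That of `σ` joins `w` and is carried to
the left by the normal form; that of `τ` is removed by a conjugation of the whole product. -/
theorem IsReversibleByInvolution.exists_standard_word (h2 : (2 : K) ≠ 0) {f : GA2 K} (hf : IsCR f)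
    (hr : IsReversibleByInvolution f) :
    ∃ t τ w σ b, b ∈ base (factor K) ∧ Alt (reps K) (!t) w ∧ τ ∈ letters (factor K) t ∧
      σ ∈ letters (factor K) (!t ^^ w.length.bodd) ∧ σ * σ = 1 ∧ τ * τ = 1 ∧
      IsStandardInvolution t τ ∧ IsStandardInvolution (!t ^^ w.length.bodd) σ ∧
      IsConj f (b * w.prod * σ * (b * w.prod)⁻¹ * τ) ∧ (t = true → w.length.bodd = true) := by
  obtain ⟨t, τ, w, σ, hw, hσ2, hτ2, hc, ht⟩ := hr.exists_word hf
  rw [alt_cons, alt_append] at hw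
  obtain ⟨hτ, hw, hσ, -⟩ := hw
  obtain ⟨bτ, hbτ, τ', hτ', hsτ, hτ2', rfl⟩ := exists_standard h2 hτ hτ2
  obtain ⟨bσ, hbσ, σ', hσ', hsσ, hσ2', rfl⟩ := exists_standard h2 hσ hσ2
  obtain ⟨b, hb, w', hw', hprod, hmap⟩ :
      ∃ b ∈ base (factor K), ∃ w', Alt (reps K) (!t) w' ∧ w.prod * bσ = b * w'.prod ∧
        w'.map degree = w.map degree := by
    rcases List.eq_nil_or_concat w with rfl | ⟨u, x, rfl⟩
    · exact ⟨bσ, hbσ, [], trivial, by simp, rfl⟩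
    · rw [List.concat_eq_append] at *
      obtain ⟨b, hb, w', hw', hprod, hmap⟩ := exists_normal_word degree_baseInvariant exists_reps
        (alt_mul_base hbσ hw)
      refine ⟨b, hb, w', hw', ?_, ?_⟩
      · rw [← hprod]
        simp [mul_assoc]
      · rw [hmap]
        simp [(degree_baseInvariant x bσ hbσ).2]
  have hlen : w'.length = w.length := by simpa using congrArg List.length hmap
  refine ⟨t, τ', w', σ', bτ⁻¹ * b, mul_mem (inv_mem hbτ) hb, hw', hτ', hlen ▸ hσ', hσ2', hτ2',
    hsτ, hlen ▸ hsσ, ?_, hlen ▸ ht⟩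
  refine hc.trans (isConj_iff.2 ⟨bτ⁻¹, ?_⟩)
  rw [mul_assoc bτ⁻¹ b, ← hprod]
  group

namespace InvForm

/-- The type of `τ` and the parity of `w` select the form: `τ` affine gives the second form for even
length and the first for odd length, `τ` elementary gives the third. -/
theorem exists_special (h2 : (2 : K) ≠ 0) {f : GA2 K} (hf : IsCR f)
    (hr : IsReversibleByInvolution f) :
    ∃ D : InvForm K, D.WellFormed ∧ D.SpecialInvolutions ∧ IsConj f D.toGA2 := by
  obtain ⟨t, τ, w, σ, b, hb, hw, hτ, hσ, hσ2, hτ2, hsτ, hsσ, hc, ht⟩ :=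
    hr.exists_standard_word h2 hf
  rw [mem_base_factor] at hb
  cases t with
  | false =>
    obtain rfl : τ = swap K := hsτ
    cases hlen : w.length.bodd with
    | false =>
      rw [hlen] at hσ hsσ
      obtain ⟨l, rfl⟩ := exists_eq_pairWord hlen
      refine ⟨two b l σ, ⟨hb, alt_pairWord.1 hw, isElemInvolution_of_mul_self h2 hσ hσ2⟩, hsσ, ?_⟩
      rwa [pairWord_prod] at hc
    | true =>
      rw [hlen] at hsσ
      obtain rfl : σ = swap K := hsσ
      rcases w with _ | ⟨e, u⟩
      · simp at hlen
      obtain ⟨l, rfl⟩ := exists_eq_pairWord (w := u) (by simpa using hlen)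
      refine ⟨one b e l, ⟨hb, hw.1, alt_pairWord.1 hw.2⟩, trivial, ?_⟩
      rwa [List.prod_cons, pairWord_prod, ← mul_assoc] at hc
  | true =>
    have hlen := ht rfl
    rw [hlen] at hσ hsσ
    rcases w with _ | ⟨a, u⟩
    · simp at hlen
    obtain ⟨l, rfl⟩ := exists_eq_pairWord (w := u) (by simpa using hlen)
    refine ⟨three b a l σ τ, ⟨hb, hw.1, alt_pairWord.1 hw.2,
      isElemInvolution_of_mul_self h2 hσ hσ2, isElemInvolution_of_mul_self h2 hτ hτ2⟩,
      ⟨hsσ, hsτ⟩, ?_⟩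
    rwa [List.prod_cons, pairWord_prod, ← mul_assoc] at hc

/-- In the third form `b` can be moved into the last involution, which then need not keep a special
shape. -/
theorem WellFormed.exists_leadAbsent (h2 : (2 : K) ≠ 0) {D : InvForm K} (hD : D.WellFormed) :
    ∃ D' : InvForm K, D'.WellFormed ∧ D'.LeadAbsentInThree ∧ IsConj D.toGA2 D'.toGA2 := by
  rcases D with ⟨b, e, l⟩ | ⟨b, l, ehat⟩ | ⟨b, a, l, ehat, ebar⟩
  · exact ⟨_, hD, trivial, IsConj.refl _⟩
  · exact ⟨_, hD, trivial, IsConj.refl _⟩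
  · obtain ⟨hb, ha, hl, he, he'⟩ := hD
    have hb' := mem_base_factor.2 hb
    refine ⟨three 1 a l ehat (b⁻¹ * ebar * b), ⟨mem_base_factor.1 (one_mem _), ha, hl, he, ?_⟩,
      rfl, isConj_iff.2 ⟨b⁻¹, ?_⟩⟩
    · refine isElemInvolution_of_mul_self h2
        (mul_base_mem_letters hb' (base_mul_mem_letters (inv_mem hb') he'.mem_letters)) ?_
      have : b⁻¹ * ebar * b * (b⁻¹ * ebar * b) = b⁻¹ * (ebar * ebar) * b := by group
      rw [this, he'.mul_self]
      group
    · simp only [toGA2, word, inner, outer]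
      group

/-- Multiplying the leading element by a basic map that commutes with the last involution. -/
theorem WellFormed.exists_lead_mul {D : InvForm K} (hD : D.WellFormed) {c : GA2 K}
    (hc : c ∈ basic K) (hcomm : c * D.outer = D.outer * c) :
    ∃ D' : InvForm K, D'.WellFormed ∧ D'.lead = c * D.lead ∧ D'.outer = D.outer ∧
      (D.SpecialInvolutions → D'.SpecialInvolutions) ∧ IsConj D.toGA2 D'.toGA2 := by
  have hmul : ∀ b ∈ basic K, c * b ∈ basic K := fun b hb =>
    mem_base_factor.1 (mul_mem (mem_base_factor.2 hc) (mem_base_factor.2 hb))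
  have hconj : ∀ d σ τ : GA2 K, c * τ = τ * c →
      IsConj (d * σ * d⁻¹ * τ) (c * d * σ * (c * d)⁻¹ * τ) := by
    intro d σ τ h
    refine isConj_iff.2 ⟨c, ?_⟩
    have h' : τ * c⁻¹ = c⁻¹ * τ := by rw [mul_inv_eq_iff_eq_mul, mul_assoc, ← h]; group
    simp only [mul_inv_rev, mul_assoc, h']
  rcases D with ⟨b, e, l⟩ | ⟨b, l, ehat⟩ | ⟨b, a, l, ehat, ebar⟩
  · refine ⟨one (c * b) e l, ⟨hmul b hD.1, hD.2⟩, rfl, rfl, id, ?_⟩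
    simpa only [toGA2, word, inner, outer, mul_assoc c] using hconj (b * e * pairProd l) _ _ hcomm
  · refine ⟨two (c * b) l ehat, ⟨hmul b hD.1, hD.2⟩, rfl, rfl, id, ?_⟩
    simpa only [toGA2, word, inner, outer, mul_assoc c] using hconj (b * pairProd l) _ _ hcomm
  · refine ⟨three (c * b) a l ehat ebar, ⟨hmul b hD.1, hD.2⟩, rfl, rfl, id, ?_⟩
    simpa only [toGA2, word, inner, outer, mul_assoc c] using hconj (b * a * pairProd l) _ _ hcomm

end InvForm

end PlaneAut

open PlaneAut in
theorem mainTheorem8 {K : Type*} [Field K] (hK : ringChar K ≠ 2) (f : GA2 K) (hf : IsCR f) :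
    (IsReversibleByInvolution f ↔
      ∃ D : InvForm K, D.WellFormed ∧ D.LeadAbsentInThree ∧ IsConj f D.toGA2) ∧
    (∀ R : GA2 K → Set (GA2 K), (∀ τ, IsRepresentativeSet (R τ) τ) →
      (IsReversibleByInvolution f ↔
        ∃ D : InvForm K, D.WellFormed ∧ D.lead ∈ R D.outer ∧ D.SpecialInvolutions ∧
          IsConj f D.toGA2)) ∧
    (∀ D : InvForm K, D.WellFormed →
      IsCyclicallyReduced D.toGA2 ∧ HasPolyDegree D.toGA2 D.degrees ∧
      jacobianDet D.toGA2 = jacobianDet D.inner * jacobianDet D.outer ∧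
      (jacobianDet D.inner = 1 ∨ jacobianDet D.inner = -1) ∧
      (jacobianDet D.outer = 1 ∨ jacobianDet D.outer = -1)) ∧
    (∀ D : InvForm K, D.WellFormed → IsConj f D.toGA2 →
      ∀ f' : GA2 K, IsConj f f' → IsCyclicallyReduced f' →
        ∀ L : List ℕ, HasPolyDegree f' L →
          L.IsRotated D.degrees ∧ ∀ n ∈ L, 2 ≤ n) := by
  have h2 : (2 : K) ≠ 0 := Ring.two_ne_zero hK
  refine ⟨⟨fun hr => ?_, ?_⟩, fun R hR => ⟨fun hr => ?_, ?_⟩, fun D hD => ?_, ?_⟩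
  · obtain ⟨D, hD, -, hc⟩ := InvForm.exists_special h2 hf hr
    obtain ⟨D', hD', hl, hc'⟩ := hD.exists_leadAbsent h2
    exact ⟨D', hD', hl, hc.trans hc'⟩
  · rintro ⟨D, hD, -, hc⟩
    exact hD.isReversible.of_isConj hc
  · obtain ⟨D, hD, hs, hc⟩ := InvForm.exists_special h2 hf hr
    obtain ⟨t, w, hb, -⟩ := hD.exists_word
    -- Conjugation by `c` in the centraliser fixes the last involution, so `R D.outer` remains the
    -- relevant set of representatives.
    obtain ⟨c, hcb, hcomm, hcR⟩ := (hR D.outer).2 D.lead (mem_base_factor.1 hb)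
    obtain ⟨D', hD', hlead, houter, hs', hc'⟩ := hD.exists_lead_mul hcb hcomm
    exact ⟨D', hD', by rwa [hlead, houter], hs' hs, hc.trans hc'⟩
  · rintro ⟨D, hD, -, -, hc⟩
    exact hD.isReversible.of_isConj hc
  · exact ⟨hD.isCyclicallyReduced, hD.hasPolyDegree, jacobianDet_conj_mul _ _ _,
      jacobianDet_of_mul_self hD.inner_mul_self, jacobianDet_of_mul_self hD.outer_mul_self⟩
  · intro D hD hc f' hf' hcr L hL
    exact HasPolyDegree.isRotated hD.isCyclicallyReduced hD.hasPolyDegree hcr hL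
      (hc.symm.trans hf')
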